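/- Let $v_0\in L^2(\mathbb R^n;\mathbb R^n)$ with $\operatorname{div}v_0=0$ in the sense of distributions. Let $\lambda$ be a nonnegative Radon measure on $[0,\infty)\times\mathbb R^n$, let $\nu=(\nu_{t,x})$ be a Lebesgue-measurable family of probability measures on $\mathbb R^n$ with $(t,x)\mapsto\langle\nu_{t,x},|\xi|^2\rangle$ integrable on compact subsets of $[0,\infty)\times\mathbb R^n$, and let $\nu^\infty=(\nu^\infty_{t,x})$ be a $\lambda$-measurable family of probability measures on $S^{n-1}$. Write $\bar\nu(t,x)=\langle\nu_{t,x},\xi\rangle$. Suppose that $(\nu,\nu^\infty,\lambda)$ is an admissible measure-valued solution of the incompressible Euler equations with initial data $v_0$, that is: 1. $\operatorname{div}\bar\nu=0$ in the sense of distributions on $(0,\infty)\times\mathbb R^n$; 2. for all $\varphi\in C_c(\mathbb R^n)$ and $\chi\in C_c([0,\infty))$, $$\int_0^\infty\!\!\int_{\mathbb R^n}\varphi(x)\chi(t)\langle\nu_{t,x},|\xi|^2\rangle\,dx\,dt+\int_{[0,\infty)\times\mathbb R^n}\varphi(x)\chi(t)\,d\lambda\le\|\varphi\|_\infty\|\chi\|_{1}\int_{\mathbb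 R^n}|v_0|^2\,dx;$$ 3. for all $\phi\in C_c^\infty([0,\infty)\times\mathbb R^n;\mathbb R^n)$ with $\operatorname{div}_x\phi=0$, $$\int_0^\infty\!\!\int_{\mathbb R^n}\partial_t\phi\cdot\bar\nu+\nabla\phi:\langle\nu_{t,x},\xi\otimes\xi\rangle\,dx\,dt+\int_{[0,\infty)\times\mathbb R^n}\nabla\phi:\langle\nu^\infty_{t,x},\theta\otimes\theta\rangle\,d\lambda=-\int_{\mathbb R^n}\phi(0,x)\cdot v_0(x)\,dx.$$ Then, after redefinition on a null set of times, $v:=\bar\nu$ is a dissipative solution in the sense of Lions with initial data $v_0$; that is, there is a function $v:[0,\infty)\to L^2(\mathbb R^n;\mathbb R^n)$ with $v(t)=\bar\nu(t,\cdot)$ a.e. in $\mathbb R^n$ for a.e. $t\ge0$, such that (a) $v$ is bounded, $v\in C([0,\infty);L^2_w(\mathbb R^n))$, $v(0)=v_0$, and $\operatorname{div}v(t)=0$ for every $t\ge 0$; (b) for every $T>0$ and every $w\in C([0,T];L^2(\mathbb R^n;\mathbb R^n))$ with $\operatorname{div}w=0$, $S(w):=\tfrac12(\nabla w+\nabla w^T)\in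 L^1(0,T;L^\infty(\mathbb R^n))$ and $E(w):=-\partial_tw-P\operatorname{div}(w\otimes w)\in L^1(0,T;L^2(\mathbb R^n))$, where $P$ is the Leray projector onto divergence-free fields, and for every $t\in[0,T]$, $$\int_{\mathbb R^n}|v-w|^2(t)\,dx\le e^{2\int_0^t\|S^-(w)\|_{\infty}d\tau}\int_{\mathbb R^n}|v_0-w(0)|^2\,dx+2\int_0^t\!\!\int_{\mathbb R^n}e^{2\int_s^t\|S^-(w)\|_{\infty}d\tau}\,E(w)\cdot(v-w)\,dx\,ds,$$ where $S^-(w)=\bigl(\sup_{|\eta|=1}-(S(w)\eta,\eta)\bigr)^+$ and $\|\cdot\|_\infty$ is the norm of $L^\infty(\mathbb R^n)$ at fixed time. -/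

import Mathlib

open MeasureTheory Set Filter Topology
open scoped ContDiff RealInnerProductSpace

noncomputable section

/-- The space `ℝⁿ` with its Euclidean structure. -/
abbrev Eucl (n : ℕ) : Type := EuclideanSpace ℝ (Fin n)

/-- The Hilbert space `L²(ℝⁿ; ℝⁿ)`. -/
abbrev L2 (n : ℕ) : Type := Lp (Eucl n) 2 (volume : Measure (Eucl n))

/-- Lebesgue measure `dx dt` on `[0,∞) × ℝⁿ` (points are written `(t, x)`). -/
def spaceTime (n : ℕ) : Measure (ℝ × Eucl n) :=
  (volume : Measure (ℝ × Eucl n)).restrict (Ici 0 ×ˢ univ)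

/-- The spatial gradient matrix `(∂_j φ_i)(t, x)` of a field `φ(t, x)`. -/
def gradMat {n : ℕ} (φ : ℝ × Eucl n → Eucl n) (z : ℝ × Eucl n) : Matrix (Fin n) (Fin n) ℝ :=
  fun i j => (fderiv ℝ (fun x => φ (z.1, x)) z.2 (EuclideanSpace.single j 1)) i

/-- The spatial divergence of a field `φ(t, x)`. -/
def spaceDiv {n : ℕ} (φ : ℝ × Eucl n → Eucl n) (z : ℝ × Eucl n) : ℝ :=
  ∑ i, gradMat φ z i i

/-- The time derivative of a field `φ(t, x)`. -/
def timeDeriv {n : ℕ} (φ : ℝ × Eucl n → Eucl n) (z : ℝ × Eucl n) : Eucl n :=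
  deriv (fun s => φ (s, z.2)) z.1

/-- The spatial gradient of a scalar function `ψ(t, x)`. -/
def spaceGrad {n : ℕ} (ψ : ℝ × Eucl n → ℝ) (z : ℝ × Eucl n) : Eucl n :=
  gradient (fun x => ψ (z.1, x)) z.2

/-- The contraction `A : B = ∑ᵢⱼ Aᵢⱼ Bᵢⱼ`. -/
def contract {n : ℕ} (A B : Matrix (Fin n) (Fin n) ℝ) : ℝ := ∑ i, ∑ j, A i j * B i j

/-- `div u = 0` in the sense of distributions on `ℝⁿ`. -/
def IsDivFree {n : ℕ} (u : Eucl n → Eucl n) : Prop :=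
  ∀ ψ : Eucl n → ℝ, ContDiff ℝ ∞ ψ → HasCompactSupport ψ → ∫ x, ⟪u x, gradient ψ x⟫ = 0

/-- A generalized Young measure `(ν, ν^∞, λ)` on `[0,∞) × ℝⁿ` for the exponent `p = 2`: a
nonnegative Radon measure `λ` on `[0,∞) × ℝⁿ` (viewed as a measure on `ℝ × ℝⁿ` that does not charge
negative times), a Lebesgue-measurable family `ν` of probability measures on `ℝⁿ` and a
`λ`-measurable family `ν^∞` of probability measures on the unit sphere. The second moments of `ν`
are locally integrable up to time `0`, so that all brackets below are meaningful. -/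
structure GeneralizedYoungMeasure (n : ℕ) where
  /-- the oscillation measures `ν_{t,x}` -/
  osc : ℝ × Eucl n → Measure (Eucl n)
  /-- the concentration-angle measures `ν^∞_{t,x}` -/
  angle : ℝ × Eucl n → Measure (Metric.sphere (0 : Eucl n) 1)
  /-- the concentration measure `λ` -/
  conc : Measure (ℝ × Eucl n)
  conc_radon : IsLocallyFiniteMeasure conc
  conc_neg : conc (Iio 0 ×ˢ univ) = 0
  osc_meas : AEMeasurable osc (spaceTime n)
  osc_prob : ∀ᵐ z ∂(spaceTime n), IsProbabilityMeasure (osc z)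
  angle_meas : AEMeasurable angle conc
  angle_prob : ∀ᵐ z ∂conc, IsProbabilityMeasure (angle z)
  osc_moment : ∀ K : Set (ℝ × Eucl n), IsCompact K →
    ∫⁻ z in K, (∫⁻ ξ, ‖ξ‖ₑ ^ 2 ∂(osc z)) ∂(spaceTime n) < ⊤

namespace GeneralizedYoungMeasure

variable {n : ℕ}

/-- The barycenter `⟨ν_{t,x}, ξ⟩`. -/
def barycenter (Y : GeneralizedYoungMeasure n) (z : ℝ × Eucl n) : Eucl n := ∫ ξ, ξ ∂(Y.osc z)

/-- The matrix `⟨ν_{t,x}, ξ ⊗ ξ⟩`. -/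
def oscMoment (Y : GeneralizedYoungMeasure n) (z : ℝ × Eucl n) : Matrix (Fin n) (Fin n) ℝ :=
  fun i j => ∫ ξ, ξ i * ξ j ∂(Y.osc z)

/-- The matrix `⟨ν^∞_{t,x}, θ ⊗ θ⟩`. -/
def angleMoment (Y : GeneralizedYoungMeasure n) (z : ℝ × Eucl n) : Matrix (Fin n) (Fin n) ℝ :=
  fun i j => ∫ θ : Metric.sphere (0 : Eucl n) 1, (θ : Eucl n) i * (θ : Eucl n) j ∂(Y.angle z)

/-- `(ν, ν^∞, λ)` is an admissible measure-valued solution of the incompressible Euler equations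
with initial data `v₀`. A function in `C_c([0,∞))` or `C_c^∞([0,∞) × ℝⁿ)` is the restriction of one
in `C_c(ℝ)` or `C_c^∞(ℝ × ℝⁿ)`; only its values at times `t ≥ 0` matter. -/
structure IsAdmissible (Y : GeneralizedYoungMeasure n) (v₀ : L2 n) : Prop where
  /-- `div ⟨ν, ξ⟩ = 0` in the sense of distributions on `(0,∞) × ℝⁿ` -/
  div_free : ∀ ψ : ℝ × Eucl n → ℝ, ContDiff ℝ ∞ ψ → HasCompactSupport ψ →
    tsupport ψ ⊆ Ioi 0 ×ˢ univ →
    ∫ z, ⟪Y.barycenter z, spaceGrad ψ z⟫ ∂(spaceTime n) = 0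
  /-- the energy inequality -/
  energy : ∀ (φ : Eucl n → ℝ) (χ : ℝ → ℝ), Continuous φ → HasCompactSupport φ →
    Continuous χ → HasCompactSupport χ →
    ∫ z, φ z.2 * χ z.1 * (∫ ξ, ‖ξ‖ ^ 2 ∂(Y.osc z)) ∂(spaceTime n)
      + ∫ z, φ z.2 * χ z.1 ∂Y.conc
      ≤ (⨆ x, |φ x|) * (∫ t in Ici (0 : ℝ), |χ t|) * ∫ x, ‖v₀ x‖ ^ 2
  /-- the momentum equation with initial data, tested with solenoidal fields -/
  momentum : ∀ φ : ℝ × Eucl n → Eucl n, ContDiff ℝ ∞ φ → HasCompactSupport φ →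
    (∀ t, 0 ≤ t → ∀ x, spaceDiv φ (t, x) = 0) →
    ∫ z, (⟪timeDeriv φ z, Y.barycenter z⟫ + contract (gradMat φ z) (Y.oscMoment z)) ∂(spaceTime n)
      + ∫ z, contract (gradMat φ z) (Y.angleMoment z) ∂Y.conc
      = - ∫ x, ⟪φ (0, x), v₀ x⟫

end GeneralizedYoungMeasure

/-- `A⁻ = (sup_{|ξ| = 1} -(Aξ, ξ))⁺`, the negative part of the smallest eigenvalue when `A` is
symmetric. -/
def negPartForm {n : ℕ} (A : Eucl n →L[ℝ] Eucl n) : ℝ :=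
  max 0 (⨆ ξ : Metric.sphere (0 : Eucl n) 1, -⟪A ξ, (ξ : Eucl n)⟫)

/-- `S` is the symmetric gradient `(∇w + ∇wᵀ)/2` of `w`, in the sense of distributions on
`(0,T) × ℝⁿ`, and it belongs to `L¹(0,T; L^∞(ℝⁿ))`. -/
structure IsSymGrad {n : ℕ} (T : ℝ) (w : ℝ → L2 n)
    (S : ℝ × Eucl n → (Eucl n →L[ℝ] Eucl n)) : Prop where
  meas : AEStronglyMeasurable S ((volume : Measure (ℝ × Eucl n)).restrict (Ioo 0 T ×ˢ univ))
  bound : ∫⁻ t in Ioo 0 T, eLpNorm (fun x => S (t, x)) ⊤ (volume : Measure (Eucl n)) < ⊤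
  weak : ∀ ψ : ℝ × Eucl n → ℝ, ContDiff ℝ ∞ ψ → HasCompactSupport ψ →
    tsupport ψ ⊆ Ioo 0 T ×ˢ univ → ∀ i j : Fin n,
    ∫ t in Ioo 0 T, ∫ x, (w t x i * spaceGrad ψ (t, x) j + w t x j * spaceGrad ψ (t, x) i) / 2
      = - ∫ t in Ioo 0 T, ∫ x, ψ (t, x) * (S (t, x) (EuclideanSpace.single j 1)) i

/-- `f = E(w) = -∂ₜ w - P div (w ⊗ w)` on `(0,T) × ℝⁿ`, `P` being the Leray projector onto
solenoidal fields, and `f` belongs to `L¹(0,T; L²(ℝⁿ))`. In the sense of distributions this means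
that `f` is solenoidal, like `w`, and agrees with `-∂ₜ w - div (w ⊗ w)` up to a gradient, that is,
when tested with solenoidal fields. -/
structure IsResidual {n : ℕ} (T : ℝ) (w f : ℝ → L2 n) : Prop where
  integrable : IntegrableOn f (Ioo 0 T)
  div_free : ∀ᵐ t ∂(volume.restrict (Ioo 0 T)), IsDivFree (f t)
  weak : ∀ φ : ℝ × Eucl n → Eucl n, ContDiff ℝ ∞ φ → HasCompactSupport φ →
    tsupport φ ⊆ Ioo 0 T ×ˢ univ → (∀ z, spaceDiv φ z = 0) →
    ∫ t in Ioo 0 T, ∫ x, (⟪w t x, timeDeriv φ (t, x)⟫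
        + contract (gradMat φ (t, x)) (fun i j => w t x i * w t x j))
      = ∫ t in Ioo 0 T, ∫ x, ⟪f t x, φ (t, x)⟫

/-- `‖S⁻(t, ·)‖_{L^∞(ℝⁿ)}`. -/
def negPartNorm {n : ℕ} (S : ℝ × Eucl n → (Eucl n →L[ℝ] Eucl n)) (t : ℝ) : ℝ :=
  (eLpNorm (fun x => negPartForm (S (t, x))) ⊤ (volume : Measure (Eucl n))).toReal

/-- `u` is a dissipative solution, in the sense of Lions, of the incompressible Euler equations on
`[0,∞) × ℝⁿ` with initial data `v₀`. The comparison fields `w` are the divergence-free fields in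
`C([0,T]; L²)` with symmetric gradient in `L¹(0,T; L^∞)` and `E(w)` in `L¹(0,T; L²)`. The inner
product in the last integral is the one of `L²(ℝⁿ; ℝⁿ)`. -/
structure IsDissipativeSolution {n : ℕ} (v₀ : L2 n) (u : ℝ → L2 n) : Prop where
  bounded : ∃ C : ℝ, ∀ t, 0 ≤ t → ‖u t‖ ≤ C
  weak_cont : ∀ g : L2 n, ContinuousOn (fun t => ⟪g, u t⟫) (Ici 0)
  initial : u 0 = v₀
  div_free : ∀ t, 0 ≤ t → IsDivFree (u t)
  dissipation : ∀ (T : ℝ) (w f : ℝ → L2 n) (S : ℝ × Eucl n → (Eucl n →L[ℝ] Eucl n)),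
    0 < T → ContinuousOn w (Icc 0 T) → (∀ t ∈ Icc 0 T, IsDivFree (w t)) →
    IsSymGrad T w S → IsResidual T w f →
    ∀ t ∈ Icc 0 T,
      ‖u t - w t‖ ^ 2
        ≤ Real.exp (2 * ∫ τ in (0 : ℝ)..t, negPartNorm S τ) * ‖v₀ - w 0‖ ^ 2
          + 2 * ∫ s in (0 : ℝ)..t,
              Real.exp (2 * ∫ τ in s..t, negPartNorm S τ) * ⟪f s, u s - w s⟫

end

/-!
The theorem is a relative energy estimate. Let `u` be the velocity of the measure-valued solution,
`V = ‖v₀‖²` and `w` a comparison field, and put `F = V - 2 ⟪w, u⟫ + ‖w‖²`. As the energy inequality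
gives `‖u t‖² ≤ V` at every time, `‖u - w‖² ≤ F`, and it suffices to derive
`F t ≤ F 0 + ∫ (2 ‖S⁻‖ F + 2 ⟪f, u - w⟫)` and to apply Grönwall's inequality (`gronwall_integral`).

*The velocity.* The energy inequality says that the total energy, of oscillations and concentrations
together, has a marginal in time with a density at most `V` (`energy_marginal_le`). Hence the
stresses integrated up to time `t` depend continuously on `t`, and the momentum equation can be
integrated in time (`ae_inner_barycenter_eq`). Its right side is, at every time, a functional on
solenoidal test fields bounded by `‖v₀‖`; the Riesz representation theorem provides `u`
(`exists_isVelocity`), which is weakly continuous and agrees with the barycenter at almost every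
time (`ae_eq_barycenter`). Solenoidal test fields are dense among the solenoidal fields of `L²`
(`mem_closure_testL`): the mollification of a solenoidal field orthogonal to all of them is also
irrotational, so it vanishes by Caccioppoli's inequality.

*The comparison field.* For solenoidal `w` with bounded symmetric gradient `S`, the distribution
`div (w ⊗ w)` agrees with `2 S w` up to a gradient, and `∫ S w · w = 0`. Thus `∂ₜ w = -f - 2 P (S w)`
is integrable with values in `L²` (`eq_add_integral_fieldDeriv`), and the energy balance
`‖w t‖² - ‖w 0‖² = -2 ∫ ⟪f, w⟫` holds (`norm_sq_sub_eq`).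

*The pairing.* The field `w` mollified in space can be inserted into the momentum equation
(`inner_moll_evolution`). Its gradient is then contracted with the stresses, where only the
symmetric part matters, and this is bounded below by `-‖S⁻‖` as a quadratic form. Jensen's inequality
for `S + ‖S⁻‖` on the oscillations and the plain bound on the concentrations replace the stresses by
`S u · u + ‖S⁻‖ (‖u‖² - V)` (`stress_lower_bound`). When the mollification is removed
(`inner_evolution_ge`), the quadratic terms combine to `∫ S (u - w) · (u - w) ≥ -‖S⁻‖ ‖u - w‖²`
(`IsSymGradAt.relative_quad_ge`), and the terms `‖S⁻‖ ‖u‖²` cancel, which leaves `-‖S⁻‖ F`.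
-/

/-! ### Mollification in `L²` -/

section Mollification

variable {n : ℕ}

/-- Jensen's inequality for the square of the norm. -/
theorem enorm_integral_sq_le_lintegral {α F : Type*} [MeasurableSpace α] [NormedAddCommGroup F]
    [NormedSpace ℝ F] (μ : Measure α) [IsProbabilityMeasure μ] (G : α → F) :
    ‖∫ y, G y ∂μ‖ₑ ^ 2 ≤ ∫⁻ y, ‖G y‖ₑ ^ 2 ∂μ := by
  by_cases hG : AEStronglyMeasurable G μ
  · have h1 : ‖∫ y, G y ∂μ‖ₑ ≤ eLpNorm G 2 μ := by
      refine (enorm_integral_le_lintegral_enorm G).trans ?_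
      rw [← eLpNorm_one_eq_lintegral_enorm]
      exact eLpNorm_le_eLpNorm_of_exponent_le (by norm_num) hG
    have h2 : eLpNorm G 2 μ ^ 2 = ∫⁻ y, ‖G y‖ₑ ^ 2 ∂μ := by
      rw [eLpNorm_eq_lintegral_rpow_enorm_toReal (by norm_num) (by norm_num)]
      rw [← ENNReal.rpow_natCast, ← ENNReal.rpow_mul]
      simp
    rw [← h2]
    gcongr
  · rw [integral_non_aestronglyMeasurable hG]
    simp

/-- The mollification kernel attached to the bump function `b`. -/
noncomputable abbrev mollKernel (b : ContDiffBump (0 : Eucl n)) : Eucl n → ℝ := b.normed volume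

/-- The mollification `η_b ⋆ u` of a field `u`. -/
noncomputable def moll {F : Type*} [NormedAddCommGroup F] [NormedSpace ℝ F]
    (b : ContDiffBump (0 : Eucl n)) (u : Eucl n → F) : Eucl n → F :=
  convolution (mollKernel b) u (ContinuousLinearMap.lsmul ℝ ℝ) volume

theorem mollKernel_contDiff (b : ContDiffBump (0 : Eucl n)) : ContDiff ℝ ∞ (mollKernel b) :=
  b.contDiff_normed

theorem mollKernel_compact (b : ContDiffBump (0 : Eucl n)) : HasCompactSupport (mollKernel b) :=
  b.hasCompactSupport_normed

theorem mollKernel_nonneg (b : ContDiffBump (0 : Eucl n)) (x : Eucl n) : 0 ≤ mollKernel b x :=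
  b.nonneg_normed x

theorem moll_apply {F : Type*} [NormedAddCommGroup F] [NormedSpace ℝ F]
    (b : ContDiffBump (0 : Eucl n)) (u : Eucl n → F) (x : Eucl n) :
    moll b u x = ∫ y, mollKernel b y • u (x - y) := by
  simp [moll, convolution_def]

theorem moll_apply' {F : Type*} [NormedAddCommGroup F] [NormedSpace ℝ F]
    (b : ContDiffBump (0 : Eucl n)) (u : Eucl n → F) (x : Eucl n) :
    moll b u x = ∫ y, mollKernel b (x - y) • u y := by
  simp [moll, convolution_eq_swap]

/-- The probability measure `η_b(y) dy`. -/
noncomputable def mollMeasure (b : ContDiffBump (0 : Eucl n)) : Measure (Eucl n) :=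
  (volume : Measure (Eucl n)).withDensity fun y => ENNReal.ofReal (mollKernel b y)

theorem mollKernel_integrable (b : ContDiffBump (0 : Eucl n)) : Integrable (mollKernel b) volume :=
  (mollKernel_contDiff b).continuous.integrable_of_hasCompactSupport (mollKernel_compact b)

instance (b : ContDiffBump (0 : Eucl n)) : IsProbabilityMeasure (mollMeasure b) := by
  constructor
  rw [mollMeasure, withDensity_apply _ MeasurableSet.univ, Measure.restrict_univ,
    ← ofReal_integral_eq_lintegral_ofReal (mollKernel_integrable b)
      (Eventually.of_forall (mollKernel_nonneg b)), b.integral_normed, ENNReal.ofReal_one]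

theorem mollKernel_ofReal_measurable (b : ContDiffBump (0 : Eucl n)) :
    Measurable fun y => ENNReal.ofReal (mollKernel b y) :=
  ENNReal.measurable_ofReal.comp (mollKernel_contDiff b).continuous.measurable

theorem integral_mollMeasure {F : Type*} [NormedAddCommGroup F] [NormedSpace ℝ F]
    (b : ContDiffBump (0 : Eucl n)) (G : Eucl n → F) :
    ∫ y, G y ∂(mollMeasure b) = ∫ y, mollKernel b y • G y := by
  rw [mollMeasure, integral_withDensity_eq_integral_toReal_smul (mollKernel_ofReal_measurable b)
    (Eventually.of_forall fun _ => ENNReal.ofReal_lt_top)]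
  simp_rw [ENNReal.toReal_ofReal (mollKernel_nonneg b _)]

theorem lintegral_enorm_mollMeasure_sq_le {F : Type*} [NormedAddCommGroup F] [NormedSpace ℝ F]
    (b : ContDiffBump (0 : Eucl n)) (G : Eucl n → Eucl n → F)
    (hG : AEStronglyMeasurable (fun p : Eucl n × Eucl n => G p.1 p.2)
      (volume.prod (mollMeasure b))) :
    ∫⁻ x, ‖∫ y, mollKernel b y • G x y‖ₑ ^ 2
      ≤ ∫⁻ y, (∫⁻ x, ‖G x y‖ₑ ^ 2) ∂(mollMeasure b) := by
  calc ∫⁻ x, ‖∫ y, mollKernel b y • G x y‖ₑ ^ 2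
      ≤ ∫⁻ x, ∫⁻ y, ‖G x y‖ₑ ^ 2 ∂(mollMeasure b) := by
        refine lintegral_mono fun x => ?_
        rw [← integral_mollMeasure]
        exact enorm_integral_sq_le_lintegral _ _
    _ = ∫⁻ y, (∫⁻ x, ‖G x y‖ₑ ^ 2) ∂(mollMeasure b) :=
        lintegral_lintegral_swap ((hG.enorm.pow_const 2))

theorem aesm_sub_mollMeasure {F : Type*} [NormedAddCommGroup F]
    (b : ContDiffBump (0 : Eucl n)) {u : Eucl n → F}
    (hu : AEStronglyMeasurable u volume) :
    AEStronglyMeasurable (fun p : Eucl n × Eucl n => u (p.1 - p.2))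
      (volume.prod (mollMeasure b)) := by
  have h := hu.comp_quasiMeasurePreserving
    (quasiMeasurePreserving_sub_of_right_invariant (volume : Measure (Eucl n)) (mollMeasure b))
  exact h

theorem eLpNorm_two_sq {F : Type*} [NormedAddCommGroup F] {α : Type*} [MeasurableSpace α]
    (μ : Measure α) (G : α → F) : eLpNorm G 2 μ ^ 2 = ∫⁻ y, ‖G y‖ₑ ^ 2 ∂μ := by
  rw [eLpNorm_eq_lintegral_rpow_enorm_toReal (by norm_num) (by norm_num)]
  rw [← ENNReal.rpow_natCast, ← ENNReal.rpow_mul]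
  simp

/-- Young's inequality for the mollification, which is an average over the probability measure
`η_b(y) dy`. -/
theorem eLpNorm_moll_le {F : Type*} [NormedAddCommGroup F] [NormedSpace ℝ F]
    (b : ContDiffBump (0 : Eucl n)) {u : Eucl n → F} (hu : AEStronglyMeasurable u volume) :
    eLpNorm (moll b u) 2 volume ≤ eLpNorm u 2 volume := by
  have h : eLpNorm (moll b u) 2 volume ^ 2 ≤ eLpNorm u 2 volume ^ 2 := by
    rw [eLpNorm_two_sq, eLpNorm_two_sq]
    simp_rw [moll_apply]
    refine (lintegral_enorm_mollMeasure_sq_le b (fun x y => u (x - y))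
      (aesm_sub_mollMeasure b hu)).trans ?_
    simp_rw [lintegral_sub_right_eq_self (fun x => ‖u x‖ₑ ^ 2)]
    simp
  exact (ENNReal.pow_le_pow_left_iff (by norm_num)).1 h

theorem continuous_moll {F : Type*} [NormedAddCommGroup F] [NormedSpace ℝ F]
    (b : ContDiffBump (0 : Eucl n)) {u : Eucl n → F} (hu : LocallyIntegrable u volume) :
    Continuous (moll b u) :=
  (mollKernel_compact b).continuous_convolution_left _ (mollKernel_contDiff b).continuous hu

theorem moll_exists {F : Type*} [NormedAddCommGroup F] [NormedSpace ℝ F]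
    (b : ContDiffBump (0 : Eucl n)) {u : Eucl n → F} (hu : LocallyIntegrable u volume)
    (x : Eucl n) : Integrable (fun y => mollKernel b y • u (x - y)) volume :=
  (mollKernel_compact b).convolutionExists_left (ContinuousLinearMap.lsmul ℝ ℝ)
    (mollKernel_contDiff b).continuous hu x

theorem L2_locallyIntegrable (u : L2 n) : LocallyIntegrable u volume :=
  (Lp.memLp u).locallyIntegrable (by norm_num)

theorem memLp_moll (b : ContDiffBump (0 : Eucl n)) {u : Eucl n → Eucl n}
    (hu : MemLp u 2 volume) : MemLp (moll b u) 2 volume :=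
  ⟨(continuous_moll b (hu.locallyIntegrable (by norm_num))).aestronglyMeasurable,
    (eLpNorm_moll_le b hu.1).trans_lt hu.2⟩

theorem moll_congr_ae {F : Type*} [NormedAddCommGroup F] [NormedSpace ℝ F]
    (b : ContDiffBump (0 : Eucl n)) {u v : Eucl n → F} (h : u =ᵐ[volume] v) :
    moll b u = moll b v := by
  ext x
  rw [moll_apply', moll_apply']
  exact integral_congr_ae (h.mono fun y hy => by simp [hy])

theorem moll_add {F : Type*} [NormedAddCommGroup F] [NormedSpace ℝ F]
    (b : ContDiffBump (0 : Eucl n)) {u v : Eucl n → F} (hu : LocallyIntegrable u volume)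
    (hv : LocallyIntegrable v volume) : moll b (u + v) = moll b u + moll b v := by
  ext x
  simp only [moll_apply, Pi.add_apply, smul_add]
  exact integral_add (moll_exists b hu x) (moll_exists b hv x)

theorem moll_smul {F : Type*} [NormedAddCommGroup F] [NormedSpace ℝ F]
    (b : ContDiffBump (0 : Eucl n)) (c : ℝ) (u : Eucl n → F) : moll b (c • u) = c • moll b u := by
  ext x
  simp only [moll_apply, Pi.smul_apply, smul_comm _ c]
  exact integral_smul c _

/-- Mollification as a linear map of `L²`. -/
noncomputable def mollLin (b : ContDiffBump (0 : Eucl n)) : L2 n →ₗ[ℝ] L2 n where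
  toFun u := (memLp_moll b (Lp.memLp u)).toLp (moll b u)
  map_add' u v := by
    rw [← MemLp.toLp_add]
    congr 1
    rw [moll_congr_ae b (Lp.coeFn_add u v),
      moll_add b (L2_locallyIntegrable u) (L2_locallyIntegrable v)]
  map_smul' c u := by
    rw [RingHom.id_apply, ← MemLp.toLp_const_smul]
    congr 1
    rw [moll_congr_ae b (Lp.coeFn_smul c u), moll_smul]

theorem mollLin_norm_le (b : ContDiffBump (0 : Eucl n)) (u : L2 n) :
    ‖mollLin b u‖ ≤ 1 * ‖u‖ := by
  have h : ‖mollLin b u‖ = (eLpNorm (moll b u) 2 volume).toReal :=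
    Lp.norm_toLp _ (memLp_moll b (Lp.memLp u))
  rw [h, one_mul, Lp.norm_def]
  exact ENNReal.toReal_mono (Lp.memLp u).2.ne (eLpNorm_moll_le b (Lp.memLp u).1)

/-- Mollification as a bounded operator of `L²`. -/
noncomputable def mollL (b : ContDiffBump (0 : Eucl n)) : L2 n →L[ℝ] L2 n :=
  (mollLin b).mkContinuous 1 (mollLin_norm_le b)

theorem mollL_coeFn (b : ContDiffBump (0 : Eucl n)) (u : L2 n) :
    mollL b u =ᵐ[volume] moll b u :=
  MemLp.coeFn_toLp (memLp_moll b (Lp.memLp u))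

theorem mollL_norm_le (b : ContDiffBump (0 : Eucl n)) (u : L2 n) : ‖mollL b u‖ ≤ ‖u‖ :=
  (mollLin_norm_le b u).trans_eq (one_mul _)

/-- Translation in `L²`. -/
noncomputable def translateL2 (y : Eucl n) (u : L2 n) : L2 n :=
  Lp.compMeasurePreserving (fun x => x - y) (measurePreserving_sub_right volume y) u

theorem continuous_translate (u : L2 n) : Continuous fun y => translateL2 y u := by
  have h : Continuous fun y : Eucl n =>
      (⟨fun x => x - y, by fun_prop⟩ : C(Eucl n, Eucl n)) :=
    ContinuousMap.continuous_of_continuous_uncurry _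
      (show Continuous fun p : Eucl n × Eucl n => p.2 - p.1 by fun_prop)
  exact Continuous.compMeasurePreservingLp (μ := volume) (ν := volume) (p := 2)
    (continuous_const (y := u)) h
    (fun y => measurePreserving_sub_right volume y) (by norm_num)

theorem enorm_translate_sub (y : Eucl n) (u : L2 n) :
    ‖translateL2 y u - u‖ₑ ^ 2 = ∫⁻ x, ‖u (x - y) - u x‖ₑ ^ 2 := by
  rw [Lp.enorm_def, eLpNorm_two_sq]
  refine lintegral_congr_ae ?_
  filter_upwards [Lp.coeFn_sub (translateL2 y u) u, Lp.coeFn_compMeasurePreserving u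
    (measurePreserving_sub_right volume y)] with x h1 h2
  rw [h1, Pi.sub_apply, translateL2, h2]
  rfl

/-- Mollification moves `u` no more than translations in the support of the kernel do. -/
theorem mollL_sub_norm_le (b : ContDiffBump (0 : Eucl n)) (u : L2 n) {δ : ℝ} (hδ : 0 ≤ δ)
    (h : ∀ y, ‖y‖ < b.rOut → ‖translateL2 y u - u‖ ≤ δ) : ‖mollL b u - u‖ ≤ δ := by
  have key : ‖mollL b u - u‖ₑ ^ 2 ≤ ENNReal.ofReal δ ^ 2 := by
    have e1 : ‖mollL b u - u‖ₑ ^ 2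
        = ∫⁻ x, ‖∫ y, mollKernel b y • (u (x - y) - u x)‖ₑ ^ 2 := by
      rw [Lp.enorm_def, eLpNorm_two_sq]
      refine lintegral_congr_ae ?_
      filter_upwards [Lp.coeFn_sub (mollL b u) u, mollL_coeFn b u] with x h1 h2
      rw [h1, Pi.sub_apply, h2, moll_apply]
      simp_rw [smul_sub]
      rw [integral_sub (moll_exists b (L2_locallyIntegrable u) x)
        ((mollKernel_integrable b).smul_const _), integral_smul_const, b.integral_normed, one_smul]
    rw [e1]
    refine (lintegral_enorm_mollMeasure_sq_le b (fun x y => u (x - y) - u x) ?_).trans ?_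
    · exact (aesm_sub_mollMeasure b (Lp.memLp u).1).sub
        ((Lp.memLp u).1.comp_quasiMeasurePreserving Measure.quasiMeasurePreserving_fst)
    · simp_rw [← enorm_translate_sub]
      calc ∫⁻ y, ‖translateL2 y u - u‖ₑ ^ 2 ∂(mollMeasure b)
          ≤ ∫⁻ y, ENNReal.ofReal δ ^ 2 ∂(mollMeasure b) := by
            refine lintegral_mono_ae ?_
            have : ∀ᵐ y ∂(mollMeasure b), ‖y‖ < b.rOut := by
              rw [mollMeasure, ae_withDensity_iff (mollKernel_ofReal_measurable b)]
              refine Eventually.of_forall fun y hy => ?_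
              have : y ∈ Function.support (mollKernel b) := by
                intro h0
                simp [h0] at hy
              rw [b.support_normed_eq] at this
              simpa using this
            filter_upwards [this] with y hy
            gcongr
            rw [← ofReal_norm]
            exact ENNReal.ofReal_le_ofReal (h y hy)
        _ = ENNReal.ofReal δ ^ 2 := by simp
  have := (ENNReal.pow_le_pow_left_iff (by norm_num)).1 key
  rw [← ofReal_norm] at this
  exact (ENNReal.ofReal_le_ofReal_iff hδ).1 this

/-- A sequence of bump functions shrinking to the origin. -/
noncomputable def bumpSeq (n m : ℕ) : ContDiffBump (0 : Eucl n) where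
  rIn := 1 / (m + 1)
  rOut := 2 / (m + 1)
  rIn_pos := by positivity
  rIn_lt_rOut := by gcongr; norm_num

theorem bumpSeq_rOut_tendsto (n : ℕ) : Tendsto (fun m => (bumpSeq n m).rOut) atTop (𝓝 0) := by
  have := (tendsto_one_div_add_atTop_nhds_zero_nat (𝕜 := ℝ)).const_mul 2
  simpa [bumpSeq, div_eq_mul_inv] using this

theorem mollL_tendsto (u : L2 n) : Tendsto (fun m => mollL (bumpSeq n m) u) atTop (𝓝 u) := by
  rw [Metric.tendsto_atTop]
  intro ε hε
  have h0 : translateL2 0 u = u := by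
    apply Lp.ext
    filter_upwards [Lp.coeFn_compMeasurePreserving u
      (measurePreserving_sub_right volume (0 : Eucl n))] with x h2
    rw [translateL2, h2]
    simp
  have hc := (continuous_translate u).tendsto 0
  rw [h0] at hc
  obtain ⟨r, hr, hr'⟩ := Metric.tendsto_nhds_nhds.1 hc (ε / 2) (by positivity)
  obtain ⟨N, hN⟩ := Metric.tendsto_atTop.1 (bumpSeq_rOut_tendsto n) r hr
  refine ⟨N, fun m hm => ?_⟩
  rw [dist_eq_norm]
  refine lt_of_le_of_lt (mollL_sub_norm_le _ u (δ := ε / 2) (by positivity) fun y hy => ?_)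
    (by linarith)
  rw [← dist_eq_norm]
  refine (hr' ?_).le
  rw [dist_zero_right]
  have := hN m hm
  rw [Real.dist_eq, sub_zero] at this
  exact hy.trans (lt_of_abs_lt this)

/-- Lebesgue differentiation along the kernels of `bumpSeq`. -/
theorem moll_tendsto_ae {F : Type*} [NormedAddCommGroup F] [NormedSpace ℝ F] [CompleteSpace F]
    {u : Eucl n → F} (hu : LocallyIntegrable u volume) :
    ∀ᵐ x, Tendsto (fun m => moll (bumpSeq n m) u x) atTop (𝓝 (u x)) :=
  ContDiffBump.ae_convolution_tendsto_right_of_locallyIntegrable (K := 2) (bumpSeq_rOut_tendsto n)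
    (Eventually.of_forall fun m => by simp [bumpSeq]; field_simp; rfl) hu

end Mollification

/-! ### Coordinates, Jacobians and integration by parts -/

section Calculus

variable {n : ℕ}

theorem eucl_inner (a b : Eucl n) : ⟪a, b⟫ = ∑ i, a i * b i := by
  simp [PiLp.inner_apply, mul_comm]

theorem eucl_norm_sq (a : Eucl n) : ‖a‖ ^ 2 = ∑ i, a i ^ 2 := by
  rw [← real_inner_self_eq_norm_sq, eucl_inner]
  simp [sq]

theorem abs_coord_le (a : Eucl n) (i : Fin n) : |a i| ≤ ‖a‖ := by
  simpa using PiLp.norm_apply_le a i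

theorem gradient_apply (ψ : Eucl n → ℝ) (x : Eucl n) (j : Fin n) :
    gradient ψ x j = fderiv ℝ ψ x (EuclideanSpace.single j 1) := by
  have h : ⟪gradient ψ x, EuclideanSpace.single j (1 : ℝ)⟫
      = fderiv ℝ ψ x (EuclideanSpace.single j 1) := by
    simp [gradient]
  rw [← h, eucl_inner]
  simp

/-- The Jacobian matrix `(∂_j φ_i)(x)` of a field `φ` on `ℝⁿ`. -/
noncomputable def jac (φ : Eucl n → Eucl n) (x : Eucl n) : Matrix (Fin n) (Fin n) ℝ :=
  fun i j => (fderiv ℝ φ x (EuclideanSpace.single j 1)) i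

theorem fderiv_coord {φ : Eucl n → Eucl n} {x : Eucl n} (h : DifferentiableAt ℝ φ x) (i : Fin n)
    (v : Eucl n) : fderiv ℝ (fun y => φ y i) x v = (fderiv ℝ φ x v) i := by
  have h1 := ((EuclideanSpace.proj (𝕜 := ℝ) i).hasFDerivAt).comp x h.hasFDerivAt
  have h2 : HasFDerivAt (fun y => φ y i)
    ((EuclideanSpace.proj (𝕜 := ℝ) i).comp (fderiv ℝ φ x)) x := h1
  rw [h2.fderiv]
  rfl

theorem contDiff_coord {φ : Eucl n → Eucl n} {k : WithTop ℕ∞} (h : ContDiff ℝ k φ) (i : Fin n) :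
    ContDiff ℝ k (fun y => φ y i) :=
  (EuclideanSpace.proj (𝕜 := ℝ) i).contDiff.comp h

theorem compact_coord {φ : Eucl n → Eucl n} (h : HasCompactSupport φ) (i : Fin n) :
    HasCompactSupport (fun y => φ y i) :=
  h.comp_left (g := fun a : Eucl n => a i) rfl

theorem continuous_jac {φ : Eucl n → Eucl n} (h : ContDiff ℝ 1 φ) (i j : Fin n) :
    Continuous fun x => jac φ x i j := by
  have h1 : Continuous fun x => fderiv ℝ φ x (EuclideanSpace.single j 1) :=
    (h.continuous_fderiv one_ne_zero).clm_apply continuous_const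
  exact (EuclideanSpace.proj (𝕜 := ℝ) i).continuous.comp h1

theorem compact_jac {φ : Eucl n → Eucl n} (h : HasCompactSupport φ) (i j : Fin n) :
    HasCompactSupport fun x => jac φ x i j :=
  (h.fderiv (𝕜 := ℝ)).comp_left
    (g := fun L : Eucl n →L[ℝ] Eucl n => (L (EuclideanSpace.single j 1)) i) rfl

theorem continuous_fderiv_apply' {f : Eucl n → ℝ} (h : ContDiff ℝ 1 f) (v : Eucl n) :
    Continuous fun x => fderiv ℝ f x v :=
  (h.continuous_fderiv one_ne_zero).clm_apply continuous_const

theorem compact_fderiv_apply {f : Eucl n → ℝ} (h : HasCompactSupport f) (v : Eucl n) :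
    HasCompactSupport fun x => fderiv ℝ f x v :=
  (h.fderiv (𝕜 := ℝ)).comp_left (g := fun L : Eucl n →L[ℝ] ℝ => L v) rfl

/-- Integration by parts against a compactly supported function. -/
theorem integral_mul_fderiv_eq_neg {f g : Eucl n → ℝ} (hf : ContDiff ℝ 1 f) (hg : ContDiff ℝ 1 g)
    (hc : HasCompactSupport g) (v : Eucl n) :
    ∫ x, f x * fderiv ℝ g x v = - ∫ x, fderiv ℝ f x v * g x := by
  refine integral_mul_fderiv_eq_neg_fderiv_mul_of_integrable ?_ ?_ ?_
    (fun x _ => hf.differentiable one_ne_zero x) (fun x _ => hg.differentiable one_ne_zero x)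
  · exact ((continuous_fderiv_apply' hf v).mul hg.continuous).integrable_of_hasCompactSupport
      hc.mul_left
  · exact (hf.continuous.mul (continuous_fderiv_apply' hg v)).integrable_of_hasCompactSupport
      (compact_fderiv_apply hc v).mul_left
  · exact (hf.continuous.mul hg.continuous).integrable_of_hasCompactSupport hc.mul_left

/-- A smooth compactly supported solenoidal field on `ℝⁿ`. -/
structure IsTestField (φ : Eucl n → Eucl n) : Prop where
  smooth : ContDiff ℝ ∞ φ
  compact : HasCompactSupport φ
  div_zero : ∀ x, ∑ i, jac φ x i i = 0

theorem isDivFree_of_jac {φ : Eucl n → Eucl n} (h : ContDiff ℝ 1 φ)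
    (hd : ∀ x, ∑ i, jac φ x i i = 0) : IsDivFree φ := by
  intro ψ hψ hc
  have hψ1 : ContDiff ℝ 1 ψ := hψ.of_le (by simp)
  simp_rw [eucl_inner, gradient_apply]
  rw [integral_finsetSum]
  · have : ∀ i, ∫ x, φ x i * fderiv ℝ ψ x (EuclideanSpace.single i 1)
        = - ∫ x, jac φ x i i * ψ x := by
      intro i
      rw [integral_mul_fderiv_eq_neg (contDiff_coord h i) hψ1 hc]
      simp_rw [fderiv_coord (h.differentiable one_ne_zero _)]
      rfl
    simp_rw [this]
    rw [Finset.sum_neg_distrib, ← integral_finsetSum]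
    · simp_rw [← Finset.sum_mul, hd]
      simp
    · intro i _
      exact ((continuous_jac h i i).mul hψ1.continuous).integrable_of_hasCompactSupport hc.mul_left
  · intro i _
    exact ((contDiff_coord h i).continuous.mul
      (continuous_fderiv_apply' hψ1 _)).integrable_of_hasCompactSupport
      (compact_fderiv_apply hc _).mul_left

theorem IsTestField.isDivFree {φ : Eucl n → Eucl n} (h : IsTestField φ) : IsDivFree φ :=
  isDivFree_of_jac (h.smooth.of_le (by simp)) h.div_zero

theorem IsTestField.memLp {φ : Eucl n → Eucl n} (h : IsTestField φ) : MemLp φ 2 volume :=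
  h.smooth.continuous.memLp_of_hasCompactSupport h.compact

end Calculus

section MollifiedGradient

variable {n : ℕ}

theorem contDiff_moll {F : Type*} [NormedAddCommGroup F] [NormedSpace ℝ F] [CompleteSpace F]
    (b : ContDiffBump (0 : Eucl n))
    {u : Eucl n → F} (hu : LocallyIntegrable u volume) : ContDiff ℝ ∞ (moll b u) :=
  (mollKernel_compact b).contDiff_convolution_left _ (mollKernel_contDiff b) hu

theorem fderiv_moll {F : Type*} [NormedAddCommGroup F] [NormedSpace ℝ F] [CompleteSpace F]
    (b : ContDiffBump (0 : Eucl n))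
    {u : Eucl n → F} (hu : LocallyIntegrable u volume) (x v : Eucl n) :
    fderiv ℝ (moll b u) x v = ∫ y, (fderiv ℝ (mollKernel b) (x - y) v) • u y := by
  have h1 : ContDiff ℝ 1 (mollKernel b) := (mollKernel_contDiff b).of_le (by simp)
  have h := (mollKernel_compact b).hasFDerivAt_convolution_left
    (ContinuousLinearMap.lsmul ℝ ℝ) (μ := volume) h1 hu x
  have h2 : HasFDerivAt (moll b u) _ x := h
  rw [h2.fderiv, convolution_eq_swap]
  have hex : ConvolutionExistsAt (fderiv ℝ (mollKernel b)) u x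
      ((ContinuousLinearMap.lsmul ℝ ℝ : ℝ →L[ℝ] F →L[ℝ] F).precompL (Eucl n)) volume :=
    ((mollKernel_compact b).fderiv (𝕜 := ℝ)).convolutionExists_left _
      (h1.continuous_fderiv one_ne_zero) hu x
  rw [ContinuousLinearMap.integral_apply hex.integrable_swap]
  rfl

/-- The field `y ↦ ∂_j η_b(x - y) e_i`, whose inner product with `u` is `∂_j (η_b ⋆ u)_i (x)`. -/
noncomputable def gradKernel (b : ContDiffBump (0 : Eucl n)) (x : Eucl n) (i j : Fin n)
    (y : Eucl n) : Eucl n :=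
  fderiv ℝ (mollKernel b) (x - y) (EuclideanSpace.single j 1) • EuclideanSpace.single i (1 : ℝ)

theorem fderiv_mollKernel_continuous (b : ContDiffBump (0 : Eucl n)) (v : Eucl n) :
    Continuous fun x => fderiv ℝ (mollKernel b) x v :=
  continuous_fderiv_apply' ((mollKernel_contDiff b).of_le (by simp)) v

theorem fderiv_mollKernel_compact (b : ContDiffBump (0 : Eucl n)) (v : Eucl n) :
    HasCompactSupport fun x => fderiv ℝ (mollKernel b) x v :=
  compact_fderiv_apply (mollKernel_compact b) v

theorem fderiv_mollKernel_memLp (b : ContDiffBump (0 : Eucl n)) (v : Eucl n) :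
    MemLp (fun x => fderiv ℝ (mollKernel b) x v) 2 volume :=
  (fderiv_mollKernel_continuous b v).memLp_of_hasCompactSupport (fderiv_mollKernel_compact b v)

theorem eLpNorm_gradKernel (b : ContDiffBump (0 : Eucl n)) (x : Eucl n) (i j : Fin n) :
    eLpNorm (gradKernel b x i j) 2 volume
      = eLpNorm (fun x => fderiv ℝ (mollKernel b) x (EuclideanSpace.single j 1)) 2 volume := by
  rw [← eLpNorm_comp_measurePreserving (fderiv_mollKernel_memLp b _).1
    (Measure.measurePreserving_sub_left volume x)]
  refine eLpNorm_congr_norm_ae (Eventually.of_forall fun y => ?_)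
  simp [gradKernel, norm_smul]

theorem gradKernel_memLp (b : ContDiffBump (0 : Eucl n)) (x : Eucl n) (i j : Fin n) :
    MemLp (gradKernel b x i j) 2 volume := by
  refine ⟨?_, ?_⟩
  · refine Continuous.aestronglyMeasurable ?_
    unfold gradKernel
    exact ((fderiv_mollKernel_continuous b _).comp (by fun_prop)).smul continuous_const
  · rw [eLpNorm_gradKernel]
    exact (fderiv_mollKernel_memLp b _).2

/-- A bound for the norm of `u ↦ ∇(η_b ⋆ u)(x)` on `L²`. -/
noncomputable def gradConst (b : ContDiffBump (0 : Eucl n)) : ℝ :=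
  ∑ j, (eLpNorm (fun x => fderiv ℝ (mollKernel b) x (EuclideanSpace.single j 1)) 2 volume).toReal

theorem gradConst_nonneg (b : ContDiffBump (0 : Eucl n)) : 0 ≤ gradConst b :=
  Finset.sum_nonneg fun _ _ => ENNReal.toReal_nonneg

theorem jac_moll_eq_integral (b : ContDiffBump (0 : Eucl n)) {u : Eucl n → Eucl n}
    (hu : LocallyIntegrable u volume) (x : Eucl n) (i j : Fin n) :
    jac (moll b u) x i j
      = ∫ y, fderiv ℝ (mollKernel b) (x - y) (EuclideanSpace.single j 1) * u y i := by
  rw [jac, fderiv_moll b hu]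
  have hc : Continuous fun y =>
      fderiv ℝ (mollKernel b) (x - y) (EuclideanSpace.single j 1) :=
    (fderiv_mollKernel_continuous b _).comp (by fun_prop)
  have hi : Integrable (fun y =>
      (fderiv ℝ (mollKernel b) (x - y) (EuclideanSpace.single j 1)) • u y) volume :=
    hu.integrable_smul_left_of_hasCompactSupport hc
      ((fderiv_mollKernel_compact b _).comp_homeomorph (Homeomorph.subLeft x))
  have := (EuclideanSpace.proj (𝕜 := ℝ) i).integral_comp_comm hi
  exact this.symm

/-- Gradients of mollifications depend on the field through inner products of `L²`; this gives their
bounds and their continuity in the field. -/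
theorem jac_moll_eq_inner (b : ContDiffBump (0 : Eucl n)) (u : L2 n) (x : Eucl n) (i j : Fin n) :
    jac (moll b u) x i j = ⟪(gradKernel_memLp b x i j).toLp _, u⟫ := by
  rw [jac_moll_eq_integral b (L2_locallyIntegrable u), L2.inner_def]
  refine integral_congr_ae ?_
  filter_upwards [(gradKernel_memLp b x i j).coeFn_toLp] with y hy
  rw [hy, gradKernel, inner_smul_left, eucl_inner]
  simp

theorem abs_jac_moll_le (b : ContDiffBump (0 : Eucl n)) (u : L2 n) (x : Eucl n) (i j : Fin n) :
    |jac (moll b u) x i j| ≤ gradConst b * ‖u‖ := by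
  rw [jac_moll_eq_inner]
  refine (abs_real_inner_le_norm _ _).trans ?_
  gcongr
  rw [Lp.norm_toLp, eLpNorm_gradKernel]
  exact Finset.single_le_sum (f := fun j => (eLpNorm (fun x => fderiv ℝ (mollKernel b) x
    (EuclideanSpace.single j 1)) 2 volume).toReal) (fun _ _ => ENNReal.toReal_nonneg)
    (Finset.mem_univ j)

theorem jac_moll_sub (b : ContDiffBump (0 : Eucl n)) (u v : L2 n) (x : Eucl n) (i j : Fin n) :
    jac (moll b (u - v : L2 n)) x i j = jac (moll b u) x i j - jac (moll b v) x i j := by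
  simp_rw [jac_moll_eq_inner, inner_sub_right]

theorem continuous_jac_moll (b : ContDiffBump (0 : Eucl n)) (i j : Fin n) :
    Continuous fun p : L2 n × Eucl n => jac (moll b p.1) p.2 i j := by
  refine continuous_prod_of_continuous_lipschitzWith _ (Real.toNNReal (gradConst b))
    (fun u => ?_) (fun x => ?_)
  · exact continuous_jac ((contDiff_moll b (L2_locallyIntegrable u)).of_le (by simp)) i j
  · refine LipschitzWith.of_dist_le_mul fun u v => ?_
    rw [Real.dist_eq, ← jac_moll_sub, Real.coe_toNNReal _ (gradConst_nonneg b), dist_eq_norm]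
    exact abs_jac_moll_le b _ x i j

/-- The mollification of a solenoidal field is solenoidal in the classical sense. -/
theorem div_moll_eq_zero (b : ContDiffBump (0 : Eucl n)) {u : Eucl n → Eucl n}
    (hu : LocallyIntegrable u volume) (hd : IsDivFree u) (x : Eucl n) :
    ∑ i, jac (moll b u) x i i = 0 := by
  have hψ : ContDiff ℝ ∞ fun y => mollKernel b (x - y) :=
    (mollKernel_contDiff b).comp (by fun_prop)
  have hc : HasCompactSupport fun y => mollKernel b (x - y) :=
    (mollKernel_compact b).comp_homeomorph (Homeomorph.subLeft x)
  have hder : ∀ y v, fderiv ℝ (fun y => mollKernel b (x - y)) y v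
      = - fderiv ℝ (mollKernel b) (x - y) v := by
    intro y v
    have h1 := ((mollKernel_contDiff b).differentiable (by simp) (x - y)).hasFDerivAt.comp y
      ((hasFDerivAt_id y).const_sub x)
    have h2 : fderiv ℝ (fun y => mollKernel b (x - y)) y = _ := h1.fderiv
    rw [h2]
    simp
  have h := hd _ hψ hc
  simp_rw [eucl_inner, gradient_apply, hder] at h
  rw [integral_finsetSum] at h
  · simp_rw [jac_moll_eq_integral b hu]
    rw [← neg_eq_zero, ← Finset.sum_neg_distrib, ← h]
    refine Finset.sum_congr rfl fun i _ => ?_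
    rw [← integral_neg]
    refine integral_congr_ae (Eventually.of_forall fun y => ?_)
    simp only
    ring
  · intro i _
    have hi : LocallyIntegrable (fun y => u y i) volume := by
      intro z
      obtain ⟨s, hs, hsi⟩ := hu z
      exact ⟨s, hs, (EuclideanSpace.proj (𝕜 := ℝ) i).integrable_comp hsi⟩
    have := hi.integrable_smul_right_of_hasCompactSupport
      (g := fun y => - fderiv ℝ (mollKernel b) (x - y) (EuclideanSpace.single i 1))
      (((fderiv_mollKernel_continuous b _).comp (by fun_prop)).neg)
      (((fderiv_mollKernel_compact b _).comp_homeomorph (Homeomorph.subLeft x)).neg)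
    exact this

theorem IsTestField.moll {φ : Eucl n → Eucl n} (h : IsTestField φ)
    (b : ContDiffBump (0 : Eucl n)) : IsTestField (moll b φ) where
  smooth := contDiff_moll b h.smooth.continuous.locallyIntegrable
  compact := (mollKernel_compact b).convolution _ h.compact
  div_zero := div_moll_eq_zero b h.smooth.continuous.locallyIntegrable h.isDivFree

end MollifiedGradient

/-! ### Density of test fields among solenoidal fields -/

section Density

variable {n : ℕ}

theorem IsDivFree.congr_ae {u v : Eucl n → Eucl n} (h : IsDivFree u) (huv : u =ᵐ[volume] v) :
    IsDivFree v := by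
  intro ψ hψ hc
  rw [← h ψ hψ hc]
  exact integral_congr_ae (huv.mono fun x hx => by simp only [hx])

theorem continuous_gradient {ψ : Eucl n → ℝ} (h : ContDiff ℝ ∞ ψ) : Continuous (gradient ψ) :=
  (LinearIsometryEquiv.continuous _).comp (h.continuous_fderiv (by simp))

theorem gradient_compact {ψ : Eucl n → ℝ} (h : HasCompactSupport ψ) :
    HasCompactSupport (gradient ψ) :=
  (h.fderiv (𝕜 := ℝ)).comp_left (map_zero (InnerProductSpace.toDual ℝ (Eucl n)).symm)

theorem gradient_memLp {ψ : Eucl n → ℝ} (h : ContDiff ℝ ∞ ψ) (hc : HasCompactSupport ψ) :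
    MemLp (gradient ψ) 2 volume :=
  (continuous_gradient h).memLp_of_hasCompactSupport (gradient_compact hc)

theorem inner_toLp_eq {φ : Eucl n → Eucl n} (h : MemLp φ 2 volume) (u : L2 n) :
    ⟪h.toLp φ, u⟫ = ∫ x, ⟪φ x, u x⟫ := by
  rw [L2.inner_def]
  exact integral_congr_ae (h.coeFn_toLp.mono fun x hx => by simp only [hx])

theorem isDivFree_iff_inner (u : L2 n) : IsDivFree u ↔
    ∀ (ψ : Eucl n → ℝ) (h : ContDiff ℝ ∞ ψ) (hc : HasCompactSupport ψ),
      ⟪(gradient_memLp h hc).toLp _, u⟫ = 0 := by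
  refine forall_congr' fun ψ => forall_congr' fun h => forall_congr' fun hc => ?_
  rw [inner_toLp_eq]
  simp_rw [real_inner_comm]

/-- The closed subspace of solenoidal fields of `L²`. -/
def divFree (n : ℕ) : Submodule ℝ (L2 n) where
  carrier := {u | IsDivFree u}
  zero_mem' := by
    simp only [mem_ofPred_eq, isDivFree_iff_inner, inner_zero_right, implies_true]
  add_mem' := by
    intro u v hu hv
    simp only [mem_ofPred_eq, isDivFree_iff_inner] at *
    intro ψ h hc
    rw [inner_add_right, hu ψ h hc, hv ψ h hc, add_zero]
  smul_mem' := by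
    intro c u hu
    simp only [mem_ofPred_eq, isDivFree_iff_inner] at *
    intro ψ h hc
    rw [inner_smul_right, hu ψ h hc, mul_zero]

theorem mem_divFree {u : L2 n} : u ∈ divFree n ↔ IsDivFree u := Iff.rfl

theorem isClosed_divFree : IsClosed (divFree n : Set (L2 n)) := by
  have : (divFree n : Set (L2 n)) = ⋂ (ψ : Eucl n → ℝ) (h : ContDiff ℝ ∞ ψ)
      (hc : HasCompactSupport ψ), {u : L2 n | ⟪(gradient_memLp h hc).toLp _, u⟫ = 0} := by
    ext u
    simp only [SetLike.mem_coe, mem_divFree, isDivFree_iff_inner, mem_iInter, mem_ofPred_eq]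
  rw [this]
  refine isClosed_iInter fun ψ => isClosed_iInter fun h => isClosed_iInter fun hc => ?_
  exact isClosed_eq (by fun_prop) continuous_const

theorem jac_add {φ ψ : Eucl n → Eucl n} (hφ : ContDiff ℝ ∞ φ) (hψ : ContDiff ℝ ∞ ψ)
    (x : Eucl n) (i j : Fin n) : jac (φ + ψ) x i j = jac φ x i j + jac ψ x i j := by
  simp only [jac]
  rw [fderiv_add (hφ.differentiable (by simp) x) (hψ.differentiable (by simp) x)]
  rfl

theorem jac_smul {φ : Eucl n → Eucl n} (hφ : ContDiff ℝ ∞ φ) (c : ℝ)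
    (x : Eucl n) (i j : Fin n) : jac (c • φ) x i j = c * jac φ x i j := by
  simp only [jac]
  rw [fderiv_const_smul (hφ.differentiable (by simp) x)]
  rfl

/-- The vector space of test fields. -/
def testFields (n : ℕ) : Submodule ℝ (Eucl n → Eucl n) where
  carrier := {φ | IsTestField φ}
  zero_mem' := ⟨contDiff_const, HasCompactSupport.zero, fun x => by
    simp only [jac]
    rw [show (0 : Eucl n → Eucl n) = fun _ => 0 from rfl, fderiv_const_apply]
    simp⟩
  add_mem' := fun {φ ψ} h h' => ⟨h.smooth.add h'.smooth, h.compact.add h'.compact, fun x => by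
    simp_rw [jac_add h.smooth h'.smooth, Finset.sum_add_distrib, h.div_zero, h'.div_zero, add_zero]⟩
  smul_mem' := fun c φ h => ⟨contDiff_const.smul h.smooth, h.compact.smul_left (f := fun _ => c),
    fun x => by simp_rw [jac_smul h.smooth, ← Finset.mul_sum, h.div_zero, mul_zero]⟩

/-- The inclusion of test fields into `L²`. -/
noncomputable def testL (n : ℕ) : testFields n →ₗ[ℝ] L2 n where
  toFun φ := (IsTestField.memLp φ.2).toLp φ.1
  map_add' _ _ := rfl
  map_smul' _ _ := rfl

theorem testL_coeFn (φ : testFields n) : testL n φ =ᵐ[volume] φ.1 :=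
  MemLp.coeFn_toLp (IsTestField.memLp φ.2)

theorem testL_mem_divFree (φ : testFields n) : testL n φ ∈ divFree n :=
  (IsTestField.isDivFree φ.2).congr_ae (testL_coeFn φ).symm

theorem inner_testL (φ : testFields n) (u : L2 n) : ⟪testL n φ, u⟫ = ∫ x, ⟪φ.1 x, u x⟫ :=
  inner_toLp_eq (IsTestField.memLp φ.2) u

/-- Smooth cutoffs at scale `R`, with gradient of order `1 / R`. -/
theorem exists_cutoff (n : ℕ) : ∃ C : ℝ, 0 ≤ C ∧ ∀ R : ℝ, 0 < R → ∃ χ : Eucl n → ℝ,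
    ContDiff ℝ ∞ χ ∧ HasCompactSupport χ ∧ (∀ x, 0 ≤ χ x) ∧ (∀ x, χ x ≤ 1) ∧
    (∀ x, ‖x‖ ≤ R → χ x = 1) ∧ ∀ x v, |fderiv ℝ χ x v| ≤ C / R * ‖v‖ := by
  let b : ContDiffBump (0 : Eucl n) := ⟨1, 2, one_pos, one_lt_two⟩
  have hb : ContDiff ℝ ∞ b := b.contDiff
  obtain ⟨C, hC⟩ := (hb.continuous_fderiv (by simp)).bounded_above_of_compact_support
    (b.hasCompactSupport.fderiv (𝕜 := ℝ))
  refine ⟨C, (norm_nonneg _).trans (hC 0), fun R hR => ⟨fun x => b (R⁻¹ • x), ?_, ?_,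
    fun x => b.nonneg, fun x => b.le_one, fun x hx => ?_, fun x v => ?_⟩⟩
  · exact hb.comp (contDiff_const_smul _)
  · exact b.hasCompactSupport.comp_homeomorph (Homeomorph.smulOfNeZero R⁻¹ (by positivity))
  · refine b.one_of_mem_closedBall ?_
    rw [mem_closedBall_zero_iff, norm_smul, norm_inv, Real.norm_of_nonneg hR.le]
    rw [inv_mul_le_iff₀ hR]
    simpa [b] using hx
  · have h1 := (hb.differentiable (by simp) (R⁻¹ • x)).hasFDerivAt.comp x
      ((hasFDerivAt_id x).const_smul R⁻¹)
    have h2 : fderiv ℝ (fun x => b (R⁻¹ • x)) x = _ := h1.fderiv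
    rw [h2]
    simp only [ContinuousLinearMap.coe_comp, Function.comp_apply, FunLike.coe_smul,
      Pi.smul_apply, ContinuousLinearMap.coe_id', id_eq, map_smul, smul_eq_mul, abs_mul]
    rw [abs_of_pos (inv_pos.2 hR), div_eq_inv_mul, mul_assoc]
    gcongr
    exact ((fderiv ℝ b (R⁻¹ • x)).le_opNorm v).trans (by gcongr; exact hC _)

theorem compact_sq {χ : Eucl n → ℝ} (hc : HasCompactSupport χ) :
    HasCompactSupport fun x => χ x ^ 2 :=
  hc.comp_left (g := fun a : ℝ => a ^ 2) (by simp)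

/-- Mixed second derivatives commute. -/
theorem fderiv_fderiv_comm {f : Eucl n → ℝ} (hf : ContDiff ℝ ∞ f) (x v w : Eucl n) :
    fderiv ℝ (fun y => fderiv ℝ f y v) x w = fderiv ℝ (fun y => fderiv ℝ f y w) x v := by
  have h2 : ContDiff ℝ ∞ (fderiv ℝ f) := hf.fderiv_right (by simp)
  have hd : DifferentiableAt ℝ (fderiv ℝ f) x := h2.differentiable (by simp) x
  have key : ∀ v w, fderiv ℝ (fun y => fderiv ℝ f y v) x w = fderiv ℝ (fderiv ℝ f) x w v := by
    intro v w
    have := hd.hasFDerivAt.clm_apply (hasFDerivAt_const v x)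
    rw [this.fderiv]
    simp
  rw [key, key]
  refine hf.contDiffAt.isSymmSndFDerivAt ?_ w v
  simp only [minSmoothness_of_isRCLikeNormedField]
  exact ENat.LEInfty.out

/-- The rotated gradient `∂_j ψ e_i - ∂_i ψ e_j`. It is a solenoidal test field, and orthogonality to
all of these means vanishing curl. -/
noncomputable def rotGrad (ψ : Eucl n → ℝ) (i j : Fin n) (y : Eucl n) : Eucl n :=
  fderiv ℝ ψ y (EuclideanSpace.single j 1) • EuclideanSpace.single i (1 : ℝ)
    - fderiv ℝ ψ y (EuclideanSpace.single i 1) • EuclideanSpace.single j (1 : ℝ)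

theorem isTestField_rotGrad {ψ : Eucl n → ℝ} (hψ : ContDiff ℝ ∞ ψ) (hc : HasCompactSupport ψ)
    (i j : Fin n) : IsTestField (rotGrad ψ i j) := by
  have hs : ∀ v, ContDiff ℝ ∞ fun y => fderiv ℝ ψ y v := fun v =>
    (hψ.fderiv_right (by simp)).clm_apply contDiff_const
  have hsm : ContDiff ℝ ∞ (rotGrad ψ i j) :=
    ((hs _).smul contDiff_const).sub ((hs _).smul contDiff_const)
  refine ⟨hsm, ?_, fun x => ?_⟩
  · exact ((compact_fderiv_apply hc _).smul_right).sub ((compact_fderiv_apply hc _).smul_right)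
  · have key : ∀ k, jac (rotGrad ψ i j) x k k
        = fderiv ℝ (fun y => fderiv ℝ ψ y (EuclideanSpace.single j 1)) x
            (EuclideanSpace.single k 1) * (EuclideanSpace.single i (1 : ℝ) : Eucl n) k
          - fderiv ℝ (fun y => fderiv ℝ ψ y (EuclideanSpace.single i 1)) x
            (EuclideanSpace.single k 1) * (EuclideanSpace.single j (1 : ℝ) : Eucl n) k := by
      intro k
      have hd := fun v => ((hs v).differentiable (by simp) x).hasFDerivAt
      have := ((hd (EuclideanSpace.single j 1)).smul_const (EuclideanSpace.single i (1 : ℝ))).sub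
        ((hd (EuclideanSpace.single i 1)).smul_const (EuclideanSpace.single j (1 : ℝ)))
      have h2 : fderiv ℝ (rotGrad ψ i j) x = _ := this.fderiv
      rw [jac, h2]
      simp
    simp_rw [key, Finset.sum_sub_distrib]
    simp [fderiv_fderiv_comm hψ x (EuclideanSpace.single j 1)]

/-- The mollification of a field orthogonal to all test fields is irrotational. -/
theorem jac_moll_symm_of_orthogonal (b : ContDiffBump (0 : Eucl n)) (r : L2 n)
    (h : ∀ φ : testFields n, ⟪testL n φ, r⟫ = 0) (x : Eucl n) (i j : Fin n) :
    jac (moll b r) x i j = jac (moll b r) x j i := by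
  have hψ : ContDiff ℝ ∞ fun y => mollKernel b (x - y) :=
    (mollKernel_contDiff b).comp (by fun_prop)
  have hc : HasCompactSupport fun y => mollKernel b (x - y) :=
    (mollKernel_compact b).comp_homeomorph (Homeomorph.subLeft x)
  have hder : ∀ y v, fderiv ℝ (fun y => mollKernel b (x - y)) y v
      = - fderiv ℝ (mollKernel b) (x - y) v := by
    intro y v
    have h1 := ((mollKernel_contDiff b).differentiable (by simp) (x - y)).hasFDerivAt.comp y
      ((hasFDerivAt_id y).const_sub x)
    have h2 : fderiv ℝ (fun y => mollKernel b (x - y)) y = _ := h1.fderiv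
    rw [h2]
    simp
  have h0 := h ⟨_, isTestField_rotGrad hψ hc i j⟩
  rw [jac_moll_eq_inner, jac_moll_eq_inner, ← sub_eq_zero, ← inner_sub_left, ← neg_eq_zero,
    ← inner_neg_left, ← h0]
  congr 1
  rw [testL]
  apply Lp.ext
  filter_upwards [Lp.coeFn_neg ((gradKernel_memLp b x i j).toLp _ - (gradKernel_memLp b x j i).toLp _),
    Lp.coeFn_sub ((gradKernel_memLp b x i j).toLp _) ((gradKernel_memLp b x j i).toLp _),
    (gradKernel_memLp b x i j).coeFn_toLp, (gradKernel_memLp b x j i).coeFn_toLp,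
    (isTestField_rotGrad hψ hc i j).memLp.coeFn_toLp] with y h1 h2 h3 h4 h5
  rw [h1, Pi.neg_apply, h2, Pi.sub_apply, h3, h4]
  refine Eq.trans ?_ h5.symm
  simp only [gradKernel, rotGrad, hder]
  module

/-- Caccioppoli's inequality for a field that is both solenoidal and irrotational. The components of
such a field are harmonic, so that its gradient on a ball is controlled by the field on a larger
one. -/
theorem caccioppoli {W : Eucl n → Eucl n} (hW : ContDiff ℝ ∞ W) (hL : MemLp W 2 volume)
    (hdiv : ∀ x, ∑ i, jac W x i i = 0) (hsymm : ∀ x i j, jac W x i j = jac W x j i)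
    {χ : Eucl n → ℝ} (hχ : ContDiff ℝ ∞ χ) (hc : HasCompactSupport χ) {M : ℝ}
    (hM : ∀ x i, |fderiv ℝ χ x (EuclideanSpace.single i 1)| ≤ M) :
    ∫ x, χ x ^ 2 * ∑ i, ∑ j, jac W x i j ^ 2 ≤ 4 * (n * M ^ 2 * ∫ x, ‖W x‖ ^ 2) := by
  have hM0 : Nonempty (Fin n) → 0 ≤ M := fun ⟨i⟩ => (abs_nonneg _).trans (hM 0 i)
  have hW1 : ContDiff ℝ 1 W := hW.of_le (by simp)
  have hχ1 : ContDiff ℝ 1 χ := hχ.of_le (by simp)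
  have hjs : ∀ i j, ContDiff ℝ ∞ fun x => jac W x i j := fun i j =>
    contDiff_coord ((hW.fderiv_right (by simp)).clm_apply contDiff_const) i
  have hjc : ∀ i j, Continuous fun x => jac W x i j := fun i j => (hjs i j).continuous
  have hWc : ∀ j, Continuous fun x => W x j := fun j => (contDiff_coord hW j).continuous
  have hχd : ∀ i, Continuous fun x => fderiv ℝ χ x (EuclideanSpace.single i 1) := fun i =>
    continuous_fderiv_apply' hχ1 _
  have hχdc : ∀ i, HasCompactSupport fun x => fderiv ℝ χ x (EuclideanSpace.single i 1) :=
    fun i => compact_fderiv_apply hc _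
  have hc2 : HasCompactSupport fun x => χ x ^ 2 := compact_sq hc
  -- the cross terms produced by the cutoff
  let X : Fin n → Fin n → Eucl n → ℝ := fun i j x =>
    2 * χ x * fderiv ℝ χ x (EuclideanSpace.single i 1) * jac W x i j * W x j
  have hXi : ∀ i j, Integrable (X i j) := fun i j => by
    refine Continuous.integrable_of_hasCompactSupport ?_ ?_
    · exact (((continuous_const.mul hχ.continuous).mul (hχd i)).mul (hjc i j)).mul (hWc j)
    · exact (((hχdc i).mul_left (f := fun x => 2 * χ x)).mul_right).mul_right
  have hAi : ∀ i j, Integrable fun x => χ x ^ 2 * jac W x i j ^ 2 := fun i j =>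
    ((hχ.continuous.pow 2).mul ((hjc i j).pow 2)).integrable_of_hasCompactSupport hc2.mul_right
  have hBi : ∀ i j, Integrable fun x => fderiv ℝ χ x (EuclideanSpace.single i 1) ^ 2 * W x j ^ 2 := by
    intro i j
    refine (((hχd i).pow 2).mul ((hWc j).pow 2)).integrable_of_hasCompactSupport ?_
    exact (compact_sq (hχdc i)).mul_right
  -- integration by parts in each term
  have hparts : ∀ i j, ∫ x, χ x ^ 2 * jac W x i j ^ 2
      = - (∫ x, X i j x) - ∫ x, χ x ^ 2 * W x j *
        fderiv ℝ (fun y => jac W y i i) x (EuclideanSpace.single j 1) := by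
    intro i j
    have hg : ContDiff ℝ 1 fun x => χ x ^ 2 * jac W x i j :=
      (hχ1.pow 2).mul ((hjs i j).of_le (by simp))
    have e1 := integral_mul_fderiv_eq_neg (contDiff_coord hW1 j) hg
      (hc2.mul_right) (EuclideanSpace.single i 1)
    have e2 : ∀ x, fderiv ℝ (fun y => W y j) x (EuclideanSpace.single i 1) * (χ x ^ 2 * jac W x i j)
        = χ x ^ 2 * jac W x i j ^ 2 := by
      intro x
      rw [fderiv_coord (hW1.differentiable one_ne_zero x)]
      change jac W x j i * _ = _
      rw [hsymm x j i]
      ring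
    have e3 : ∀ x, W x j * fderiv ℝ (fun x => χ x ^ 2 * jac W x i j) x (EuclideanSpace.single i 1)
        = X i j x + χ x ^ 2 * W x j *
          fderiv ℝ (fun y => jac W y i i) x (EuclideanSpace.single j 1) := by
      intro x
      have hd1 := (hχ1.differentiable one_ne_zero x).hasFDerivAt
      have hd2 := ((hjs i j).differentiable (by simp) x).hasFDerivAt
      have h3 : fderiv ℝ (fun x => χ x ^ 2 * jac W x i j) x = _ := ((hd1.pow 2).mul hd2).fderiv
      have h4 : fderiv ℝ (fun y => jac W y i j) x (EuclideanSpace.single i 1)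
          = fderiv ℝ (fun y => jac W y i i) x (EuclideanSpace.single j 1) := by
        have := fderiv_fderiv_comm (contDiff_coord hW i) x (EuclideanSpace.single j 1)
          (EuclideanSpace.single i 1)
        simp_rw [fderiv_coord (hW1.differentiable one_ne_zero _)] at this
        exact this
      rw [h3]
      simp only [X, add_apply, smul_apply, smul_eq_mul, h4]
      simp
      ring
    simp_rw [e2, e3] at e1
    rw [integral_add (hXi i j)] at e1
    · linarith
    · refine Continuous.integrable_of_hasCompactSupport ?_ (hc2.mul_right.mul_right)
      exact (((hχ.continuous.pow 2).mul (hWc j))).mul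
        (continuous_fderiv_apply' ((hjs i i).of_le (by simp)) _)
  -- the remaining terms add up to the derivative of the divergence
  have hzero : ∀ j, ∑ i, ∫ x, χ x ^ 2 * W x j *
        fderiv ℝ (fun y => jac W y i i) x (EuclideanSpace.single j 1) = 0 := by
    intro j
    rw [← integral_finsetSum]
    · have : ∀ x, ∑ i, χ x ^ 2 * W x j *
        fderiv ℝ (fun y => jac W y i i) x (EuclideanSpace.single j 1) = 0 := by
        intro x
        rw [← Finset.mul_sum]
        have h5 : fderiv ℝ (fun y => ∑ i, jac W y i i) x = ∑ i, fderiv ℝ (fun y => jac W y i i) x :=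
          fderiv_fun_sum fun i _ => (hjs i i).differentiable (by simp) x
        simp_rw [hdiv] at h5
        rw [← sum_apply, ← h5]
        simp
      simp_rw [this]
      simp
    · intro i _
      refine Continuous.integrable_of_hasCompactSupport ?_ (hc2.mul_right.mul_right)
      exact (((hχ.continuous.pow 2).mul (hWc j))).mul
        (continuous_fderiv_apply' ((hjs i i).of_le (by simp)) _)
  -- Young's inequality, with half of the gradient to be absorbed on the left
  have hbound : ∀ i j, - (∫ x, X i j x) ≤ (1 / 2) * (∫ x, χ x ^ 2 * jac W x i j ^ 2)
      + 2 * ∫ x, fderiv ℝ χ x (EuclideanSpace.single i 1) ^ 2 * W x j ^ 2 := by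
    intro i j
    rw [← integral_neg, ← integral_const_mul, ← integral_const_mul,
      ← integral_add ((hAi i j).const_mul _) ((hBi i j).const_mul _)]
    refine integral_mono (hXi i j).neg (((hAi i j).const_mul _).add ((hBi i j).const_mul _)) ?_
    intro x
    simp only [X]
    nlinarith [sq_nonneg (χ x * jac W x i j + 2 * (fderiv ℝ χ x (EuclideanSpace.single i 1) * W x j))]
  have hWsq : ∀ j, Integrable fun x => W x j ^ 2 := by
    intro j
    have h := (hL.norm).integrable_sq
    refine h.mono' ((hWc j).pow 2).aestronglyMeasurable (Eventually.of_forall fun x => ?_)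
    rw [Real.norm_of_nonneg (sq_nonneg _), ← sq_abs]
    gcongr
    exact abs_coord_le _ _
  have hB : ∀ i j, ∫ x, fderiv ℝ χ x (EuclideanSpace.single i 1) ^ 2 * W x j ^ 2
      ≤ M ^ 2 * ∫ x, W x j ^ 2 := by
    intro i j
    rw [← integral_const_mul]
    refine integral_mono (hBi i j) ((hWsq j).const_mul _) fun x => ?_
    simp only
    gcongr ?_ * _
    rw [← sq_abs]
    gcongr
    exact hM x i
  have hsum : ∫ x, χ x ^ 2 * ∑ i, ∑ j, jac W x i j ^ 2
      = ∑ i, ∑ j, ∫ x, χ x ^ 2 * jac W x i j ^ 2 := by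
    simp_rw [Finset.mul_sum]
    rw [integral_finsetSum _ fun i _ => integrable_finsetSum _ fun j _ => hAi i j]
    exact Finset.sum_congr rfl fun i _ => integral_finsetSum _ fun j _ => hAi i j
  have hnorm : ∫ x, ‖W x‖ ^ 2 = ∑ j, ∫ x, W x j ^ 2 := by
    simp_rw [eucl_norm_sq]
    exact integral_finsetSum _ fun j _ => hWsq j
  have hS : ∑ i, ∑ j, ∫ x, χ x ^ 2 * jac W x i j ^ 2 = ∑ i, ∑ j, - (∫ x, X i j x) := by
    simp_rw [hparts, Finset.sum_sub_distrib]
    rw [Finset.sum_comm (f := fun i j => ∫ x, χ x ^ 2 * W x j *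
        fderiv ℝ (fun y => jac W y i i) x (EuclideanSpace.single j 1))]
    simp_rw [hzero]
    simp
  have hT : ∑ i, ∑ j, - (∫ x, X i j x) ≤ ∑ i : Fin n, ∑ j,
      ((1 / 2) * (∫ x, χ x ^ 2 * jac W x i j ^ 2) + 2 * (M ^ 2 * ∫ x, W x j ^ 2)) :=
    Finset.sum_le_sum fun i _ => Finset.sum_le_sum fun j _ =>
      (hbound i j).trans (by linarith [hB i j])
  simp_rw [Finset.sum_add_distrib, ← Finset.mul_sum] at hT
  rw [← hnorm] at hT
  simp only [Finset.sum_const, Finset.card_univ, Fintype.card_fin, nsmul_eq_mul] at hT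
  rw [hsum]
  linarith

/-- A square-integrable solenoidal field orthogonal to all test fields vanishes: its mollifications
are solenoidal and irrotational, hence constant by Caccioppoli's inequality with cutoffs at
scales tending to infinity, and a constant is square integrable only if it is zero. -/
theorem eq_zero_of_orthogonal (r : L2 n) (hd : IsDivFree r)
    (h : ∀ φ : testFields n, ⟪testL n φ, r⟫ = 0) : r = 0 := by
  rcases Nat.eq_zero_or_pos n with rfl | hn
  · apply Lp.ext
    exact Eventually.of_forall fun x => Subsingleton.elim _ _
  -- in positive dimension the whole space has infinite measure
  have : Nonempty (Fin n) := ⟨⟨0, hn⟩⟩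
  have : Nontrivial (Eucl n) := inferInstance
  have hmoll : ∀ b : ContDiffBump (0 : Eucl n), mollL b r = 0 := by
    intro b
    set W := moll b r with hWdef
    have hloc := L2_locallyIntegrable r
    have hW : ContDiff ℝ ∞ W := contDiff_moll b hloc
    have hL : MemLp W 2 volume := memLp_moll b (Lp.memLp r)
    obtain ⟨C, hC0, hC⟩ := exists_cutoff n
    have hjc : ∀ i j, Continuous fun x => jac W x i j := fun i j =>
      continuous_jac (hW.of_le (by simp)) i j
    have hqc : Continuous fun x => ∑ i, ∑ j, jac W x i j ^ 2 :=
      continuous_finsetSum _ fun i _ => continuous_finsetSum _ fun j _ => (hjc i j).pow 2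
    have hq0 : ∀ x, 0 ≤ ∑ i, ∑ j, jac W x i j ^ 2 := fun x =>
      Finset.sum_nonneg fun i _ => Finset.sum_nonneg fun j _ => sq_nonneg _
    have hball : ∀ ρ : ℕ, ∫ x in Metric.closedBall (0 : Eucl n) ρ, ∑ i, ∑ j, jac W x i j ^ 2 = 0 := by
      intro ρ
      refine le_antisymm ?_ (integral_nonneg hq0)
      have hlim : Tendsto (fun R : ℝ => 4 * (n * (C / R) ^ 2 * ∫ x, ‖W x‖ ^ 2)) atTop
          (𝓝 (4 * (n * 0 ^ 2 * ∫ x, ‖W x‖ ^ 2))) :=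
        ((((tendsto_const_nhds.div_atTop tendsto_id).pow 2).const_mul _).mul_const _).const_mul _
      simp only [ne_eq, OfNat.ofNat_ne_zero, not_false_eq_true, zero_pow, mul_zero, zero_mul] at hlim
      refine ge_of_tendsto hlim ?_
      filter_upwards [eventually_ge_atTop (ρ : ℝ), eventually_gt_atTop 0] with R hR hR0
      obtain ⟨χ, hχ, hc, h0, h1, hone, hder⟩ := hC R hR0
      refine le_trans ?_ (caccioppoli hW hL (div_moll_eq_zero b hloc hd)
        (jac_moll_symm_of_orthogonal b r h) hχ hc (M := C / R) fun x i => ?_)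
      · have hc2 : HasCompactSupport fun x => χ x ^ 2 := compact_sq hc
        have hint : Integrable fun x => χ x ^ 2 * ∑ i, ∑ j, jac W x i j ^ 2 :=
          ((hχ.continuous.pow 2).mul hqc).integrable_of_hasCompactSupport hc2.mul_right
        calc ∫ x in Metric.closedBall (0 : Eucl n) ρ, ∑ i, ∑ j, jac W x i j ^ 2
            = ∫ x in Metric.closedBall (0 : Eucl n) ρ, χ x ^ 2 * ∑ i, ∑ j, jac W x i j ^ 2 := by
              refine setIntegral_congr_fun Metric.isClosed_closedBall.measurableSet fun x hx => ?_
              rw [hone x ((mem_closedBall_zero_iff.1 hx).trans hR)]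
              ring
          _ ≤ ∫ x, χ x ^ 2 * ∑ i, ∑ j, jac W x i j ^ 2 :=
              setIntegral_le_integral hint
                (Eventually.of_forall fun x => mul_nonneg (sq_nonneg _) (hq0 x))
      · simpa using hder x (EuclideanSpace.single i 1)
    have hae : (fun x => ∑ i, ∑ j, jac W x i j ^ 2) =ᵐ[volume] fun _ => 0 := by
      have hall : ∀ᵐ x : Eucl n, ∀ ρ : ℕ, x ∈ Metric.closedBall (0 : Eucl n) ρ →
          ∑ i, ∑ j, jac W x i j ^ 2 = 0 := by
        rw [ae_all_iff]
        intro ρ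
        have := (setIntegral_eq_zero_iff_of_nonneg_ae (Eventually.of_forall hq0)
          (hqc.locallyIntegrable.integrableOn_isCompact (isCompact_closedBall (0 : Eucl n) ρ))).1
            (hball ρ)
        exact (ae_restrict_iff' Metric.isClosed_closedBall.measurableSet).1 this
      filter_upwards [hall] with x hx
      obtain ⟨ρ, hρ⟩ := exists_nat_ge ‖x‖
      exact hx ρ (mem_closedBall_zero_iff.2 hρ)
    have hq := (hqc.ae_eq_iff_eq (μ := volume) continuous_const).1 hae
    have hjz : ∀ x i j, jac W x i j = 0 := by
      intro x i j
      have h1 : ∑ i, ∑ j, jac W x i j ^ 2 = 0 := congrFun hq x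
      have h2 := (Finset.sum_eq_zero_iff_of_nonneg
        (fun i _ => Finset.sum_nonneg fun j _ => sq_nonneg (jac W x i j))).1 h1 i (Finset.mem_univ i)
      have h3 := (Finset.sum_eq_zero_iff_of_nonneg
        (fun j _ => sq_nonneg (jac W x i j))).1 h2 j (Finset.mem_univ j)
      exact (pow_eq_zero_iff two_ne_zero).1 h3
    have hf : ∀ x, fderiv ℝ W x = 0 := by
      intro x
      refine ContinuousLinearMap.coe_injective ?_
      refine (EuclideanSpace.basisFun (Fin n) ℝ).toBasis.ext fun j => ?_
      ext i
      simpa [jac] using hjz x i j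
    have hconst : W = fun _ => W 0 := by
      ext1 x
      exact is_const_of_fderiv_eq_zero (hW.differentiable (by simp)) hf x 0
    rw [hconst, memLp_const_iff (by norm_num) (by norm_num)] at hL
    have hW0 : W 0 = 0 := by
      rcases hL with h | h
      · exact h
      · simp at h
    apply Lp.ext
    filter_upwards [mollL_coeFn b r, Lp.coeFn_zero (Eucl n) 2 (volume : Measure (Eucl n))]
      with x h1 h2
    rw [h1, h2, ← hWdef, hconst, hW0]
    rfl
  have := mollL_tendsto r
  simp_rw [hmoll] at this
  exact tendsto_nhds_unique this tendsto_const_nhds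

/-- Test fields are dense in the space of solenoidal fields of `L²`. -/
theorem mem_closure_testL {u : L2 n} (hu : u ∈ divFree n) :
    u ∈ closure (range (testL n)) := by
  let K := (LinearMap.range (testL n)).topologicalClosure
  have hK : IsClosed (K : Set (L2 n)) := Submodule.isClosed_topologicalClosure _
  have : CompleteSpace K := hK.completeSpace_coe
  have hsub : K ≤ divFree n := by
    refine Submodule.topologicalClosure_minimal _ ?_ isClosed_divFree
    rintro _ ⟨φ, rfl⟩
    exact testL_mem_divFree φ
  have hr : u - K.starProjection u ∈ divFree n :=
    (divFree n).sub_mem hu (hsub (Submodule.starProjection_apply_mem K u))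
  have hz := eq_zero_of_orthogonal _ hr fun φ => by
    have hφ : testL n φ ∈ K := Submodule.le_topologicalClosure _ ⟨φ, rfl⟩
    exact (Submodule.sub_starProjection_mem_orthogonal (K := K) u) _ hφ
  have : u ∈ K := by
    rw [sub_eq_zero.1 hz]
    exact Submodule.starProjection_apply_mem K u
  have h2 : u ∈ (K : Set (L2 n)) := this
  rwa [Submodule.topologicalClosure_coe] at h2

end Density

/-! ### Symmetric gradients at a fixed time -/

section FixedTime

variable {n : ℕ}

theorem integral_inner_gradient_eq_zero {φ : Eucl n → Eucl n} (h : IsTestField φ)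
    {ψ : Eucl n → ℝ} (hψ : ContDiff ℝ ∞ ψ) : ∫ x, ⟪φ x, gradient ψ x⟫ = 0 := by
  have hψ1 : ContDiff ℝ 1 ψ := hψ.of_le (by simp)
  have hφ1 : ContDiff ℝ 1 φ := h.smooth.of_le (by simp)
  simp_rw [eucl_inner, gradient_apply]
  rw [integral_finsetSum]
  · have : ∀ i, ∫ x, φ x i * fderiv ℝ ψ x (EuclideanSpace.single i 1)
        = - ∫ x, ψ x * jac φ x i i := by
      intro i
      have := integral_mul_fderiv_eq_neg hψ1 (contDiff_coord hφ1 i) (compact_coord h.compact i)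
        (EuclideanSpace.single i 1)
      simp_rw [fderiv_coord (hφ1.differentiable one_ne_zero _)] at this
      rw [eq_neg_iff_add_eq_zero, add_comm, ← eq_neg_iff_add_eq_zero]
      simp_rw [mul_comm (φ _ i)]
      exact this
    simp_rw [this]
    rw [Finset.sum_neg_distrib, ← integral_finsetSum]
    · simp_rw [← Finset.mul_sum, h.div_zero]
      simp
    · intro i _
      exact (hψ1.continuous.mul (continuous_jac hφ1 i i)).integrable_of_hasCompactSupport
        (compact_jac h.compact i i).mul_left
  · intro i _
    exact ((contDiff_coord hφ1 i).continuous.mul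
      (continuous_fderiv_apply' hψ1 _)).integrable_of_hasCompactSupport
      (compact_coord h.compact i).mul_right

theorem contract_eq_inner (L : Eucl n →L[ℝ] Eucl n) (a c : Eucl n) :
    contract (fun i j => (L (EuclideanSpace.single j 1)) i) (fun i j => a i * c j) = ⟪L c, a⟫ := by
  have h : c = ∑ j, c j • EuclideanSpace.single j (1 : ℝ) := by
    have := (EuclideanSpace.basisFun (Fin n) ℝ).sum_repr c
    simpa using this.symm
  have h2 : ∀ i, (L c) i = ∑ j, c j * (L (EuclideanSpace.single j 1)) i := by
    intro i
    conv_lhs => rw [h]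
    simp
  rw [eucl_inner]
  unfold contract
  simp_rw [h2, Finset.sum_mul]
  exact Finset.sum_congr rfl fun i _ => Finset.sum_congr rfl fun j _ => by ring

theorem contract_jac_eq_inner (φ : Eucl n → Eucl n) (x a c : Eucl n) :
    contract (jac φ x) (fun i j => a i * c j) = ⟪fderiv ℝ φ x c, a⟫ :=
  contract_eq_inner _ a c

section Multiplication

variable {A : Eucl n → (Eucl n →L[ℝ] Eucl n)}

theorem memLp_clm_apply (hA : MemLp A ⊤ volume) {u : Eucl n → Eucl n} (hu : MemLp u 2 volume) :
    MemLp (fun x => A x (u x)) 2 volume := by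
  refine MemLp.of_le_mul (c := (eLpNormEssSup A volume).toReal) hu
    ((ContinuousLinearMap.id ℝ (Eucl n →L[ℝ] Eucl n)).aestronglyMeasurable_comp₂ hA.1 hu.1) ?_
  have hfin : eLpNormEssSup A volume ≠ ⊤ := by
    have := hA.2.ne
    rwa [eLpNorm_exponent_top] at this
  filter_upwards [enorm_ae_le_eLpNormEssSup A volume] with x hx
  refine ((A x).le_opNorm _).trans ?_
  gcongr
  rw [← toReal_enorm]
  exact ENNReal.toReal_mono hfin hx

theorem ae_norm_le_eLpNorm_top {F : Type*} [NormedAddCommGroup F] {g : Eucl n → F}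
    (hg : eLpNorm g ⊤ volume < ⊤) : ∀ᵐ x, ‖g x‖ ≤ (eLpNorm g ⊤ volume).toReal := by
  rw [eLpNorm_exponent_top] at *
  filter_upwards [enorm_ae_le_eLpNormEssSup g volume] with x hx
  rw [← toReal_enorm]
  exact ENNReal.toReal_mono hg.ne hx

/-- Multiplication by a bounded field of linear maps, as a linear map of `L²`. -/
noncomputable def mulLin (hA : MemLp A ⊤ volume) : L2 n →ₗ[ℝ] L2 n where
  toFun u := (memLp_clm_apply hA (Lp.memLp u)).toLp _
  map_add' u v := by
    rw [← MemLp.toLp_add]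
    refine MemLp.toLp_congr _ _ ?_
    filter_upwards [Lp.coeFn_add u v] with x hx
    rw [hx]
    exact map_add _ _ _
  map_smul' c u := by
    rw [RingHom.id_apply, ← MemLp.toLp_const_smul]
    refine MemLp.toLp_congr _ _ ?_
    filter_upwards [Lp.coeFn_smul c u] with x hx
    rw [hx]
    exact (A x).map_smul c (u x)

theorem mulLin_coeFn (hA : MemLp A ⊤ volume) (u : L2 n) :
    mulLin hA u =ᵐ[volume] fun x => A x (u x) :=
  MemLp.coeFn_toLp (memLp_clm_apply hA (Lp.memLp u))

theorem mulLin_norm_le (hA : MemLp A ⊤ volume) {C : ℝ} (hC : ∀ᵐ x, ‖A x‖ ≤ C) (u : L2 n) :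
    ‖mulLin hA u‖ ≤ C * ‖u‖ := by
  refine Lp.norm_le_mul_norm_of_ae_le_mul ?_
  filter_upwards [mulLin_coeFn hA u, hC] with x h1 h2
  rw [h1]
  exact ((A x).le_opNorm _).trans (by gcongr)

theorem inner_mulLin (hA : MemLp A ⊤ volume) (u v : L2 n) :
    ⟪mulLin hA u, v⟫ = ∫ x, ⟪A x (u x), v x⟫ := by
  rw [L2.inner_def]
  exact integral_congr_ae ((mulLin_coeFn hA u).mono fun x hx => by simp only [hx])

theorem norm_moll_le {F : Type*} [NormedAddCommGroup F] [NormedSpace ℝ F]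
    (b : ContDiffBump (0 : Eucl n)) {g : Eucl n → F} {C : ℝ} (hC : ∀ᵐ x, ‖g x‖ ≤ C) (x : Eucl n) :
    ‖moll b g x‖ ≤ C := by
  rw [moll_apply']
  have h1 : ∀ᵐ y, ‖mollKernel b (x - y) • g y‖ ≤ mollKernel b (x - y) * C := by
    filter_upwards [hC] with y hy
    rw [norm_smul, Real.norm_of_nonneg (mollKernel_nonneg b _)]
    gcongr
    exact mollKernel_nonneg b _
  have hi : Integrable fun y => mollKernel b (x - y) * C :=
    ((mollKernel_integrable b).comp_sub_left x).mul_const C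
  refine (norm_integral_le_of_norm_le hi h1).trans_eq ?_
  rw [integral_mul_const, integral_sub_left_eq_self (mollKernel b), b.integral_normed, one_mul]

theorem memLp_top_moll (b : ContDiffBump (0 : Eucl n)) (hA : MemLp A ⊤ volume) :
    MemLp (moll b A) ⊤ volume :=
  memLp_top_of_bound
    (continuous_moll b (hA.locallyIntegrable le_top)).aestronglyMeasurable _
    (Eventually.of_forall (norm_moll_le b (ae_norm_le_eLpNorm_top hA.2)))

theorem tendsto_of_enorm_sq {E : Type*} [NormedAddCommGroup E] {a : ℕ → E} {c : E}
    (h : Tendsto (fun m => ‖a m - c‖ₑ ^ 2) atTop (𝓝 0)) : Tendsto a atTop (𝓝 c) := by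
  rw [tendsto_iff_norm_sub_tendsto_zero]
  have h2 := (ENNReal.tendsto_toReal ENNReal.zero_ne_top).comp h
  simp only [Function.comp_def, ENNReal.toReal_pow, toReal_enorm, ENNReal.toReal_zero] at h2
  have h3 := h2.sqrt
  simpa using h3

/-- Multiplication by the mollifications of a bounded field converges strongly in `L²`, although the
mollifications need not converge in `L^∞`. -/
theorem mulLin_moll_tendsto (hA : MemLp A ⊤ volume) (u : L2 n) :
    Tendsto (fun m => mulLin (memLp_top_moll (bumpSeq n m) hA) u) atTop (𝓝 (mulLin hA u)) := by
  apply tendsto_of_enorm_sq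
  set C := (eLpNorm A ⊤ volume).toReal with hCdef
  have hC := ae_norm_le_eLpNorm_top hA.2
  have e : ∀ m, ‖mulLin (memLp_top_moll (bumpSeq n m) hA) u - mulLin hA u‖ₑ ^ 2
      = ∫⁻ x, ‖(moll (bumpSeq n m) A x - A x) (u x)‖ₑ ^ 2 := by
    intro m
    rw [Lp.enorm_def, eLpNorm_two_sq]
    refine lintegral_congr_ae ?_
    filter_upwards [Lp.coeFn_sub (mulLin (memLp_top_moll (bumpSeq n m) hA) u) (mulLin hA u),
      mulLin_coeFn (memLp_top_moll (bumpSeq n m) hA) u, mulLin_coeFn hA u] with x h1 h2 h3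
    rw [h1, Pi.sub_apply, h2, h3]
    simp
  simp_rw [e]
  have hz : (0 : ENNReal) = ∫⁻ _ : Eucl n, 0 := by simp
  rw [hz]
  refine tendsto_lintegral_of_dominated_convergence' (fun x => (ENNReal.ofReal (2 * C) * ‖u x‖ₑ) ^ 2)
    (fun m => ?_) (fun m => ?_) ?_ ?_
  · refine AEMeasurable.pow_const (AEStronglyMeasurable.enorm ?_) 2
    exact (ContinuousLinearMap.id ℝ (Eucl n →L[ℝ] Eucl n)).aestronglyMeasurable_comp₂
      ((memLp_top_moll (bumpSeq n m) hA).1.sub hA.1) (Lp.memLp u).1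
  · filter_upwards [hC] with x hx
    gcongr
    rw [← ofReal_norm, ← ofReal_norm, ← ENNReal.ofReal_mul (by positivity)]
    refine ENNReal.ofReal_le_ofReal (((ContinuousLinearMap.le_opNorm _ _)).trans ?_)
    gcongr
    refine (norm_sub_le _ _).trans ?_
    have := norm_moll_le (bumpSeq n m) hC x
    linarith
  · simp_rw [mul_pow]
    rw [lintegral_const_mul' _ _ (by finiteness), ← eLpNorm_two_sq]
    exact (ENNReal.mul_lt_top (by finiteness) (ENNReal.pow_lt_top (Lp.memLp u).2)).ne
  · filter_upwards [moll_tendsto_ae (hA.locallyIntegrable le_top)] with x hx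
    have h1 : Tendsto (fun m => (moll (bumpSeq n m) A x - A x) (u x)) atTop (𝓝 0) := by
      have h2 : Tendsto (fun m => moll (bumpSeq n m) A x - A x) atTop (𝓝 0) := by
        simpa using hx.sub_const (A x)
      have h3 := ((ContinuousLinearMap.apply ℝ (Eucl n) (u x)).continuous.tendsto 0).comp h2
      rw [map_zero] at h3
      exact h3
    have h4 := ((ENNReal.continuous_pow 2).tendsto _).comp h1.enorm
    simpa [Function.comp_def] using h4

theorem mulLin_moll_tendsto' (hA : MemLp A ⊤ volume) {u : ℕ → L2 n} {v : L2 n}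
    (hu : Tendsto u atTop (𝓝 v)) :
    Tendsto (fun m => mulLin (memLp_top_moll (bumpSeq n m) hA) (u m)) atTop
      (𝓝 (mulLin hA v)) := by
  have h1 := mulLin_moll_tendsto hA v
  have h2 : Tendsto (fun m => mulLin (memLp_top_moll (bumpSeq n m) hA) (u m - v)) atTop (𝓝 0) := by
    refine squeeze_zero_norm (a := fun m => (eLpNorm A ⊤ volume).toReal * ‖u m - v‖) (fun m => ?_) ?_
    · exact mulLin_norm_le _ (Eventually.of_forall
        (norm_moll_le _ (ae_norm_le_eLpNorm_top hA.2))) _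
    · have := (tendsto_iff_norm_sub_tendsto_zero.1 hu).const_mul (eLpNorm A ⊤ volume).toReal
      simpa using this
  have h3 := h1.add h2
  simp_rw [← map_add] at h3
  simpa using h3

end Multiplication

theorem opNorm_fderiv_moll_le (b : ContDiffBump (0 : Eucl n)) (u : L2 n) (x : Eucl n) :
    ‖fderiv ℝ (moll b u) x‖ ≤ n * n * gradConst b * ‖u‖ := by
  refine ContinuousLinearMap.opNorm_le_bound _
    (by have := gradConst_nonneg b; positivity) fun ξ => ?_
  have h := contract_jac_eq_inner (moll b u) x (fderiv ℝ (moll b u) x ξ) ξ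
  rw [real_inner_self_eq_norm_sq] at h
  set N := ‖fderiv ℝ (moll b u) x ξ‖ with hN
  have h2 : N ^ 2 ≤ (n * n * gradConst b * ‖u‖ * ‖ξ‖) * N := by
    rw [← h]
    unfold contract
    calc ∑ i, ∑ j, jac (moll b u) x i j * ((fderiv ℝ (moll b u) x ξ) i * ξ j)
        ≤ ∑ _i : Fin n, ∑ _j : Fin n, (gradConst b * ‖u‖) * (N * ‖ξ‖) := by
          refine Finset.sum_le_sum fun i _ => Finset.sum_le_sum fun j _ => ?_
          refine (le_abs_self _).trans ?_
          rw [abs_mul, abs_mul]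
          have := gradConst_nonneg b
          gcongr
          · exact abs_jac_moll_le b u x i j
          · exact abs_coord_le _ _
          · exact abs_coord_le _ _
      _ = _ := by
          simp
          ring
  rcases eq_or_lt_of_le (norm_nonneg (fderiv ℝ (moll b u) x ξ)) with h0 | h0
  · rw [hN, ← h0]
    have := gradConst_nonneg b
    positivity
  · rw [← hN] at h0
    nlinarith

theorem memLp_top_fderiv_moll (b : ContDiffBump (0 : Eucl n)) (u : L2 n) :
    MemLp (fderiv ℝ (moll b u)) ⊤ volume :=
  memLp_top_of_bound
    ((contDiff_moll b (L2_locallyIntegrable u)).continuous_fderiv (by simp)).aestronglyMeasurable _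
    (Eventually.of_forall (opNorm_fderiv_moll_le b u))

theorem fderiv_moll_sub (b : ContDiffBump (0 : Eucl n)) (u v : L2 n) (x : Eucl n) :
    fderiv ℝ (moll b (u - v : L2 n)) x = fderiv ℝ (moll b u) x - fderiv ℝ (moll b v) x := by
  have h : moll b (u - v : L2 n) = moll b u - moll b v := by
    rw [moll_congr_ae b (Lp.coeFn_sub u v)]
    ext1 x
    simp only [moll_apply, Pi.sub_apply, smul_sub]
    exact integral_sub (moll_exists b (L2_locallyIntegrable u) x)
      (moll_exists b (L2_locallyIntegrable v) x)
  rw [h]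
  exact fderiv_sub ((contDiff_moll b (L2_locallyIntegrable u)).differentiable (by simp) x)
    ((contDiff_moll b (L2_locallyIntegrable v)).differentiable (by simp) x)

/-- `A` is the bounded symmetric gradient of `w`. As `w` need not be differentiable, this is expressed
through mollifications: the mollification of `A` is the classical symmetric gradient of the
mollification of `w`. -/
structure IsSymGradAt (w : L2 n) (A : Eucl n → (Eucl n →L[ℝ] Eucl n)) : Prop where
  memLp : MemLp A ⊤ volume
  sym : ∀ m x ξ η, ⟪fderiv ℝ (moll (bumpSeq n m) w) x ξ, η⟫
    + ⟪ξ, fderiv ℝ (moll (bumpSeq n m) w) x η⟫ = 2 * ⟪moll (bumpSeq n m) A x ξ, η⟫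

namespace IsSymGradAt

variable {w : L2 n} {A : Eucl n → (Eucl n →L[ℝ] Eucl n)}

theorem quad (h : IsSymGradAt w A) (m : ℕ) (x ξ : Eucl n) :
    ⟪fderiv ℝ (moll (bumpSeq n m) w) x ξ, ξ⟫ = ⟪moll (bumpSeq n m) A x ξ, ξ⟫ := by
  have := h.sym m x ξ ξ
  rw [real_inner_comm _ ξ] at this
  linarith

theorem moll_symm (h : IsSymGradAt w A) (m : ℕ) (x ξ η : Eucl n) :
    ⟪moll (bumpSeq n m) A x ξ, η⟫ = ⟪ξ, moll (bumpSeq n m) A x η⟫ := by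
  have h1 := h.sym m x ξ η
  have h2 := h.sym m x η ξ
  rw [real_inner_comm _ η, real_inner_comm ξ] at h2
  rw [real_inner_comm _ ξ]
  linarith

theorem mul_symm (h : IsSymGradAt w A) (u v : L2 n) :
    ⟪mulLin h.memLp u, v⟫ = ⟪u, mulLin h.memLp v⟫ := by
  have h1 := (mulLin_moll_tendsto h.memLp u).inner (tendsto_const_nhds (x := v)) (𝕜 := ℝ)
  have h2 := (tendsto_const_nhds (x := u)).inner (mulLin_moll_tendsto h.memLp v) (𝕜 := ℝ)
  refine tendsto_nhds_unique h1 (h2.congr fun m => ?_)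
  rw [real_inner_comm, inner_mulLin, inner_mulLin]
  refine integral_congr_ae (Eventually.of_forall fun x => ?_)
  simp only
  rw [h.moll_symm, real_inner_comm]

/-- For solenoidal `w`, `div (w ⊗ w)` and `2 S(w) w` agree up to a gradient. -/
theorem integral_fderiv_test (h : IsSymGradAt w A) (hw : IsDivFree w) {φ : Eucl n → Eucl n}
    (hφ : IsTestField φ) :
    ∫ x, ⟪fderiv ℝ φ x (w x), w x⟫ = - 2 * ∫ x, ⟪A x (w x), φ x⟫ := by
  have hDφ : MemLp (fderiv ℝ φ) ⊤ volume := by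
    have hc := hφ.smooth.continuous_fderiv (by simp)
    exact hc.memLp_top_of_hasCompactSupport (hφ.compact.fderiv (𝕜 := ℝ)) volume
  let Φ : testFields n := ⟨φ, hφ⟩
  -- the identity for the mollified field, obtained by integration by parts
  have key : ∀ m, ⟪mulLin hDφ (mollL (bumpSeq n m) w), mollL (bumpSeq n m) w⟫
      = - 2 * ⟪mulLin (memLp_top_moll (bumpSeq n m) h.memLp) (mollL (bumpSeq n m) w), testL n Φ⟫ := by
    intro m
    set b := bumpSeq n m
    set W := moll b w with hW
    have hWs : ContDiff ℝ ∞ W := contDiff_moll b (L2_locallyIntegrable w)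
    have hWd : ∀ x, DifferentiableAt ℝ W x := hWs.differentiable (by simp)
    have hφd : ∀ x, DifferentiableAt ℝ φ x := hφ.smooth.differentiable (by simp)
    have hWdiv : IsDivFree W :=
      isDivFree_of_jac (hWs.of_le (by simp)) (div_moll_eq_zero b (L2_locallyIntegrable w) hw)
    have hDW := hWs.continuous_fderiv (by simp)
    have hDφc := hφ.smooth.continuous_fderiv (by simp)
    -- transport of `⟨W, φ⟩` by `W`
    have e1 := hWdiv (fun x => ⟪W x, φ x⟫) (hWs.inner ℝ hφ.smooth)
      (hφ.compact.mono' (fun x hx => subset_closure (by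
        intro h0
        exact hx (by simp only [h0, inner_zero_right]))))
    have e1' : ∀ x, ⟪W x, gradient (fun x => ⟪W x, φ x⟫) x⟫
        = ⟪fderiv ℝ W x (W x), φ x⟫ + ⟪fderiv ℝ φ x (W x), W x⟫ := by
      intro x
      have : ⟪gradient (fun x => ⟪W x, φ x⟫) x, W x⟫ = fderiv ℝ (fun x => ⟪W x, φ x⟫) x (W x) := by
        simp [gradient]
      rw [real_inner_comm, this, fderiv_inner_apply ℝ (hWd x) (hφd x), add_comm,
        real_inner_comm (fderiv ℝ φ x (W x))]
    simp_rw [e1'] at e1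
    -- transport of `|W|²` by `φ`
    have e2 := integral_inner_gradient_eq_zero hφ (ψ := fun x => ⟪W x, W x⟫) (hWs.inner ℝ hWs)
    have e2' : ∀ x, ⟪φ x, gradient (fun x => ⟪W x, W x⟫) x⟫
        = 2 * ⟪W x, fderiv ℝ W x (φ x)⟫ := by
      intro x
      have : ⟪gradient (fun x => ⟪W x, W x⟫) x, φ x⟫ = fderiv ℝ (fun x => ⟪W x, W x⟫) x (φ x) := by
        simp [gradient]
      rw [real_inner_comm, this, fderiv_inner_apply ℝ (hWd x) (hWd x),
        real_inner_comm (W x) (fderiv ℝ W x (φ x))]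
      ring
    simp_rw [e2', integral_const_mul] at e2
    have hsupp : ∀ f : Eucl n → ℝ, (∀ x, φ x = 0 → f x = 0) → HasCompactSupport f := fun f hf =>
      hφ.compact.mono' (fun x hx => subset_closure (fun h0 => hx (hf x h0)))
    have i1 : Integrable fun x => ⟪fderiv ℝ W x (W x), φ x⟫ :=
      ((hDW.clm_apply hWs.continuous).inner hφ.smooth.continuous).integrable_of_hasCompactSupport
        (hsupp _ fun x hx => by rw [hx, inner_zero_right])
    have i2 : Integrable fun x => ⟪fderiv ℝ φ x (W x), W x⟫ :=
      ((hDφc.clm_apply hWs.continuous).inner hWs.continuous).integrable_of_hasCompactSupport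
        ((hφ.compact.fderiv (𝕜 := ℝ)).mono' (fun x hx => subset_closure (fun h0 => hx (by
          simp only [h0, zero_apply, inner_zero_left]))))
    have i3 : Integrable fun x => ⟪W x, fderiv ℝ W x (φ x)⟫ :=
      (hWs.continuous.inner (hDW.clm_apply hφ.smooth.continuous)).integrable_of_hasCompactSupport
        (hsupp _ fun x hx => by rw [hx, map_zero, inner_zero_right])
    rw [integral_add i1 i2] at e1
    have l1 : ⟪mulLin hDφ (mollL b w), mollL b w⟫ = ∫ x, ⟪fderiv ℝ φ x (W x), W x⟫ := by
      rw [inner_mulLin]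
      refine integral_congr_ae ?_
      filter_upwards [mollL_coeFn b w] with x hx
      rw [hx]
    have l2 : ⟪mulLin (memLp_top_moll b h.memLp) (mollL b w), testL n Φ⟫
        = (1 / 2) * ((∫ x, ⟪fderiv ℝ W x (W x), φ x⟫) + ∫ x, ⟪W x, fderiv ℝ W x (φ x)⟫) := by
      rw [inner_mulLin, ← integral_add i1 i3, ← integral_const_mul]
      refine integral_congr_ae ?_
      filter_upwards [mollL_coeFn b w, testL_coeFn Φ] with x hx hx'
      rw [hx, hx']
      have := h.sym m x (W x) (φ x)
      change ⟪moll b A x (W x), φ x⟫ = _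
      linarith
    rw [l1, l2]
    linarith
  have hlim := mollL_tendsto w
  have t1 : Tendsto (fun m => ⟪mulLin hDφ (mollL (bumpSeq n m) w), mollL (bumpSeq n m) w⟫) atTop
      (𝓝 ⟪mulLin hDφ w, w⟫) := by
    have hcont : Tendsto (fun m => mulLin hDφ (mollL (bumpSeq n m) w)) atTop
        (𝓝 (mulLin hDφ w)) := by
      rw [tendsto_iff_norm_sub_tendsto_zero] at hlim ⊢
      refine squeeze_zero (fun _ => norm_nonneg _) (fun m => ?_)
        (by simpa using hlim.const_mul (eLpNorm (fderiv ℝ φ) ⊤ volume).toReal)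
      rw [← map_sub]
      exact mulLin_norm_le hDφ (ae_norm_le_eLpNorm_top hDφ.2) _
    exact hcont.inner hlim
  have t2 := ((mulLin_moll_tendsto' h.memLp hlim).inner
    (tendsto_const_nhds (x := testL n Φ)) (𝕜 := ℝ)).const_mul (-2)
  have := tendsto_nhds_unique (t1.congr key) t2
  rw [inner_mulLin, inner_mulLin] at this
  rw [this]
  congr 1
  refine integral_congr_ae ?_
  filter_upwards [testL_coeFn Φ] with x hx
  rw [hx]

/-- `∫ S(w) w · w = 0` for solenoidal `w`: this is the cancellation of `∫ (w · ∇)w · w`, which has to be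
obtained by approximation as `w` is not differentiable. -/
theorem inner_mul_self (h : IsSymGradAt w A) (hw : IsDivFree w) : ⟪mulLin h.memLp w, w⟫ = 0 := by
  -- the previous identity extends by density to mollifications of arbitrary solenoidal fields
  have key : ∀ m, ⟪mulLin (memLp_top_moll (bumpSeq n m) h.memLp) w, w⟫
      = - 2 * ⟪mulLin h.memLp w, mollL (bumpSeq n m) w⟫ := by
    intro m
    set b := bumpSeq n m
    have hcl : ∀ a : L2 n, a ∈ closure (range (testL n)) →
        ⟪mulLin (memLp_top_fderiv_moll b a) w, w⟫ = - 2 * ⟪mulLin h.memLp w, mollL b a⟫ := by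
      intro a ha
      refine closure_minimal (t := {a : L2 n | ⟪mulLin (memLp_top_fderiv_moll b a) w, w⟫
        = - 2 * ⟪mulLin h.memLp w, mollL b a⟫}) ?_ ?_ ha
      · rintro _ ⟨φ, rfl⟩
        have hφm : moll b (testL n φ) = moll b φ.1 := moll_congr_ae b (testL_coeFn φ)
        have := h.integral_fderiv_test hw ((show IsTestField φ.1 from φ.2).moll b)
        simp only [mem_ofPred_eq]
        rw [inner_mulLin, inner_mulLin, hφm, this]
        congr 1
        refine integral_congr_ae ?_
        filter_upwards [mollL_coeFn b (testL n φ)] with x hx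
        rw [hx, hφm]
      · refine isClosed_eq ?_ (by fun_prop)
        have hlip : LipschitzWith (Real.toNNReal (n * n * gradConst b * ‖w‖))
            (fun a : L2 n => mulLin (memLp_top_fderiv_moll b a) w) := by
          refine LipschitzWith.of_dist_le_mul fun a c => ?_
          rw [Real.coe_toNNReal _ (by have := gradConst_nonneg b; positivity), dist_eq_norm,
            dist_eq_norm]
          have e : mulLin (memLp_top_fderiv_moll b a) w - mulLin (memLp_top_fderiv_moll b c) w
              = mulLin (memLp_top_fderiv_moll b (a - c)) w := by
            apply Lp.ext
            filter_upwards [Lp.coeFn_sub (mulLin (memLp_top_fderiv_moll b a) w)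
              (mulLin (memLp_top_fderiv_moll b c) w), mulLin_coeFn (memLp_top_fderiv_moll b a) w,
              mulLin_coeFn (memLp_top_fderiv_moll b c) w,
              mulLin_coeFn (memLp_top_fderiv_moll b (a - c)) w] with x h1 h2 h3 h4
            rw [h1, h4, Pi.sub_apply, h2, h3, fderiv_moll_sub]
            rfl
          rw [e]
          refine (mulLin_norm_le _ (Eventually.of_forall (opNorm_fderiv_moll_le b _)) w).trans_eq ?_
          ring
        exact hlip.continuous.inner continuous_const
    rw [← hcl w (mem_closure_testL hw), inner_mulLin, inner_mulLin]
    exact integral_congr_ae (Eventually.of_forall fun x => (h.quad m x (w x)).symm)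
  have t1 := (mulLin_moll_tendsto h.memLp w).inner (tendsto_const_nhds (x := w)) (𝕜 := ℝ)
  have t2 := ((tendsto_const_nhds (x := mulLin h.memLp w)).inner (mollL_tendsto w)
    (𝕜 := ℝ)).const_mul (-2)
  have := tendsto_nhds_unique (t1.congr key) t2
  linarith

end IsSymGradAt

theorem negPartForm_nonneg (A : Eucl n →L[ℝ] Eucl n) : 0 ≤ negPartForm A := le_max_left _ _

theorem neg_inner_le_norm (A : Eucl n →L[ℝ] Eucl n) (ξ : Metric.sphere (0 : Eucl n) 1) :
    -⟪A ξ, (ξ : Eucl n)⟫ ≤ ‖A‖ := by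
  have h1 : ‖(ξ : Eucl n)‖ = 1 := by simp
  refine (neg_le_abs _).trans ((abs_real_inner_le_norm _ _).trans ?_)
  have := A.le_opNorm ξ
  rw [h1, mul_one] at *
  exact this

theorem negPartForm_bddAbove (A : Eucl n →L[ℝ] Eucl n) :
    BddAbove (range fun ξ : Metric.sphere (0 : Eucl n) 1 => -⟪A ξ, (ξ : Eucl n)⟫) :=
  ⟨‖A‖, by rintro _ ⟨ξ, rfl⟩; exact neg_inner_le_norm A ξ⟩

theorem negPartForm_le_norm (A : Eucl n →L[ℝ] Eucl n) : negPartForm A ≤ ‖A‖ :=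
  max_le (norm_nonneg _) (Real.iSup_le (neg_inner_le_norm A) (norm_nonneg _))

/-- `A⁻` is a lower bound for the quadratic form of `A`. -/
theorem neg_negPartForm_mul_le (A : Eucl n →L[ℝ] Eucl n) (ξ : Eucl n) :
    - negPartForm A * ‖ξ‖ ^ 2 ≤ ⟪A ξ, ξ⟫ := by
  rcases eq_or_ne ξ 0 with rfl | h0
  · simp
  have hn : 0 < ‖ξ‖ := norm_pos_iff.2 h0
  let θ : Metric.sphere (0 : Eucl n) 1 := ⟨‖ξ‖⁻¹ • ξ, by
    simp [norm_smul, hn.ne']⟩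
  have h1 : -⟪A θ, (θ : Eucl n)⟫ ≤ negPartForm A :=
    (le_ciSup (negPartForm_bddAbove A) θ).trans (le_max_right _ _)
  have h2 : ⟪A θ, (θ : Eucl n)⟫ = ‖ξ‖⁻¹ ^ 2 * ⟪A ξ, ξ⟫ := by
    simp only [θ, map_smul, inner_smul_left, inner_smul_right]
    simp
    ring
  rw [h2] at h1
  have h3 : ⟪A ξ, ξ⟫ = ‖ξ‖ ^ 2 * (‖ξ‖⁻¹ ^ 2 * ⟪A ξ, ξ⟫) := by
    field_simp
  rw [h3]
  nlinarith [sq_nonneg ‖ξ‖]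

/-- The essential supremum of the negative part of a field of linear maps. -/
noncomputable def negSup (A : Eucl n → (Eucl n →L[ℝ] Eucl n)) : ℝ :=
  (eLpNorm (fun x => negPartForm (A x)) ⊤ volume).toReal

theorem eLpNorm_negPartForm_le (A : Eucl n → (Eucl n →L[ℝ] Eucl n)) :
    eLpNorm (fun x => negPartForm (A x)) ⊤ volume ≤ eLpNorm A ⊤ volume :=
  eLpNorm_mono fun x => by
    rw [Real.norm_of_nonneg (negPartForm_nonneg _)]
    exact negPartForm_le_norm _

variable {A : Eucl n → (Eucl n →L[ℝ] Eucl n)}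

theorem ae_quad_ge (hA : MemLp A ⊤ volume) : ∀ᵐ x, ∀ ξ, - negSup A * ‖ξ‖ ^ 2 ≤ ⟪A x ξ, ξ⟫ := by
  filter_upwards [ae_norm_le_eLpNorm_top ((eLpNorm_negPartForm_le A).trans_lt hA.2)] with x hx ξ
  refine le_trans ?_ (neg_negPartForm_mul_le (A x) ξ)
  have : negPartForm (A x) ≤ negSup A := (le_abs_self _).trans hx
  nlinarith [sq_nonneg ‖ξ‖]

theorem inner_mulLin_ge (hA : MemLp A ⊤ volume) (u : L2 n) :
    - negSup A * ‖u‖ ^ 2 ≤ ⟪mulLin hA u, u⟫ := by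
  rw [inner_mulLin, ← real_inner_self_eq_norm_sq, L2.inner_def, ← integral_const_mul]
  refine integral_mono_ae ((L2.integrable_inner u u).const_mul _) ?_ ?_
  · refine (L2.integrable_inner (𝕜 := ℝ) (mulLin hA u) u).congr ?_
    filter_upwards [mulLin_coeFn hA u] with x hx
    rw [hx]
  · filter_upwards [ae_quad_ge hA] with x hx
    have := hx (u x)
    rwa [← real_inner_self_eq_norm_sq] at this

/-- Mollification is an average, so it preserves lower bounds for quadratic forms. -/
theorem quad_moll_ge (b : ContDiffBump (0 : Eucl n)) (hA : MemLp A ⊤ volume) (x ξ : Eucl n) :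
    - negSup A * ‖ξ‖ ^ 2 ≤ ⟪moll b A x ξ, ξ⟫ := by
  have hi := moll_exists b (hA.locallyIntegrable le_top) x
  let L : (Eucl n →L[ℝ] Eucl n) →L[ℝ] ℝ :=
    (innerSL ℝ ξ).comp (ContinuousLinearMap.apply ℝ (Eucl n) ξ)
  have hL : ∀ B : Eucl n →L[ℝ] Eucl n, L B = ⟪B ξ, ξ⟫ := fun B => by
    simp [L, real_inner_comm]
  have e : ⟪moll b A x ξ, ξ⟫ = ∫ y, mollKernel b y * ⟪A (x - y) ξ, ξ⟫ := by
    rw [← hL, moll_apply, ← L.integral_comp_comm hi]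
    simp_rw [map_smul, hL, smul_eq_mul]
  have hi2 : Integrable fun y => mollKernel b y * ⟪A (x - y) ξ, ξ⟫ := by
    have := L.integrable_comp hi
    simp_rw [map_smul, hL, smul_eq_mul] at this
    exact this
  have e2 : - negSup A * ‖ξ‖ ^ 2 = ∫ y, mollKernel b y * (- negSup A * ‖ξ‖ ^ 2) := by
    rw [integral_mul_const, b.integral_normed, one_mul]
  rw [e, e2]
  refine integral_mono_ae ((mollKernel_integrable b).mul_const _) hi2 ?_
  have := (Measure.measurePreserving_sub_left volume x).quasiMeasurePreserving.ae (ae_quad_ge hA)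
  filter_upwards [this] with y hy
  exact mul_le_mul_of_nonneg_left (hy ξ) (mollKernel_nonneg b y)

/-- The quadratic terms of the relative energy balance at a fixed time. -/
theorem IsSymGradAt.relative_quad_ge {w : L2 n} (h : IsSymGradAt w A) (hw : IsDivFree w)
    (u : L2 n) :
    - negSup A * ‖u - w‖ ^ 2 ≤ ⟪mulLin h.memLp u, u⟫ - 2 * ⟪mulLin h.memLp w, u⟫ := by
  refine (inner_mulLin_ge h.memLp (u - w)).trans_eq ?_
  rw [map_sub, inner_sub_left, inner_sub_right, inner_sub_right, h.inner_mul_self hw,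
    h.mul_symm u w, real_inner_comm u (mulLin h.memLp w)]
  ring

end FixedTime

/-! ### Measurability, absolutely continuous functions and Grönwall's inequality -/

section TimeTools

theorem secondCountable_L2 (n : ℕ) : SecondCountableTopology (L2 n) := by
  have : Fact ((2 : ENNReal) ≠ ⊤) := ⟨by norm_num⟩
  infer_instance

theorem countable_of_orthonormal {H ι : Type*} [NormedAddCommGroup H] [InnerProductSpace ℝ H]
    [SecondCountableTopology H] {b : ι → H} (hb : Orthonormal ℝ b) : Countable ι := by
  have hdist : ∀ i j, i ≠ j → 1 < dist (b i) (b j) := by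
    intro i j hij
    have h : dist (b i) (b j) ^ 2 = 2 := by
      rw [dist_eq_norm, @norm_sub_sq_real, hb.1, hb.1, hb.2 hij]
      norm_num
    nlinarith [dist_nonneg (x := b i) (y := b j)]
  have hc : (univ : Set ι).Countable := by
    refine PairwiseDisjoint.countable_of_isOpen (s := fun i => Metric.ball (b i) (1 / 2)) ?_
      (fun _ _ => Metric.isOpen_ball) (fun i _ => ⟨b i, Metric.mem_ball_self (by norm_num)⟩)
    intro i _ j _ hij
    refine Metric.ball_disjoint_ball ?_
    have := hdist i j hij
    linarith
  exact countable_univ_iff.1 hc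

/-- Pettis' theorem in a separable Hilbert space: weak measurability implies strong
measurability. -/
theorem aestronglyMeasurable_of_inner {H α : Type*} [NormedAddCommGroup H] [InnerProductSpace ℝ H]
    [CompleteSpace H] [SecondCountableTopology H] [MeasurableSpace α] {μ : Measure α} {h : α → H}
    (hm : ∀ g : H, AEStronglyMeasurable (fun t => ⟪g, h t⟫) μ) : AEStronglyMeasurable h μ := by
  obtain ⟨w, b, hb⟩ := exists_hilbertBasis ℝ H
  have hcount : Countable w := countable_of_orthonormal b.orthonormal
  refine aestronglyMeasurable_of_tendsto_ae (atTop : Filter (Finset w))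
    (f := fun s t => ∑ i ∈ s, b.repr (h t) i • b i) (fun s => ?_)
    (Eventually.of_forall fun t => b.hasSum_repr (h t))
  refine Finset.aestronglyMeasurable_fun_sum s fun i _ => ?_
  simp_rw [b.repr_apply_apply]
  exact (hm (b i)).smul_const _

/-- Essential suprema of the time slices of a jointly measurable function are measurable. -/
theorem aemeasurable_essSup_slice {α β : Type*} [MeasurableSpace α] [MeasurableSpace β]
    {μ : Measure α} {ν : Measure β} [SFinite ν] {f : α × β → ENNReal}
    (hf : AEMeasurable f (μ.prod ν)) : AEMeasurable (fun t => essSup (fun x => f (t, x)) ν) μ := by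
  refine ⟨fun t => essSup (fun x => hf.mk f (t, x)) ν, ?_, ?_⟩
  · refine measurable_of_Iic fun a => ?_
    have : (fun t => essSup (fun x => hf.mk f (t, x)) ν) ⁻¹' Iic a
        = (fun t => ν (Prod.mk t ⁻¹' (hf.mk f ⁻¹' Ioi a))) ⁻¹' {0} := by
      ext t
      simp only [mem_preimage, mem_Iic, mem_singleton_iff]
      have key : ν (Prod.mk t ⁻¹' (hf.mk f ⁻¹' Ioi a)) = 0 ↔ ∀ᵐ x ∂ν, hf.mk f (t, x) ≤ a := by
        rw [ae_iff]
        simp only [not_le]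
        rfl
      rw [key]
      constructor
      · intro h
        filter_upwards [ae_le_essSup (f := fun x => hf.mk f (t, x)) (μ := ν)] with x hx
        exact hx.trans h
      · exact fun h => essSup_le_of_ae_le a h
    rw [this]
    exact (measurable_measure_prodMk_left (hf.measurable_mk measurableSet_Ioi))
      (measurableSet_singleton 0)
  · filter_upwards [Measure.ae_ae_of_ae_prod hf.ae_eq_mk] with t ht
    exact essSup_congr_ae ht

theorem abs_negPartForm_sub_le {n : ℕ} (A B : Eucl n →L[ℝ] Eucl n) :
    |negPartForm A - negPartForm B| ≤ ‖A - B‖ := by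
  have key : ∀ A B : Eucl n →L[ℝ] Eucl n, negPartForm A ≤ negPartForm B + ‖A - B‖ := by
    intro A B
    refine max_le (add_nonneg (negPartForm_nonneg B) (norm_nonneg _)) (Real.iSup_le (fun ξ => ?_)
      (add_nonneg (negPartForm_nonneg B) (norm_nonneg _)))
    have h1 : -⟪B ξ, (ξ : Eucl n)⟫ ≤ negPartForm B :=
      (le_ciSup (negPartForm_bddAbove B) ξ).trans (le_max_right _ _)
    have h2 := neg_inner_le_norm (A - B) ξ
    rw [sub_apply, inner_sub_left] at h2
    linarith
  rw [abs_le]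
  have h1 := key A B
  have h2 := key B A
  rw [norm_sub_rev] at h2
  constructor <;> linarith

theorem continuous_negPartForm {n : ℕ} :
    Continuous (negPartForm : (Eucl n →L[ℝ] Eucl n) → ℝ) := by
  have : LipschitzWith 1 (negPartForm : (Eucl n →L[ℝ] Eucl n) → ℝ) :=
    LipschitzWith.of_dist_le_mul fun A B => by
      rw [Real.dist_eq, NNReal.coe_one, one_mul, dist_eq_norm]
      exact abs_negPartForm_sub_le A B
  exact this.continuous

/-- A function whose increments are dominated by those of an absolutely continuous function is
absolutely continuous. -/
theorem absolutelyContinuousOnInterval_of_dist_le {X Y : Type*} [PseudoMetricSpace X]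
    [PseudoMetricSpace Y] {f : ℝ → X} {g : ℝ → Y} {a b K : ℝ}
    (hg : AbsolutelyContinuousOnInterval g a b)
    (h : ∀ x ∈ uIcc a b, ∀ y ∈ uIcc a b, dist (f x) (f y) ≤ K * dist (g x) (g y)) :
    AbsolutelyContinuousOnInterval f a b := by
  have h0 := Tendsto.const_mul K hg
  rw [mul_zero] at h0
  refine squeeze_zero' (Eventually.of_forall fun E => Finset.sum_nonneg fun i _ => dist_nonneg) ?_ h0
  have : ∀ᶠ E in (AbsolutelyContinuousOnInterval.totalLengthFilter (X := ℝ)) ⊓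
      𝓟 (AbsolutelyContinuousOnInterval.disjWithin a b),
      E ∈ AbsolutelyContinuousOnInterval.disjWithin a b :=
    mem_inf_of_right (mem_principal_self _)
  filter_upwards [this] with E hE
  rw [Finset.mul_sum]
  exact Finset.sum_le_sum fun i hi => h _ (hE.1 i hi).1 _ (hE.1 i hi).2

/-- The energy balance of a primitive in a Hilbert space. -/
theorem norm_sq_primitive {H : Type*} [NormedAddCommGroup H] [InnerProductSpace ℝ H]
    [CompleteSpace H] {g : ℝ → H} {t : ℝ} (hg : IntervalIntegrable g volume 0 t)
    (w₀ : H) :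
    ‖w₀ + ∫ r in (0 : ℝ)..t, g r‖ ^ 2 - ‖w₀‖ ^ 2
      = ∫ s in (0 : ℝ)..t, 2 * ⟪w₀ + ∫ r in (0 : ℝ)..s, g r, g s⟫ := by
  set w : ℝ → H := fun s => w₀ + ∫ r in (0 : ℝ)..s, g r with hw
  have hsub : ∀ x ∈ uIcc 0 t, ∀ y ∈ uIcc 0 t, IntervalIntegrable g volume x y := fun x hx y hy =>
    hg.mono_set (uIcc_subset_uIcc hx hy)
  have h0 : (0 : ℝ) ∈ uIcc 0 t := left_mem_uIcc
  have hG : AbsolutelyContinuousOnInterval (fun s => ∫ r in (0 : ℝ)..s, ‖g r‖) 0 t :=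
    hg.norm.absolutelyContinuousOnInterval_intervalIntegral left_mem_uIcc
  have hdist : ∀ x ∈ uIcc 0 t, ∀ y ∈ uIcc 0 t,
      ‖w x - w y‖ ≤ dist (∫ r in (0 : ℝ)..x, ‖g r‖) (∫ r in (0 : ℝ)..y, ‖g r‖) := by
    intro x hx y hy
    rw [Real.dist_eq, intervalIntegral.integral_interval_sub_left (hsub _ h0 _ hx).norm
      (hsub _ h0 _ hy).norm]
    have : w x - w y = ∫ r in y..x, g r := by
      simp only [hw, add_sub_add_left_eq_sub]
      exact intervalIntegral.integral_interval_sub_left (hsub _ h0 _ hx) (hsub _ h0 _ hy)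
    rw [this]
    exact intervalIntegral.norm_integral_le_abs_integral_norm
  obtain ⟨M, hM⟩ : ∃ M, ∀ x ∈ uIcc 0 t, ‖w x‖ ≤ M := by
    have hc : ContinuousOn w (uIcc 0 t) :=
      continuousOn_const.add (intervalIntegral.continuousOn_primitive_interval' hg h0)
    exact isCompact_uIcc.exists_bound_of_continuousOn hc
  have hac : AbsolutelyContinuousOnInterval (fun s => ‖w s‖ ^ 2) 0 t := by
    refine absolutelyContinuousOnInterval_of_dist_le (K := 2 * M) hG fun x hx y hy => ?_
    rw [Real.dist_eq]
    have e : ‖w x‖ ^ 2 - ‖w y‖ ^ 2 = (‖w x‖ + ‖w y‖) * (‖w x‖ - ‖w y‖) := by ring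
    rw [e, abs_mul, abs_of_nonneg (by positivity)]
    have h1 := hM x hx
    have h2 := hM y hy
    have h3 := (abs_norm_sub_norm_le (w x) (w y)).trans (hdist x hx y hy)
    have h4 : (0 : ℝ) ≤ 2 * M := by linarith [norm_nonneg (w x)]
    exact mul_le_mul (by linarith) h3 (abs_nonneg _) h4
  have hfin := hac.integral_deriv_eq_sub
  have hw0 : w 0 = w₀ := by simp [hw]
  simp only [hw0] at hfin
  rw [← hfin]
  refine intervalIntegral.integral_congr_ae ?_
  filter_upwards [hg.ae_hasDerivAt_integral] with s hs hs'
  have hs2 := (hs (uIoc_subset_uIcc hs') 0 h0).const_add w₀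
  have := hs2.norm_sq
  exact this.deriv

/-- Grönwall's inequality in integral form, with an integrable forcing term of arbitrary sign. -/
theorem gronwall_integral {F κ h : ℝ → ℝ} {t F₀ : ℝ} (ht : 0 ≤ t)
    (hκ0 : ∀ s, 0 ≤ κ s) (hκ : IntervalIntegrable κ volume 0 t)
    (hh : IntervalIntegrable h volume 0 t)
    (hκF : IntervalIntegrable (fun s => κ s * F s) volume 0 t)
    (hF : ∀ s ∈ Icc 0 t, F s ≤ F₀ + ∫ r in (0 : ℝ)..s, (κ r * F r + h r)) :
    F t ≤ Real.exp (∫ r in (0 : ℝ)..t, κ r) * F₀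
      + ∫ s in (0 : ℝ)..t, Real.exp (∫ r in s..t, κ r) * h s := by
  have h0 : (0 : ℝ) ∈ uIcc 0 t := left_mem_uIcc
  have hsub : ∀ x ∈ uIcc 0 t, ∀ y ∈ uIcc 0 t, IntervalIntegrable κ volume x y := fun x hx y hy =>
    hκ.mono_set (uIcc_subset_uIcc hx hy)
  set R : ℝ → ℝ := fun s => F₀ + ∫ r in (0 : ℝ)..s, (κ r * F r + h r) with hR
  set k : ℝ → ℝ := fun s => ∫ r in (0 : ℝ)..s, κ r with hk
  have hkac : AbsolutelyContinuousOnInterval k 0 t :=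
    hκ.absolutelyContinuousOnInterval_intervalIntegral left_mem_uIcc
  have hRac : AbsolutelyContinuousOnInterval R 0 t := by
    have := (hκF.add hh).absolutelyContinuousOnInterval_intervalIntegral (left_mem_uIcc)
    refine absolutelyContinuousOnInterval_of_dist_le (K := 1) this fun x _ y _ => ?_
    simp [hR]
  have hk0 : ∀ s ∈ uIcc 0 t, 0 ≤ k s := fun s hs => by
    rw [uIcc_of_le ht] at hs
    exact intervalIntegral.integral_nonneg hs.1 fun r _ => hκ0 r
  have heac : AbsolutelyContinuousOnInterval (fun s => Real.exp (- k s)) 0 t := by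
    refine absolutelyContinuousOnInterval_of_dist_le (K := 1) hkac fun x hx y hy => ?_
    rw [Real.dist_eq, Real.dist_eq, one_mul]
    have key : ∀ a b : ℝ, 0 ≤ a → a ≤ b → |Real.exp (-a) - Real.exp (-b)| ≤ |a - b| := by
      intro a b ha hab
      rw [abs_of_nonneg (by simp [hab]), abs_of_nonpos (by linarith)]
      have h1 : Real.exp (-b) = Real.exp (-a) * Real.exp (a - b) := by
        rw [← Real.exp_add]; ring_nf
      have h2 := Real.add_one_le_exp (a - b)
      have h3 : Real.exp (-a) ≤ 1 := by simpa using ha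
      have h4 := Real.exp_pos (-a)
      rw [h1]
      nlinarith
    rcases le_total (k x) (k y) with hxy | hxy
    · exact key _ _ (hk0 x hx) hxy
    · rw [abs_sub_comm, abs_sub_comm (k x)]
      exact key _ _ (hk0 y hy) hxy
  have hprod := heac.mul hRac
  have hfin := hprod.integral_deriv_eq_sub
  have hk00 : k 0 = 0 := by simp [hk]
  have hR0 : R 0 = F₀ := by simp [hR]
  simp only [Pi.mul_apply, hk00, hR0, neg_zero, Real.exp_zero, one_mul] at hfin
  have hekc : ContinuousOn (fun s => Real.exp (- k s)) (uIcc 0 t) := heac.continuousOn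
  have hle : ∫ s in (0 : ℝ)..t, deriv ((fun s => Real.exp (- k s)) * R) s
      ≤ ∫ s in (0 : ℝ)..t, Real.exp (- k s) * h s := by
    refine intervalIntegral.integral_mono_ae_restrict ht hprod.intervalIntegrable_deriv
      (hh.continuousOn_mul hekc) ?_
    rw [EventuallyLE, ae_restrict_iff' measurableSet_Icc]
    filter_upwards [hκ.ae_hasDerivAt_integral, (hκF.add hh).ae_hasDerivAt_integral] with s h1 h2 hs
    have hs' : s ∈ uIcc 0 t := by rwa [uIcc_of_le ht]
    have d1 := (h1 hs' 0 h0).neg.exp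
    have d2 := (h2 hs' 0 h0).const_add F₀
    have d3 : deriv ((fun s => Real.exp (- k s)) * R) s = _ := (d1.mul d2).deriv
    rw [d3]
    have hFR := hF s hs
    have e1 : (0 : ℝ) ≤ Real.exp (- k s) := (Real.exp_pos _).le
    change Real.exp (- k s) * -κ s * R s + Real.exp (- k s) * (κ s * F s + h s) ≤ _
    have : 0 ≤ Real.exp (- k s) * (κ s * (R s - F s)) :=
      mul_nonneg e1 (mul_nonneg (hκ0 s) (sub_nonneg.2 hFR))
    nlinarith
  have hRt : R t ≤ Real.exp (k t) * (F₀ + ∫ s in (0 : ℝ)..t, Real.exp (- k s) * h s) := by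
    have e2 : R t = Real.exp (k t) * (Real.exp (- k t) * R t) := by
      rw [← mul_assoc, ← Real.exp_add]
      simp
    rw [e2]
    exact mul_le_mul_of_nonneg_left (by linarith) (Real.exp_pos _).le
  refine (hF t ⟨ht, le_rfl⟩).trans (hRt.trans_eq ?_)
  rw [mul_add, ← intervalIntegral.integral_const_mul]
  congr 1
  refine intervalIntegral.integral_congr fun s hs => ?_
  change Real.exp (k t) * (Real.exp (- k s) * h s) = _
  rw [← mul_assoc, ← Real.exp_add]
  congr 2
  have := intervalIntegral.integral_interval_sub_left (hsub _ h0 _ right_mem_uIcc) (hsub _ h0 _ hs)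
  rw [← this]
  ring

/-- The du Bois-Reymond lemma: a function with vanishing weak derivative is constant. -/
theorem ae_const_of_integral_deriv_mul_eq_zero {c : ℝ → ℝ} {T : ℝ} (hT : 0 < T)
    (hc : IntegrableOn c (Ioo 0 T))
    (h : ∀ χ : ℝ → ℝ, ContDiff ℝ ∞ χ → HasCompactSupport χ → tsupport χ ⊆ Ioo 0 T →
      ∫ t in Ioo 0 T, deriv χ t * c t = 0) :
    ∃ k : ℝ, ∀ᵐ t ∂(volume.restrict (Ioo 0 T)), c t = k := by
  -- a bump of unit mass inside the interval
  let b : ContDiffBump (T / 2 : ℝ) := ⟨T / 8, T / 4, by positivity, by linarith⟩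
  set χ₀ : ℝ → ℝ := b.normed volume with hχ₀
  have hb1 : ContDiff ℝ ∞ χ₀ := b.contDiff_normed
  have hb2 : HasCompactSupport χ₀ := b.hasCompactSupport_normed
  have hb3 : ∫ t, χ₀ t = 1 := b.integral_normed
  have hb4 : tsupport χ₀ ⊆ Ioo 0 T := by
    rw [hχ₀, b.tsupport_normed_eq, Real.closedBall_eq_Icc]
    intro x hx
    simp only [b, mem_Icc] at hx
    constructor <;> linarith [hx.1, hx.2]
  refine ⟨∫ t in Ioo 0 T, χ₀ t * c t, ?_⟩
  set k := ∫ t in Ioo 0 T, χ₀ t * c t with hk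
  have hmain : ∀ θ : ℝ → ℝ, ContDiff ℝ ∞ θ → HasCompactSupport θ → tsupport θ ⊆ Ioo 0 T →
      ∫ t in Ioo 0 T, θ t * (c t - k) = 0 := by
    intro θ hθ hθc hθs
    set m := ∫ t, θ t with hm
    let ζ : ℝ → ℝ := fun t => θ t - m * χ₀ t
    have hζ : ContDiff ℝ ∞ ζ := hθ.sub (contDiff_const.mul hb1)
    have hζc : HasCompactSupport ζ := hθc.sub (hb2.mul_left (f := fun _ => m))
    have hθi : Integrable θ := hθ.continuous.integrable_of_hasCompactSupport hθc
    have hχi : Integrable χ₀ := hb1.continuous.integrable_of_hasCompactSupport hb2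
    have hζi : Integrable ζ := hθi.sub (hχi.const_mul m)
    have hζ0 : ∫ t, ζ t = 0 := by
      simp only [ζ]
      rw [integral_sub hθi (hχi.const_mul m), integral_const_mul, hb3]
      simp [hm]
    have hζs : tsupport ζ ⊆ tsupport θ ∪ tsupport χ₀ := by
      refine (tsupport_sub θ (fun t => m * χ₀ t)).trans (union_subset_union_right _ ?_)
      exact closure_mono (Function.support_mul_subset_right _ _)
    -- the support lies in a compact subinterval
    obtain ⟨α, β, hα, hαβ, hβ, hsub⟩ : ∃ α β, 0 < α ∧ α ≤ β ∧ β < T ∧ tsupport ζ ⊆ Icc α β := by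
      have hK : IsCompact (tsupport θ ∪ tsupport χ₀) := hθc.isCompact.union hb2.isCompact
      have hKs : tsupport θ ∪ tsupport χ₀ ⊆ Ioo 0 T := union_subset hθs hb4
      have hne : (tsupport θ ∪ tsupport χ₀).Nonempty := by
        by_contra hne
        rw [not_nonempty_iff_eq_empty, union_empty_iff] at hne
        have : χ₀ = 0 := tsupport_eq_empty_iff.1 hne.2
        rw [this] at hb3
        simp at hb3
      refine ⟨sInf (tsupport θ ∪ tsupport χ₀), sSup (tsupport θ ∪ tsupport χ₀),
        (hKs (hK.sInf_mem hne)).1, ?_, (hKs (hK.sSup_mem hne)).2, fun x hx => ?_⟩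
      · exact csInf_le_csSup hne hK.bddBelow hK.bddAbove
      · exact ⟨csInf_le hK.bddBelow (hζs hx), le_csSup hK.bddAbove (hζs hx)⟩
    have hζz : ∀ t, t ∉ Icc α β → ζ t = 0 := fun t ht => image_eq_zero_of_notMem_tsupport
      fun h => ht (hsub h)
    let χ : ℝ → ℝ := fun t => ∫ s in (0 : ℝ)..t, ζ s
    have hder : ∀ t, HasDerivAt χ (ζ t) t := fun t =>
      (hζ.continuous.integral_hasStrictDerivAt 0 t).hasDerivAt
    have hderiv : deriv χ = ζ := funext fun t => (hder t).deriv
    have hχs : ContDiff ℝ ∞ χ :=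
      contDiff_infty_iff_deriv.2 ⟨fun t => (hder t).differentiableAt, by rwa [hderiv]⟩
    have hχz : ∀ t, t ∉ Icc α β → χ t = 0 := by
      intro t ht
      rw [mem_Icc, not_and_or, not_le, not_le] at ht
      rcases ht with ht | ht
      · refine (intervalIntegral.integral_congr (g := fun _ => (0 : ℝ)) fun s hs => ?_).trans
          (by simp)
        refine hζz s fun hs' => ?_
        have : s < α := by
          rcases le_total 0 t with h0 | h0
          · rw [uIcc_of_le h0] at hs
            exact hs.2.trans_lt ht
          · rw [uIcc_of_ge h0] at hs
            exact hs.2.trans_lt hα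
        exact absurd hs'.1 (not_le.2 this)
      · have e : χ t = ∫ s, ζ s := by
          simp only [χ]
          rw [intervalIntegral.integral_of_le (by linarith)]
          refine setIntegral_eq_integral_of_forall_compl_eq_zero fun s hs => hζz s fun hs' => hs ?_
          exact ⟨hα.trans_le hs'.1, hs'.2.trans ht.le⟩
        rw [e, hζ0]
    have hχsub : tsupport χ ⊆ Icc α β :=
      closure_minimal (fun t ht => by_contra fun h => ht (hχz t h)) isClosed_Icc
    have hχc : HasCompactSupport χ := HasCompactSupport.intro isCompact_Icc hχz
    have hz := h χ hχs hχc (hχsub.trans fun t ht => ⟨hα.trans_le ht.1, ht.2.trans_lt hβ⟩)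
    rw [hderiv] at hz
    have b1 : ∀ f : ℝ → ℝ, Continuous f → HasCompactSupport f → IntegrableOn (fun t => f t * c t)
        (Ioo 0 T) := by
      intro f hf hfc
      obtain ⟨C, hC⟩ := hf.bounded_above_of_compact_support hfc
      exact hc.bdd_mul hf.aestronglyMeasurable.restrict (Eventually.of_forall hC)
    have i1 := b1 θ hθ.continuous hθc
    have i2 := b1 χ₀ hb1.continuous hb2
    have e1 : ∫ t in Ioo 0 T, ζ t * c t = (∫ t in Ioo 0 T, θ t * c t) - m * k := by
      simp only [ζ, sub_mul, mul_assoc]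
      rw [integral_sub i1 (i2.const_mul m), integral_const_mul]
    have e2 : ∫ t in Ioo 0 T, θ t = m := by
      refine setIntegral_eq_integral_of_forall_compl_eq_zero fun s hs => ?_
      exact image_eq_zero_of_notMem_tsupport fun h => hs (hθs h)
    have e3 : ∫ t in Ioo 0 T, θ t * (c t - k) = (∫ t in Ioo 0 T, θ t * c t) - m * k := by
      simp only [mul_sub]
      rw [integral_sub i1 (hθi.integrableOn.mul_const k), integral_mul_const, e2]
    rw [e3, ← e1, hz]
  have hloc : LocallyIntegrableOn (fun t => c t - k) (Ioo 0 T) volume :=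
    (hc.sub (integrableOn_const (by simp))).locallyIntegrableOn
  have := isOpen_Ioo.ae_eq_zero_of_integral_contDiff_smul_eq_zero hloc fun g hg hgc hgs => by
    have h1 := hmain g hg hgc hgs
    rw [← h1]
    refine (setIntegral_eq_integral_of_forall_compl_eq_zero fun s hs => ?_).symm
    rw [image_eq_zero_of_notMem_tsupport fun h => hs (hgs h), zero_smul]
  rw [ae_restrict_iff' measurableSet_Ioo]
  filter_upwards [this] with t ht ht'
  linarith [ht ht']

/-- A continuous function with integrable weak derivative is the primitive of that derivative. -/
theorem eq_add_integral_of_weak_deriv {a β : ℝ → ℝ} {T : ℝ} (hT : 0 < T)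
    (ha : ContinuousOn a (Icc 0 T)) (hβ : IntegrableOn β (Ioo 0 T))
    (h : ∀ χ : ℝ → ℝ, ContDiff ℝ ∞ χ → HasCompactSupport χ → tsupport χ ⊆ Ioo 0 T →
      ∫ t in Ioo 0 T, (deriv χ t * a t + χ t * β t) = 0) :
    ∀ t ∈ Icc 0 T, a t = a 0 + ∫ s in (0 : ℝ)..t, β s := by
  have hβi : IntervalIntegrable β volume 0 T := by
    rw [intervalIntegrable_iff_integrableOn_Ioo_of_le hT.le]
    exact hβ
  set B : ℝ → ℝ := fun t => ∫ s in (0 : ℝ)..t, β s with hB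
  have hBac : AbsolutelyContinuousOnInterval B 0 T :=
    hβi.absolutelyContinuousOnInterval_intervalIntegral left_mem_uIcc
  have hBc : ContinuousOn B (Icc 0 T) := by
    have := hBac.continuousOn
    rwa [uIcc_of_le hT.le] at this
  have hai : IntegrableOn a (Ioo 0 T) :=
    (ha.integrableOn_compact isCompact_Icc).mono_set Ioo_subset_Icc_self
  have hBi : IntegrableOn B (Ioo 0 T) :=
    (hBc.integrableOn_compact isCompact_Icc).mono_set Ioo_subset_Icc_self
  obtain ⟨k, hk⟩ := ae_const_of_integral_deriv_mul_eq_zero (c := fun t => a t - B t) hT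
    (hai.sub hBi) fun χ hχ hχc hχs => by
      have hd : Continuous (deriv χ) := hχ.continuous_deriv (by simp)
      have bdd : ∀ (f g : ℝ → ℝ), Continuous f → HasCompactSupport f → IntegrableOn g (Ioo 0 T) →
          IntegrableOn (fun t => f t * g t) (Ioo 0 T) := by
        intro f g hf hfc hg
        obtain ⟨C, hC⟩ := hf.bounded_above_of_compact_support hfc
        exact hg.bdd_mul hf.aestronglyMeasurable.restrict (Eventually.of_forall hC)
      have i1 := bdd _ _ hd hχc.deriv hai
      have i2 := bdd _ _ hd hχc.deriv hBi
      have i3 := bdd _ _ hχ.continuous hχc hβ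
      have e0 := h χ hχ hχc hχs
      rw [integral_add i1 i3] at e0
      have hχac : AbsolutelyContinuousOnInterval χ 0 T :=
        (hχ.of_le (by simp)).contDiffOn.absolutelyContinuousOnInterval
      have e1 := hχac.integral_mul_deriv_eq_deriv_mul hBac
      have z0 : χ 0 = 0 := image_eq_zero_of_notMem_tsupport fun h => (hχs h).1.false
      have zT : χ T = 0 := image_eq_zero_of_notMem_tsupport fun h => (hχs h).2.false
      rw [z0, zT] at e1
      have e2 : ∫ x in (0 : ℝ)..T, χ x * deriv B x = ∫ x in (0 : ℝ)..T, χ x * β x := by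
        refine intervalIntegral.integral_congr_ae ?_
        filter_upwards [hβi.ae_hasDerivAt_integral] with s hs hs'
        rw [(hs (uIoc_subset_uIcc hs') 0 left_mem_uIcc).deriv]
      rw [e2, intervalIntegral.integral_of_le hT.le, intervalIntegral.integral_of_le hT.le,
        integral_Ioc_eq_integral_Ioo, integral_Ioc_eq_integral_Ioo] at e1
      simp only [mul_sub]
      rw [integral_sub i1 i2]
      linarith
  have hcl : ∀ t ∈ Icc 0 T, a t - B t = k := by
    intro t ht
    have hcont : ContinuousOn (fun t => a t - B t) (Icc 0 T) := ha.sub hBc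
    have hEq : EqOn (fun t => a t - B t) (fun _ => k) (Ioo 0 T) :=
      Measure.eqOn_open_of_ae_eq hk isOpen_Ioo (hcont.mono Ioo_subset_Icc_self) continuousOn_const
    exact hEq.of_subset_closure hcont continuousOn_const Ioo_subset_Icc_self
      (by rw [closure_Ioo hT.ne]) ht
  intro t ht
  have h1 := hcl t ht
  have h2 := hcl 0 ⟨le_rfl, hT.le⟩
  have h3 : B 0 = 0 := by simp [hB]
  linarith

end TimeTools

/-! ### Comparison fields -/

section Separated

variable {n : ℕ}

/-- The separated function `χ(t) φ(x)`. -/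
def separated {F : Type*} [SMul ℝ F] (χ : ℝ → ℝ) (φ : Eucl n → F) (z : ℝ × Eucl n) : F :=
  χ z.1 • φ z.2

variable {F : Type*} [NormedAddCommGroup F] [NormedSpace ℝ F] {χ : ℝ → ℝ} {φ : Eucl n → F}

theorem separated_contDiff (hχ : ContDiff ℝ ∞ χ) (hφ : ContDiff ℝ ∞ φ) :
    ContDiff ℝ ∞ (separated χ φ) :=
  (hχ.comp contDiff_fst).smul (hφ.comp contDiff_snd)

theorem tsupport_separated_subset : tsupport (separated χ φ) ⊆ tsupport χ ×ˢ tsupport φ := by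
  refine closure_minimal (fun z hz => ?_) ((isClosed_tsupport χ).prod (isClosed_tsupport φ))
  rw [Function.mem_support, separated] at hz
  exact ⟨subset_closure fun h => hz (by rw [h, zero_smul]),
    subset_closure fun h => hz (by rw [h, smul_zero])⟩

theorem separated_compact (hχ : HasCompactSupport χ) (hφ : HasCompactSupport φ) :
    HasCompactSupport (separated χ φ) :=
  (hχ.isCompact.prod hφ.isCompact).of_isClosed_subset (isClosed_tsupport _)
    tsupport_separated_subset

theorem timeDeriv_separated {φ : Eucl n → Eucl n} (hχ : ContDiff ℝ ∞ χ) (z : ℝ × Eucl n) :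
    timeDeriv (separated χ φ) z = deriv χ z.1 • φ z.2 := by
  have := ((hχ.differentiable (by simp) z.1).hasDerivAt.smul_const (φ z.2)).deriv
  exact this

theorem gradMat_separated {φ : Eucl n → Eucl n} (hφ : ContDiff ℝ ∞ φ) (z : ℝ × Eucl n)
    (i j : Fin n) : gradMat (separated χ φ) z i j = χ z.1 * jac φ z.2 i j := by
  exact jac_smul hφ (χ z.1) z.2 i j

theorem contract_gradMat_separated {φ : Eucl n → Eucl n} (hφ : ContDiff ℝ ∞ φ) (z : ℝ × Eucl n)
    (B : Matrix (Fin n) (Fin n) ℝ) :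
    contract (gradMat (separated χ φ) z) B = χ z.1 * contract (jac φ z.2) B := by
  unfold contract
  rw [Finset.mul_sum]
  refine Finset.sum_congr rfl fun i _ => ?_
  rw [Finset.mul_sum]
  refine Finset.sum_congr rfl fun j _ => ?_
  rw [gradMat_separated hφ, mul_assoc]

theorem spaceDiv_separated {φ : Eucl n → Eucl n} (hφ : IsTestField φ) (z : ℝ × Eucl n) :
    spaceDiv (separated χ φ) z = 0 := by
  unfold spaceDiv
  simp_rw [gradMat_separated hφ.smooth, ← Finset.mul_sum, hφ.div_zero, mul_zero]

theorem spaceGrad_separated {ψ : Eucl n → ℝ} (hψ : ContDiff ℝ ∞ ψ) (z : ℝ × Eucl n) :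
    spaceGrad (separated χ ψ) z = χ z.1 • gradient ψ z.2 := by
  have h : fderiv ℝ (fun x => separated χ ψ (z.1, x)) z.2 = χ z.1 • fderiv ℝ ψ z.2 :=
    ((hψ.differentiable (by simp) z.2).hasFDerivAt.const_smul (χ z.1)).fderiv
  simp [spaceGrad, gradient, h]

end Separated

section Comparison

variable {n : ℕ} {T : ℝ} {w f : ℝ → L2 n} {S : ℝ × Eucl n → (Eucl n →L[ℝ] Eucl n)}

theorem restrict_slab (I : Set ℝ) :
    (volume : Measure (ℝ × Eucl n)).restrict (I ×ˢ univ) = (volume.restrict I).prod volume := by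
  rw [Measure.volume_eq_prod, ← Measure.prod_restrict, Measure.restrict_univ]

theorem IsSymGrad.meas_prod (hS : IsSymGrad T w S) :
    AEStronglyMeasurable S ((volume.restrict (Ioo 0 T)).prod volume) := by
  rw [← restrict_slab]
  exact hS.meas

theorem IsSymGrad.aemeasurable_norm (hS : IsSymGrad T w S) :
    AEMeasurable (fun t => eLpNorm (fun x => S (t, x)) ⊤ volume) (volume.restrict (Ioo 0 T)) := by
  simp_rw [eLpNorm_exponent_top, eLpNormEssSup]
  exact aemeasurable_essSup_slice (f := fun z => ‖S z‖ₑ) hS.meas_prod.enorm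

theorem IsSymGrad.ae_memLp (hS : IsSymGrad T w S) :
    ∀ᵐ t ∂(volume.restrict (Ioo 0 T)), MemLp (fun x => S (t, x)) ⊤ volume := by
  filter_upwards [hS.meas_prod.prodMk_left, ae_lt_top' hS.aemeasurable_norm hS.bound.ne] with t h1 h2
  exact ⟨h1, h2⟩

theorem IsSymGrad.integrable_norm (hS : IsSymGrad T w S) :
    IntegrableOn (fun t => (eLpNorm (fun x => S (t, x)) ⊤ volume).toReal) (Ioo 0 T) :=
  integrable_toReal_of_lintegral_ne_top hS.aemeasurable_norm hS.bound.ne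

theorem negPartNorm_nonneg (t : ℝ) : 0 ≤ negPartNorm S t := ENNReal.toReal_nonneg

/-- In particular the integrals of `negPartNorm` in the relative energy inequality are genuine. -/
theorem IsSymGrad.integrable_negPartNorm (hS : IsSymGrad T w S) :
    IntegrableOn (negPartNorm S) (Ioo 0 T) := by
  have hm : AEMeasurable (fun t => eLpNorm (fun x => negPartForm (S (t, x))) ⊤ volume)
      (volume.restrict (Ioo 0 T)) := by
    simp_rw [eLpNorm_exponent_top, eLpNormEssSup]
    exact aemeasurable_essSup_slice (f := fun z => ‖negPartForm (S z)‖ₑ)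
      (continuous_negPartForm.comp_aestronglyMeasurable hS.meas_prod).enorm
  refine integrable_toReal_of_lintegral_ne_top hm (lt_of_le_of_lt ?_ hS.bound).ne
  exact lintegral_mono fun t => eLpNorm_negPartForm_le _

/-- The weak formulation of the symmetric gradient at almost every time. -/
theorem IsSymGrad.ae_weak (hS : IsSymGrad T w S) (hw : ContinuousOn w (Icc 0 T))
    {ψ : Eucl n → ℝ} (hψ : ContDiff ℝ ∞ ψ) (hψc : HasCompactSupport ψ) (i j : Fin n) :
    ∀ᵐ t ∂(volume.restrict (Ioo 0 T)),
      ∫ x, (w t x i * gradient ψ x j + w t x j * gradient ψ x i) / 2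
        = - ∫ x, ψ x * (S (t, x) (EuclideanSpace.single j 1)) i := by
  set p : ℝ → ℝ := fun t => ∫ x, (w t x i * gradient ψ x j + w t x j * gradient ψ x i) / 2 with hp
  set q : ℝ → ℝ := fun t => ∫ x, ψ x * (S (t, x) (EuclideanSpace.single j 1)) i with hq
  -- the left side is an inner product of `L²`
  let G : Eucl n → Eucl n := fun x => (1 / 2 : ℝ) • (gradient ψ x j • EuclideanSpace.single i (1 : ℝ)
    + gradient ψ x i • EuclideanSpace.single j (1 : ℝ))
  have hgc : ∀ k, Continuous fun x => gradient ψ x k := fun k =>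
    (EuclideanSpace.proj (𝕜 := ℝ) k).continuous.comp (continuous_gradient hψ)
  have hgs : ∀ k, HasCompactSupport fun x => gradient ψ x k := fun k =>
    compact_coord (gradient_compact hψc) k
  have hG : MemLp G 2 volume := by
    refine Continuous.memLp_of_hasCompactSupport ?_ ?_
    · have h1 : ∀ k l : Fin n, Continuous fun x =>
          gradient ψ x k • EuclideanSpace.single l (1 : ℝ) := fun k l =>
        (hgc k).smul continuous_const
      exact ((h1 j i).add (h1 i j)).const_smul (1 / 2 : ℝ)
    · have h1 : ∀ k l : Fin n, HasCompactSupport fun x =>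
          gradient ψ x k • EuclideanSpace.single l (1 : ℝ) := fun k l => (hgs k).smul_right
      exact ((h1 j i).add (h1 i j)).smul_left (f := fun _ => (1 / 2 : ℝ))
  have hpG : ∀ t, p t = ⟪hG.toLp G, w t⟫ := by
    intro t
    rw [inner_toLp_eq]
    refine integral_congr_ae (Eventually.of_forall fun x => ?_)
    simp only [G, inner_smul_left, inner_add_left, eucl_inner (EuclideanSpace.single _ _)]
    simp
    ring
  have hpc : ContinuousOn p (Icc 0 T) := by
    have hpe : p = fun t => ⟪hG.toLp G, w t⟫ := funext hpG
    rw [hpe]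
    exact (continuousOn_const (c := hG.toLp G)).inner hw
  have hpi : IntegrableOn p (Ioo 0 T) :=
    (hpc.integrableOn_compact isCompact_Icc).mono_set Ioo_subset_Icc_self
  have hSij : AEStronglyMeasurable (fun z : ℝ × Eucl n =>
      ψ z.2 * (S z (EuclideanSpace.single j 1)) i) ((volume.restrict (Ioo 0 T)).prod volume) := by
    refine (hψ.continuous.comp continuous_snd).aestronglyMeasurable.mul ?_
    let L : (Eucl n →L[ℝ] Eucl n) →L[ℝ] ℝ := (EuclideanSpace.proj (𝕜 := ℝ) i).comp
      (ContinuousLinearMap.apply ℝ (Eucl n) (EuclideanSpace.single j 1))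
    exact L.continuous.comp_aestronglyMeasurable hS.meas_prod
  have hψi : Integrable ψ := hψ.continuous.integrable_of_hasCompactSupport hψc
  have hqi : IntegrableOn q (Ioo 0 T) := by
    refine Integrable.mono' (hS.integrable_norm.mul_const (∫ x, ‖ψ x‖))
      hSij.integral_prod_right' ?_
    filter_upwards [hS.ae_memLp] with t ht
    rw [← integral_const_mul]
    refine norm_integral_le_of_norm_le (hψi.norm.const_mul _) ?_
    filter_upwards [ae_norm_le_eLpNorm_top ht.2] with x hx
    rw [norm_mul, mul_comm]
    gcongr
    rw [Real.norm_eq_abs]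
    refine (abs_coord_le _ i).trans (((S (t, x)).le_opNorm _).trans ?_)
    simpa using hx
  have hmain : ∀ χ : ℝ → ℝ, ContDiff ℝ ∞ χ → HasCompactSupport χ → tsupport χ ⊆ Ioo 0 T →
      ∫ t, χ t • (p t + q t) = 0 := by
    intro χ hχ hχc hχs
    have h := hS.weak (separated χ ψ) (separated_contDiff hχ hψ) (separated_compact hχc hψc)
      (tsupport_separated_subset.trans (prod_mono hχs (subset_univ _))) i j
    have e1 : ∀ t, ∫ x, (w t x i * spaceGrad (separated χ ψ) (t, x) j
        + w t x j * spaceGrad (separated χ ψ) (t, x) i) / 2 = χ t * p t := by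
      intro t
      rw [hp, ← integral_const_mul]
      refine integral_congr_ae (Eventually.of_forall fun x => ?_)
      simp only [spaceGrad_separated hψ, PiLp.smul_apply, smul_eq_mul]
      ring
    have e2 : ∀ t, ∫ x, separated χ ψ (t, x) * (S (t, x) (EuclideanSpace.single j 1)) i
        = χ t * q t := by
      intro t
      rw [hq, ← integral_const_mul]
      refine integral_congr_ae (Eventually.of_forall fun x => ?_)
      simp only [separated, smul_eq_mul]
      ring
    simp_rw [e1, e2] at h
    obtain ⟨C, hC⟩ := hχ.continuous.bounded_above_of_compact_support hχc
    have i1 : IntegrableOn (fun t => χ t * p t) (Ioo 0 T) :=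
      hpi.bdd_mul hχ.continuous.aestronglyMeasurable.restrict (Eventually.of_forall hC)
    have i2 : IntegrableOn (fun t => χ t * q t) (Ioo 0 T) :=
      hqi.bdd_mul hχ.continuous.aestronglyMeasurable.restrict (Eventually.of_forall hC)
    rw [← setIntegral_eq_integral_of_forall_compl_eq_zero (s := Ioo 0 T)]
    · simp only [smul_eq_mul, mul_add]
      rw [integral_add i1 i2, h]
      ring
    · intro t ht
      rw [image_eq_zero_of_notMem_tsupport fun h => ht (hχs h), zero_smul]
  have := isOpen_Ioo.ae_eq_zero_of_integral_contDiff_smul_eq_zero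
    ((hpi.add hqi).locallyIntegrableOn) hmain
  rw [ae_restrict_iff' measurableSet_Ioo]
  filter_upwards [this] with t ht ht'
  have h1 : p t + q t = 0 := ht ht'
  linarith

/-- At almost every time, `S` is the symmetric gradient of `w`. -/
theorem IsSymGrad.ae_isSymGradAt (hS : IsSymGrad T w S) (hw : ContinuousOn w (Icc 0 T)) :
    ∀ᵐ t ∂(volume.restrict (Ioo 0 T)), IsSymGradAt (w t) fun x => S (t, x) := by
  -- it suffices to test with countably many translates of the kernels
  have hall : ∀ᵐ t ∂(volume.restrict (Ioo 0 T)), ∀ (m k : ℕ) (i j : Fin n),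
      ∫ y, (w t y i * gradient (fun y => mollKernel (bumpSeq n m)
            (TopologicalSpace.denseSeq (Eucl n) k - y)) y j
          + w t y j * gradient (fun y => mollKernel (bumpSeq n m)
            (TopologicalSpace.denseSeq (Eucl n) k - y)) y i) / 2
        = - ∫ y, mollKernel (bumpSeq n m) (TopologicalSpace.denseSeq (Eucl n) k - y)
            * (S (t, y) (EuclideanSpace.single j 1)) i := by
    simp_rw [ae_all_iff]
    intro m k i j
    have h1 : ContDiff ℝ ∞ fun y => mollKernel (bumpSeq n m)
        (TopologicalSpace.denseSeq (Eucl n) k - y) :=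
      (mollKernel_contDiff (bumpSeq n m)).comp (contDiff_const.sub contDiff_id)
    have h2 : HasCompactSupport fun y => mollKernel (bumpSeq n m)
        (TopologicalSpace.denseSeq (Eucl n) k - y) :=
      (mollKernel_compact (bumpSeq n m)).comp_homeomorph
        (Homeomorph.subLeft (TopologicalSpace.denseSeq (Eucl n) k))
    exact hS.ae_weak hw h1 h2 i j
  filter_upwards [hall, hS.ae_memLp] with t ht hA
  set A : Eucl n → (Eucl n →L[ℝ] Eucl n) := fun x => S (t, x) with hAdef
  have hloc := L2_locallyIntegrable (w t)
  have hAloc : LocallyIntegrable A volume := hA.locallyIntegrable le_top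
  have hentry : ∀ (m : ℕ) (i j : Fin n) (x : Eucl n),
      (jac (moll (bumpSeq n m) (w t)) x i j + jac (moll (bumpSeq n m) (w t)) x j i) / 2
        = (moll (bumpSeq n m) A x (EuclideanSpace.single j 1)) i := by
    intro m i j
    set b := bumpSeq n m
    let L : (Eucl n →L[ℝ] Eucl n) →L[ℝ] ℝ := (EuclideanSpace.proj (𝕜 := ℝ) i).comp
      (ContinuousLinearMap.apply ℝ (Eucl n) (EuclideanSpace.single j 1))
    have hc1 : ∀ i j, Continuous fun x => jac (moll b (w t)) x i j := fun i j =>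
      continuous_jac ((contDiff_moll b hloc).of_le (by simp)) i j
    refine congrFun (Continuous.ext_on (TopologicalSpace.denseRange_denseSeq (Eucl n))
      (((hc1 i j).add (hc1 j i)).div_const 2)
      (L.continuous.comp (continuous_moll b hAloc)) ?_)
    rintro _ ⟨k, rfl⟩
    set x := TopologicalSpace.denseSeq (Eucl n) k
    have h := ht m k i j
    have hder : ∀ y l, gradient (fun y => mollKernel b (x - y)) y l
        = - fderiv ℝ (mollKernel b) (x - y) (EuclideanSpace.single l 1) := by
      intro y l
      have h1 := ((mollKernel_contDiff b).differentiable (by simp) (x - y)).hasFDerivAt.comp y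
        ((hasFDerivAt_id y).const_sub x)
      have h2 : fderiv ℝ (fun y => mollKernel b (x - y)) y = _ := h1.fderiv
      rw [gradient_apply, h2]
      simp
    have hint : ∀ i j, Integrable fun y =>
        fderiv ℝ (mollKernel b) (x - y) (EuclideanSpace.single j 1) * w t y i := by
      intro i j
      have hi : LocallyIntegrable (fun y => w t y i) volume := by
        intro z
        obtain ⟨s, hs, hsi⟩ := hloc z
        exact ⟨s, hs, (EuclideanSpace.proj (𝕜 := ℝ) i).integrable_comp hsi⟩
      exact hi.integrable_smul_left_of_hasCompactSupport
        ((fderiv_mollKernel_continuous b _).comp (by fun_prop))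
        ((fderiv_mollKernel_compact b _).comp_homeomorph (Homeomorph.subLeft x))
    have e1 : ∫ y, (w t y i * gradient (fun y => mollKernel b (x - y)) y j
        + w t y j * gradient (fun y => mollKernel b (x - y)) y i) / 2
        = - ((jac (moll b (w t)) x i j + jac (moll b (w t)) x j i) / 2) := by
      rw [jac_moll_eq_integral b hloc, jac_moll_eq_integral b hloc, ← integral_add (hint i j)
        (hint j i), ← integral_div, ← integral_neg]
      refine integral_congr_ae (Eventually.of_forall fun y => ?_)
      simp only [hder]
      ring
    have e2 : L (moll b A x) = ∫ y, mollKernel b (x - y) * (A y (EuclideanSpace.single j 1)) i := by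
      have hi : Integrable fun y => mollKernel b (x - y) • A y :=
        ((mollKernel_compact b).convolutionExists_left (ContinuousLinearMap.lsmul ℝ ℝ)
          (mollKernel_contDiff b).continuous hAloc x).integrable_swap
      rw [moll_apply', ← L.integral_comp_comm hi]
      simp_rw [map_smul, smul_eq_mul]
      rfl
    have h' := e1.symm.trans h
    change _ = L (moll b A x)
    rw [e2]
    exact neg_injective h'
  refine ⟨hA, fun m x ξ η => ?_⟩
  have c1 := contract_jac_eq_inner (moll (bumpSeq n m) (w t)) x η ξ
  have c2 := contract_jac_eq_inner (moll (bumpSeq n m) (w t)) x ξ η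
  have c3 := contract_eq_inner (moll (bumpSeq n m) A x) η ξ
  rw [real_inner_comm _ ξ, ← c1, ← c2, ← c3]
  unfold contract
  have c4 : ∑ i, ∑ j, jac (moll (bumpSeq n m) (w t)) x i j * (ξ i * η j)
      = ∑ i, ∑ j, jac (moll (bumpSeq n m) (w t)) x j i * (ξ j * η i) := Finset.sum_comm
  rw [c4, ← Finset.sum_add_distrib, Finset.mul_sum]
  refine Finset.sum_congr rfl fun i _ => ?_
  rw [← Finset.sum_add_distrib, Finset.mul_sum]
  refine Finset.sum_congr rfl fun j _ => ?_
  have h := hentry m i j x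
  change jac (moll (bumpSeq n m) (w t)) x i j * (η i * ξ j)
      + jac (moll (bumpSeq n m) (w t)) x j i * (ξ j * η i)
      = 2 * ((moll (bumpSeq n m) A x (EuclideanSpace.single j 1)) i * (η i * ξ j))
  rw [← h]
  ring

end Comparison

/-! ### Comparison fields as primitives of their time derivatives -/

section Primitive

variable {n : ℕ} {T : ℝ} {w f : ℝ → L2 n} {S : ℝ × Eucl n → (Eucl n →L[ℝ] Eucl n)}

instance completeSpace_divFree : CompleteSpace (divFree n) := isClosed_divFree.completeSpace_coe

theorem starProjection_divFree_self {u : L2 n} (hu : u ∈ divFree n) :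
    (divFree n).starProjection u = u :=
  Submodule.starProjection_eq_self_iff.2 hu

open Classical in
/-- The solenoidal part `P (S w)` of `S w`, that is half of `P div (w ⊗ w)`, at those times at which
`S` is an essentially bounded symmetric gradient of `w`, and zero at the others. -/
noncomputable def projStrain (w : ℝ → L2 n) (S : ℝ × Eucl n → (Eucl n →L[ℝ] Eucl n)) (t : ℝ) :
    L2 n :=
  if h : IsSymGradAt (w t) fun x => S (t, x) then
    (divFree n).starProjection (mulLin h.memLp (w t)) else 0

theorem projStrain_mem (t : ℝ) : projStrain w S t ∈ divFree n := by
  unfold projStrain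
  split_ifs
  · exact Submodule.starProjection_apply_mem _ _
  · exact zero_mem _

theorem inner_projStrain {t : ℝ} (h : IsSymGradAt (w t) fun x => S (t, x)) {u : L2 n}
    (hu : u ∈ divFree n) : ⟪projStrain w S t, u⟫ = ⟪mulLin h.memLp (w t), u⟫ := by
  rw [projStrain, dif_pos h, Submodule.inner_starProjection_left_eq_right,
    starProjection_divFree_self hu]

theorem norm_projStrain_le (t : ℝ) :
    ‖projStrain w S t‖ ≤ (eLpNorm (fun x => S (t, x)) ⊤ volume).toReal * ‖w t‖ := by
  unfold projStrain
  split_ifs with h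
  · exact ((divFree n).norm_starProjection_apply_le _).trans
      (mulLin_norm_le h.memLp (ae_norm_le_eLpNorm_top h.memLp.2) _)
  · simp only [norm_zero]
    positivity

theorem IsTestField.memLp_fderiv {φ : Eucl n → Eucl n} (h : IsTestField φ) :
    MemLp (fderiv ℝ φ) ⊤ volume := by
  have hc := h.smooth.continuous_fderiv (by simp)
  obtain ⟨C, hC⟩ := hc.bounded_above_of_compact_support (h.compact.fderiv (𝕜 := ℝ))
  exact memLp_top_of_bound hc.aestronglyMeasurable C (Eventually.of_forall hC)

theorem continuous_mulLin {A : Eucl n → (Eucl n →L[ℝ] Eucl n)} (hA : MemLp A ⊤ volume) :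
    Continuous (mulLin hA) :=
  ((mulLin hA).mkContinuous _ (mulLin_norm_le hA (ae_norm_le_eLpNorm_top hA.2))).continuous

/-- `projStrain` represents half of `div (w ⊗ w)` on solenoidal test fields. -/
theorem inner_testL_projStrain {t : ℝ} (h : IsSymGradAt (w t) fun x => S (t, x))
    (hd : IsDivFree (w t)) (φ : testFields n) :
    ⟪testL n φ, projStrain w S t⟫
      = - (1 / 2) * ⟪mulLin (IsTestField.memLp_fderiv φ.2) (w t), w t⟫ := by
  have h1 := h.integral_fderiv_test hd φ.2
  have h2 : ⟪testL n φ, mulLin h.memLp (w t)⟫ = ∫ x, ⟪S (t, x) (w t x), φ.1 x⟫ := by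
    rw [real_inner_comm, inner_mulLin]
    refine integral_congr_ae ((testL_coeFn φ).mono fun x hx => ?_)
    simp only [hx]
  rw [real_inner_comm, inner_projStrain h (testL_mem_divFree φ), real_inner_comm, h2,
    inner_mulLin, h1]
  ring

theorem aestronglyMeasurable_projStrain (hw : ContinuousOn w (Icc 0 T))
    (hdiv : ∀ t ∈ Icc 0 T, IsDivFree (w t)) (hS : IsSymGrad T w S) :
    AEStronglyMeasurable (projStrain w S) (volume.restrict (Ioo 0 T)) := by
  have := secondCountable_L2 n
  refine aestronglyMeasurable_of_inner fun g => ?_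
  -- the projection of `g` is a limit of test fields
  obtain ⟨a, ha, hlim⟩ := mem_closure_iff_seq_limit.1
    (mem_closure_testL ((divFree n).starProjection_apply_mem g))
  choose φ hφ using ha
  refine aestronglyMeasurable_of_tendsto_ae atTop
    (f := fun k t => ⟪testL n (φ k), projStrain w S t⟫) (fun k => ?_)
    (Eventually.of_forall fun t => ?_)
  · have hc : ContinuousOn (fun t => - (1 / 2 : ℝ) *
        ⟪mulLin (IsTestField.memLp_fderiv (φ k).2) (w t), w t⟫) (Icc 0 T) :=
      (((continuous_mulLin _).comp_continuousOn hw).inner hw).const_mul _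
    refine ((hc.mono Ioo_subset_Icc_self).aestronglyMeasurable measurableSet_Ioo).congr ?_
    filter_upwards [hS.ae_isSymGradAt hw, ae_restrict_mem measurableSet_Ioo] with t ht htI
    exact (inner_testL_projStrain ht (hdiv t (Ioo_subset_Icc_self htI)) (φ k)).symm
  · simp_rw [hφ]
    have h1 : ⟪g, projStrain w S t⟫ = ⟪(divFree n).starProjection g, projStrain w S t⟫ := by
      rw [Submodule.inner_starProjection_left_eq_right,
        starProjection_divFree_self (projStrain_mem t)]
    rw [h1]
    exact hlim.inner tendsto_const_nhds

theorem integrableOn_projStrain (hw : ContinuousOn w (Icc 0 T))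
    (hdiv : ∀ t ∈ Icc 0 T, IsDivFree (w t)) (hS : IsSymGrad T w S) :
    IntegrableOn (projStrain w S) (Ioo 0 T) := by
  obtain ⟨M, hM⟩ := isCompact_Icc.exists_bound_of_continuousOn hw
  refine Integrable.mono' (hS.integrable_norm.mul_const M)
    (aestronglyMeasurable_projStrain hw hdiv hS) ?_
  filter_upwards [ae_restrict_mem measurableSet_Ioo] with t ht
  refine (norm_projStrain_le t).trans ?_
  gcongr
  exact hM t (Ioo_subset_Icc_self ht)

theorem integral_mem_divFree {g : ℝ → L2 n} {a b : ℝ} (hab : a ≤ b)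
    (hg : IntervalIntegrable g volume a b)
    (hd : ∀ᵐ t ∂(volume.restrict (Ioo a b)), g t ∈ divFree n) :
    ∫ t in a..b, g t ∈ divFree n := by
  have h := (divFree n).starProjection.intervalIntegral_comp_comm hg
  refine Submodule.starProjection_eq_self_iff.1 (h.symm.trans ?_)
  rw [intervalIntegral.integral_of_le hab, intervalIntegral.integral_of_le hab,
    integral_Ioc_eq_integral_Ioo, integral_Ioc_eq_integral_Ioo]
  exact integral_congr_ae (hd.mono fun t ht => starProjection_divFree_self ht)

theorem inner_intervalIntegral {H : Type*} [NormedAddCommGroup H] [InnerProductSpace ℝ H]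
    [CompleteSpace H] {g : ℝ → H} {a b : ℝ} (hg : IntervalIntegrable g volume a b) (c : H) :
    ⟪c, ∫ t in a..b, g t⟫ = ∫ t in a..b, ⟪c, g t⟫ :=
  ((innerSL ℝ c).intervalIntegral_comp_comm hg).symm

/-- The time derivative of a comparison field. -/
noncomputable def fieldDeriv (w f : ℝ → L2 n) (S : ℝ × Eucl n → (Eucl n →L[ℝ] Eucl n)) (t : ℝ) :
    L2 n :=
  - f t - (2 : ℝ) • projStrain w S t

theorem integrableOn_fieldDeriv (hw : ContinuousOn w (Icc 0 T))
    (hdiv : ∀ t ∈ Icc 0 T, IsDivFree (w t)) (hS : IsSymGrad T w S) (hf : IsResidual T w f) :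
    IntegrableOn (fieldDeriv w f S) (Ioo 0 T) :=
  hf.integrable.neg.sub ((integrableOn_projStrain hw hdiv hS).smul (2 : ℝ))

theorem fieldDeriv_mem (hf : IsResidual T w f) :
    ∀ᵐ t ∂(volume.restrict (Ioo 0 T)), fieldDeriv w f S t ∈ divFree n := by
  filter_upwards [hf.div_free] with t ht
  exact sub_mem (neg_mem (mem_divFree.2 ht)) (Submodule.smul_mem _ _ (projStrain_mem t))

theorem inner_fieldDeriv {t : ℝ} (h : IsSymGradAt (w t) fun x => S (t, x)) {u : L2 n}
    (hu : u ∈ divFree n) :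
    ⟪fieldDeriv w f S t, u⟫ = - ⟪f t, u⟫ - 2 * ⟪mulLin h.memLp (w t), u⟫ := by
  rw [fieldDeriv, inner_sub_left, inner_neg_left, real_inner_smul_left, inner_projStrain h hu]

/-- A comparison field is the primitive of its time derivative. -/
theorem eq_add_integral_fieldDeriv (hT : 0 < T) (hw : ContinuousOn w (Icc 0 T))
    (hdiv : ∀ t ∈ Icc 0 T, IsDivFree (w t)) (hS : IsSymGrad T w S) (hf : IsResidual T w f)
    {t : ℝ} (ht : t ∈ Icc 0 T) : w t = w 0 + ∫ s in (0 : ℝ)..t, fieldDeriv w f S s := by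
  have hgi := integrableOn_fieldDeriv hw hdiv hS hf
  have hgI : ∀ t ∈ Icc 0 T, IntervalIntegrable (fieldDeriv w f S) volume 0 t := by
    intro t ht
    rw [intervalIntegrable_iff_integrableOn_Ioo_of_le ht.1]
    exact hgi.mono_set (Ioo_subset_Ioo le_rfl ht.2)
  have hdg := fieldDeriv_mem (S := S) hf
  have hmem : w t - (w 0 + ∫ s in (0 : ℝ)..t, fieldDeriv w f S s) ∈ divFree n :=
    sub_mem (hdiv t ht) (add_mem (hdiv 0 (left_mem_Icc.2 hT.le)) (integral_mem_divFree ht.1 (hgI t ht)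
      (ae_restrict_of_ae_restrict_of_subset (Ioo_subset_Ioo le_rfl ht.2) hdg)))
  -- a solenoidal field orthogonal to all test fields vanishes
  rw [← sub_eq_zero]
  refine eq_zero_of_orthogonal _ hmem fun φ => ?_
  have hw' : ContinuousOn w (Ioo 0 T) := hw.mono Ioo_subset_Icc_self
  have ha : ContinuousOn (fun t => ⟪testL n φ, w t⟫) (Icc 0 T) :=
    (continuousOn_const (c := testL n φ)).inner hw
  have hβ : IntegrableOn (fun t => ⟪testL n φ, fieldDeriv w f S t⟫) (Ioo 0 T) :=
    hgi.const_inner _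
  have key := eq_add_integral_of_weak_deriv hT ha hβ ?_ t ht
  -- the pairing with a test field is the primitive of its weak derivative
  · simp only [← inner_intervalIntegral (hgI t ht)] at key
    rw [inner_sub_right, inner_add_right]
    linarith
  intro χ hχ hχc hχs
  have h := hf.weak (separated χ φ.1) (separated_contDiff hχ (IsTestField.smooth φ.2))
    (separated_compact hχc (IsTestField.compact φ.2))
    (tsupport_separated_subset.trans (prod_mono hχs (subset_univ _)))
    (spaceDiv_separated φ.2)
  set Q : ℝ → ℝ := fun t => ⟪mulLin (IsTestField.memLp_fderiv φ.2) (w t), w t⟫ with hQ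
  have hQc : ContinuousOn Q (Icc 0 T) := ((continuous_mulLin _).comp_continuousOn hw).inner hw
  have e1 : ∀ t, ∫ x, (⟪w t x, timeDeriv (separated χ φ.1) (t, x)⟫
      + contract (gradMat (separated χ φ.1) (t, x)) (fun i j => w t x i * w t x j))
      = deriv χ t * ⟪testL n φ, w t⟫ + χ t * Q t := by
    intro t
    have i1 : Integrable fun x => ⟪φ.1 x, w t x⟫ :=
      (L2.integrable_inner (𝕜 := ℝ) (testL n φ) (w t)).congr
        ((testL_coeFn φ).mono fun x hx => by simp only [hx])
    have i2 : Integrable fun x => ⟪fderiv ℝ φ.1 x (w t x), w t x⟫ :=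
      (L2.integrable_inner (𝕜 := ℝ) (mulLin (IsTestField.memLp_fderiv φ.2) (w t)) (w t)).congr
        ((mulLin_coeFn (IsTestField.memLp_fderiv φ.2) (w t)).mono fun x hx => by simp only [hx])
    have hQt : Q t = ∫ x, ⟪fderiv ℝ φ.1 x (w t x), w t x⟫ := inner_mulLin _ _ _
    rw [inner_testL, hQt, ← integral_const_mul, ← integral_const_mul,
      ← integral_add (i1.const_mul _) (i2.const_mul _)]
    refine integral_congr_ae (Eventually.of_forall fun x => ?_)
    have hc : contract (gradMat (separated χ φ.1) (t, x)) (fun i j => w t x i * w t x j)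
        = χ t * ⟪fderiv ℝ φ.1 x (w t x), w t x⟫ :=
      (contract_gradMat_separated (IsTestField.smooth φ.2) _ _).trans
        (congrArg (χ t * ·) (contract_jac_eq_inner φ.1 x (w t x) (w t x)))
    have ht : ⟪w t x, timeDeriv (separated χ φ.1) (t, x)⟫ = deriv χ t * ⟪φ.1 x, w t x⟫ := by
      rw [timeDeriv_separated hχ, real_inner_smul_right, real_inner_comm]
    exact congrArg₂ (· + ·) ht hc
  have e2 : ∀ t, ∫ x, ⟪f t x, separated χ φ.1 (t, x)⟫ = χ t * ⟪testL n φ, f t⟫ := by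
    intro t
    rw [inner_testL, ← integral_const_mul]
    refine integral_congr_ae (Eventually.of_forall fun x => ?_)
    simp only [separated, real_inner_smul_right]
    rw [real_inner_comm]
  simp_rw [e1, e2] at h
  obtain ⟨C, hC⟩ := hχ.continuous.bounded_above_of_compact_support hχc
  have hχ' : Continuous (deriv χ) := hχ.continuous_deriv (by simp)
  have j1 : IntegrableOn (fun t => deriv χ t * ⟪testL n φ, w t⟫ + χ t * Q t) (Ioo 0 T) :=
    (((hχ'.continuousOn.mul ha).add (hχ.continuous.continuousOn.mul hQc)).integrableOn_compact
      isCompact_Icc).mono_set Ioo_subset_Icc_self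
  have j2 : IntegrableOn (fun t => χ t * ⟪testL n φ, f t⟫) (Ioo 0 T) :=
    (hf.integrable.const_inner _).bdd_mul hχ.continuous.aestronglyMeasurable.restrict
      (Eventually.of_forall hC)
  rw [← sub_eq_zero, ← integral_sub j1 j2] at h
  refine Eq.trans (integral_congr_ae ?_) h
  filter_upwards [hS.ae_isSymGradAt hw, ae_restrict_mem measurableSet_Ioo] with t ht htI
  have h1 := inner_testL_projStrain ht (hdiv t (Ioo_subset_Icc_self htI)) φ
  simp only [fieldDeriv, inner_sub_right, inner_neg_right, real_inner_smul_right, h1, hQ]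
  ring

/-- The energy balance of a comparison field: the quadratic term does not contribute. -/
theorem norm_sq_sub_eq (hT : 0 < T) (hw : ContinuousOn w (Icc 0 T))
    (hdiv : ∀ t ∈ Icc 0 T, IsDivFree (w t)) (hS : IsSymGrad T w S) (hf : IsResidual T w f)
    {t : ℝ} (ht : t ∈ Icc 0 T) : ‖w t‖ ^ 2 - ‖w 0‖ ^ 2 = ∫ s in (0 : ℝ)..t, - 2 * ⟪f s, w s⟫ := by
  have hgi := integrableOn_fieldDeriv hw hdiv hS hf
  have hgI : IntervalIntegrable (fieldDeriv w f S) volume 0 t := by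
    rw [intervalIntegrable_iff_integrableOn_Ioo_of_le ht.1]
    exact hgi.mono_set (Ioo_subset_Ioo le_rfl ht.2)
  have h := norm_sq_primitive hgI (w 0)
  rw [← eq_add_integral_fieldDeriv hT hw hdiv hS hf ht] at h
  rw [h, intervalIntegral.integral_of_le ht.1, intervalIntegral.integral_of_le ht.1,
    integral_Ioc_eq_integral_Ioo, integral_Ioc_eq_integral_Ioo]
  refine integral_congr_ae ?_
  filter_upwards [ae_restrict_of_ae_restrict_of_subset (Ioo_subset_Ioo le_rfl ht.2)
    (hS.ae_isSymGradAt hw), ae_restrict_mem measurableSet_Ioo] with s hs hsI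
  have hsI' : s ∈ Icc 0 T := ⟨hsI.1.le, hsI.2.le.trans ht.2⟩
  rw [← eq_add_integral_fieldDeriv hT hw hdiv hS hf hsI', real_inner_comm,
    inner_fieldDeriv hs (hdiv s hsI'), hs.inner_mul_self (hdiv s hsI')]
  ring

end Primitive

/-! ### Matrix-valued measures with bounded time marginal -/

theorem abs_contract_le {n : ℕ} {A B : Matrix (Fin n) (Fin n) ℝ} {C e : ℝ}
    (hA : ∀ i j, |A i j| ≤ C) (hB : ∀ i j, |B i j| ≤ e) : |contract A B| ≤ n * n * C * e := by
  unfold contract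
  refine (Finset.abs_sum_le_sum_abs _ _).trans ?_
  refine (Finset.sum_le_sum fun i _ => Finset.abs_sum_le_sum_abs _ _).trans ?_
  refine (Finset.sum_le_sum fun i _ => Finset.sum_le_sum (g := fun _ => C * e) fun j _ => ?_).trans
    (le_of_eq ?_)
  · rw [abs_mul]
    exact mul_le_mul (hA i j) (hB i j) (abs_nonneg _) ((abs_nonneg _).trans (hA i j))
  · simp
    ring

/-- The field representing the functional `a ↦ ∇(η_b ⋆ a)(x) : B` in `L²`. -/
noncomputable def gradRep {n : ℕ} (b : ContDiffBump (0 : Eucl n)) (x : Eucl n)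
    (B : Matrix (Fin n) (Fin n) ℝ) : L2 n :=
  ∑ i, ∑ j, B i j • (gradKernel_memLp b x i j).toLp _

theorem contract_jac_moll {n : ℕ} (b : ContDiffBump (0 : Eucl n)) (x : Eucl n)
    (B : Matrix (Fin n) (Fin n) ℝ) (a : L2 n) :
    contract (jac (moll b a) x) B = ⟪gradRep b x B, a⟫ := by
  unfold contract
  simp only [gradRep, sum_inner, real_inner_smul_left, jac_moll_eq_inner]
  exact Finset.sum_congr rfl fun i _ => Finset.sum_congr rfl fun j _ => mul_comm _ _

/-- A matrix-valued measure `Θ τ` on space-time, dominated by a nonnegative measure `e τ` whose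
marginal in time is supported on `[0, ∞)` and has a density bounded by `V`. The two parts of a
generalized Young measure live on different copies of space-time, so the points of `Z` are mapped to
times and positions by `time` and `pos`. -/
structure StressMeasure (n : ℕ) (V : ℝ) (Z : Type*) [MeasurableSpace Z] where
  /-- the reference measure -/
  τ : Measure Z
  /-- the time coordinate -/
  time : Z → ℝ
  /-- the space coordinate -/
  pos : Z → Eucl n
  /-- the density of the matrix-valued measure -/
  Θ : Z → Matrix (Fin n) (Fin n) ℝ
  /-- the density of the dominating measure -/
  e : Z → ℝ
  sfinite : SFinite τ
  measurable_time : Measurable time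
  time_qmp : Measure.QuasiMeasurePreserving time τ (volume.restrict (Ici 0))
  measurable_pos : Measurable pos
  meas : ∀ i j, AEStronglyMeasurable (fun z => Θ z i j) τ
  e_meas : AEMeasurable e τ
  bound : ∀ᵐ z ∂τ, ∀ i j, |Θ z i j| ≤ e z
  e_nonneg : ∀ z, 0 ≤ e z
  V_nonneg : 0 ≤ V
  marginal : ∀ B : Set ℝ, MeasurableSet B →
    ∫⁻ z in time ⁻¹' B, ENNReal.ofReal (e z) ∂τ ≤ ENNReal.ofReal V * volume (B ∩ Ici 0)

namespace StressMeasure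

variable {n : ℕ} {V : ℝ} {Z : Type*} [MeasurableSpace Z] (M : StressMeasure n V Z)

theorem time_nonneg : ∀ᵐ z ∂M.τ, 0 ≤ M.time z :=
  M.time_qmp.ae (ae_restrict_mem measurableSet_Ici)

/-- The bound on the marginal in time, for integrands in place of sets. -/
theorem lintegral_time_le {h : ℝ → ENNReal} (hh : AEMeasurable h (volume.restrict (Ici 0))) :
    ∫⁻ z, h (M.time z) * ENNReal.ofReal (M.e z) ∂M.τ
      ≤ ENNReal.ofReal V * ∫⁻ t in Ici 0, h t := by
  set ρ := (M.τ.withDensity fun z => ENNReal.ofReal (M.e z)).map M.time with hρ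
  have hle : ρ ≤ ENNReal.ofReal V • volume.restrict (Ici 0) := by
    refine Measure.le_intro fun B hB _ => ?_
    rw [hρ, Measure.map_apply M.measurable_time hB,
      withDensity_apply _ (M.measurable_time hB), Measure.smul_apply, Measure.restrict_apply hB,
      smul_eq_mul]
    exact M.marginal B hB
  have hρm : AEMeasurable h ρ :=
    hh.mono_ac (hle.absolutelyContinuous.trans Measure.smul_absolutelyContinuous)
  have h1 : ∫⁻ z, h (M.time z) * ENNReal.ofReal (M.e z) ∂M.τ = ∫⁻ t, h t ∂ρ := by
    have h2 := lintegral_withDensity_eq_lintegral_mul₀' M.e_meas.ennreal_ofReal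
      (g := fun z => h (M.time z)) (hρm.comp_measurable M.measurable_time)
    rw [lintegral_map' hρm M.measurable_time.aemeasurable, h2]
    exact lintegral_congr fun z => mul_comm _ _
  rw [h1]
  refine (lintegral_mono' hle le_rfl).trans ?_
  rw [lintegral_smul_measure, smul_eq_mul]

theorem integrable_time_mul {h : ℝ → ℝ} (hh : IntegrableOn h (Ici 0)) :
    Integrable (fun z => h (M.time z) * M.e z) M.τ := by
  refine ⟨(hh.1.comp_quasiMeasurePreserving M.time_qmp).mul M.e_meas.aestronglyMeasurable, ?_⟩
  refine lt_of_eq_of_lt (lintegral_congr fun z => ?_)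
    ((M.lintegral_time_le hh.1.enorm).trans_lt (ENNReal.mul_lt_top ENNReal.ofReal_lt_top hh.2))
  rw [enorm_mul, Real.enorm_of_nonneg (M.e_nonneg z)]

theorem integral_time_mul_le {h : ℝ → ℝ} (hh : IntegrableOn h (Ici 0)) (h0 : ∀ t, 0 ≤ h t) :
    ∫ z, h (M.time z) * M.e z ∂M.τ ≤ V * ∫ t in Ici 0, h t := by
  have hI : 0 ≤ ∫ t in Ici 0, h t := integral_nonneg h0
  rw [integral_eq_lintegral_of_nonneg_ae
    (Eventually.of_forall fun z => mul_nonneg (h0 _) (M.e_nonneg z)) (M.integrable_time_mul hh).1]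
  refine ENNReal.toReal_le_of_le_ofReal (mul_nonneg M.V_nonneg hI) ?_
  rw [ENNReal.ofReal_mul M.V_nonneg,
    ofReal_integral_eq_lintegral_ofReal hh (Eventually.of_forall h0)]
  refine le_of_eq_of_le (lintegral_congr fun z => ?_)
    (M.lintegral_time_le hh.1.aemeasurable.ennreal_ofReal)
  rw [ENNReal.ofReal_mul (h0 _)]

/-- The weight of a time slab. -/
theorem lintegral_slab_le (s t : ℝ) :
    ∫⁻ z in M.time ⁻¹' Ioc s t, ENNReal.ofReal (M.e z) ∂M.τ ≤ ENNReal.ofReal (V * (t - s)) := by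
  refine (M.marginal _ measurableSet_Ioc).trans ?_
  rw [ENNReal.ofReal_mul M.V_nonneg]
  gcongr
  exact (measure_mono inter_subset_left).trans (by rw [Real.volume_Ioc])

theorem lintegral_Iic_le (t : ℝ) :
    ∫⁻ z in M.time ⁻¹' Iic t, ENNReal.ofReal (M.e z) ∂M.τ ≤ ENNReal.ofReal (V * t) := by
  refine (M.marginal _ measurableSet_Iic).trans ?_
  rw [ENNReal.ofReal_mul M.V_nonneg]
  gcongr
  rw [inter_comm, Ici_inter_Iic, Real.volume_Icc, sub_zero]

theorem integrableOn_e (t : ℝ) : IntegrableOn M.e (M.time ⁻¹' Iic t) M.τ := by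
  refine ⟨M.e_meas.aestronglyMeasurable.restrict, ?_⟩
  rw [hasFiniteIntegral_iff_ofReal (Eventually.of_forall M.e_nonneg)]
  exact (M.lintegral_Iic_le t).trans_lt ENNReal.ofReal_lt_top

theorem aestronglyMeasurable_contract {A : Z → Matrix (Fin n) (Fin n) ℝ} {μ : Measure Z}
    (hμ : μ ≪ M.τ) (hA : ∀ i j, AEStronglyMeasurable (fun z => A z i j) μ) :
    AEStronglyMeasurable (fun z => contract (A z) (M.Θ z)) μ := by
  unfold contract
  exact Finset.aestronglyMeasurable_fun_sum _ fun i _ =>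
    Finset.aestronglyMeasurable_fun_sum _ fun j _ => (hA i j).mul ((M.meas i j).mono_ac hμ)

/-- The integral of `A : Θ` over times at most `t`. -/
noncomputable def upto (t : ℝ) (A : Eucl n → Matrix (Fin n) (Fin n) ℝ) : ℝ :=
  ∫ z in M.time ⁻¹' Iic t, contract (A (M.pos z)) (M.Θ z) ∂M.τ

section Upto

variable {A : Eucl n → Matrix (Fin n) (Fin n) ℝ} {C : ℝ}

theorem integrableOn_contract (hA : ∀ i j, Continuous fun x => A x i j)
    (hC : ∀ x i j, |A x i j| ≤ C) (t : ℝ) :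
    IntegrableOn (fun z => contract (A (M.pos z)) (M.Θ z)) (M.time ⁻¹' Iic t) M.τ := by
  refine Integrable.mono' ((M.integrableOn_e t).const_mul (n * n * C))
    (M.aestronglyMeasurable_contract Measure.absolutelyContinuous_restrict fun i j =>
      ((hA i j).measurable.comp M.measurable_pos).aestronglyMeasurable) ?_
  filter_upwards [ae_restrict_of_ae M.bound] with z hz
  exact abs_contract_le (hC _) hz

theorem abs_upto_sub_le (hA : ∀ i j, Continuous fun x => A x i j)
    (hC : ∀ x i j, |A x i j| ≤ C) (hC0 : 0 ≤ C) {s t : ℝ} (hst : s ≤ t) :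
    |M.upto t A - M.upto s A| ≤ n * n * C * (V * (t - s)) := by
  have hd : Disjoint (M.time ⁻¹' Iic s) (M.time ⁻¹' Ioc s t) :=
    (Iic_disjoint_Ioc le_rfl).preimage _
  have hu : M.time ⁻¹' Iic t = M.time ⁻¹' Iic s ∪ M.time ⁻¹' Ioc s t := by
    rw [← preimage_union, Iic_union_Ioc_eq_Iic hst]
  have hi := M.integrableOn_contract hA hC t
  rw [hu, integrableOn_union] at hi
  have hsplit : M.upto t A - M.upto s A
      = ∫ z in M.time ⁻¹' Ioc s t, contract (A (M.pos z)) (M.Θ z) ∂M.τ := by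
    rw [upto, upto, hu, setIntegral_union hd (M.measurable_time measurableSet_Ioc) hi.1 hi.2]
    ring
  have he : IntegrableOn M.e (M.time ⁻¹' Ioc s t) M.τ :=
    (M.integrableOn_e t).mono_set (preimage_mono Ioc_subset_Iic_self)
  rw [hsplit, ← Real.norm_eq_abs]
  refine (norm_integral_le_of_norm_le (he.const_mul (n * n * C)) ?_).trans ?_
  · filter_upwards [ae_restrict_of_ae M.bound] with z hz
    exact abs_contract_le (hC _) hz
  · rw [integral_const_mul]
    gcongr
    rw [integral_eq_lintegral_of_nonneg_ae (Eventually.of_forall M.e_nonneg) he.1]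
    exact ENNReal.toReal_le_of_le_ofReal
      (mul_nonneg M.V_nonneg (by linarith)) (M.lintegral_slab_le s t)

theorem upto_zero (hC : ∀ x i j, |A x i j| ≤ C) : M.upto 0 A = 0 := by
  have h0 : ∫⁻ z in M.time ⁻¹' Iic 0, ENNReal.ofReal (M.e z) ∂M.τ = 0 := by
    simpa using M.lintegral_Iic_le 0
  rw [lintegral_eq_zero_iff' M.e_meas.ennreal_ofReal.restrict] at h0
  refine integral_eq_zero_of_ae ?_
  filter_upwards [h0, ae_restrict_of_ae M.bound] with z h1 h2
  have h3 : M.e z = 0 := le_antisymm (by simpa using h1) (M.e_nonneg z)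
  have h4 := abs_contract_le (hC (M.pos z)) h2
  rw [h3, mul_zero] at h4
  exact abs_nonpos_iff.1 h4

/-- The stress is Lipschitz in the upper limit of time, as the marginal has a bounded density. This is
why the concentrations cause no jumps in time. -/
theorem continuous_upto (hA : ∀ i j, Continuous fun x => A x i j)
    (hC : ∀ x i j, |A x i j| ≤ C) (hC0 : 0 ≤ C) : Continuous fun t => M.upto t A := by
  have hV := M.V_nonneg
  refine LipschitzWith.continuous (K := Real.toNNReal (n * n * C * V))
    (LipschitzWith.of_dist_le_mul fun s t => ?_)
  rw [Real.coe_toNNReal _ (by positivity), Real.dist_eq, Real.dist_eq]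
  rcases le_total s t with h | h
  · rw [abs_sub_comm, abs_sub_comm s, abs_of_nonneg (sub_nonneg.2 h)]
    exact (M.abs_upto_sub_le hA hC hC0 h).trans_eq (by ring)
  · rw [abs_of_nonneg (sub_nonneg.2 h)]
    exact (M.abs_upto_sub_le hA hC hC0 h).trans_eq (by ring)

end Upto

/-- Fubini's theorem on the region `{time z ≤ r ≤ t}`. -/
theorem integral_upto_eq {t : ℝ} (ht : 0 ≤ t) {G : ℝ → Z → ℝ} {h : ℝ → ℝ}
    (hG : AEStronglyMeasurable (Function.uncurry G) ((volume.restrict (Ioc 0 t)).prod M.τ))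
    (hh : IntegrableOn h (Ioc 0 t)) (hle : ∀ᵐ z ∂M.τ, ∀ r, |G r z| ≤ h r * M.e z) :
    ∫ r in (0 : ℝ)..t, ∫ z in M.time ⁻¹' Iic r, G r z ∂M.τ
      = ∫ z in M.time ⁻¹' Iic t, (∫ r in M.time z..t, G r z) ∂M.τ := by
  have := M.sfinite
  set τ' := M.τ.restrict (M.time ⁻¹' Iic t) with hτ'
  set D : Set (ℝ × Z) := {p | M.time p.2 ≤ p.1} with hD
  have hDm : MeasurableSet D := measurableSet_le (M.measurable_time.comp measurable_snd) measurable_fst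
  have hac : τ' ≪ M.τ := Measure.absolutelyContinuous_restrict
  have hGm : AEStronglyMeasurable (Function.uncurry G) ((volume.restrict (Ioc 0 t)).prod τ') :=
    hG.mono_ac (Measure.AbsolutelyContinuous.rfl.prod hac)
  have hGle : ∀ᵐ p ∂((volume.restrict (Ioc 0 t)).prod τ'), |G p.1 p.2| ≤ h p.1 * M.e p.2 :=
    (Measure.quasiMeasurePreserving_snd.ae (hac hle)).mono fun p hp => hp p.1
  have hGi : Integrable (Function.uncurry G) ((volume.restrict (Ioc 0 t)).prod τ') :=
    Integrable.mono' (Integrable.mul_prod hh (M.integrableOn_e t)) hGm hGle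
  have hswap := integral_integral_swap (f := fun r z => D.indicator (Function.uncurry G) (r, z))
    (hGi.indicator hDm)
  rw [intervalIntegral.integral_of_le ht]
  refine Eq.trans ?_ (hswap.trans ?_)
  · refine setIntegral_congr_fun measurableSet_Ioc fun r hr => ?_
    have hsub : M.time ⁻¹' Iic r ⊆ M.time ⁻¹' Iic t := preimage_mono (Iic_subset_Iic.2 hr.2)
    have e : ∀ z, D.indicator (Function.uncurry G) (r, z)
        = (M.time ⁻¹' Iic r).indicator (G r) z := fun z => rfl
    simp only [e]
    rw [integral_indicator (M.measurable_time measurableSet_Iic), hτ',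
      Measure.restrict_restrict (M.measurable_time measurableSet_Iic),
      inter_eq_self_of_subset_left hsub]
  · refine integral_congr_ae ?_
    filter_upwards [ae_restrict_of_ae M.time_nonneg,
      ae_restrict_mem (M.measurable_time measurableSet_Iic)] with z h0 h1
    have e : ∀ r, D.indicator (Function.uncurry G) (r, z)
        = (Ici (M.time z)).indicator (fun r => G r z) r := fun r => rfl
    simp only [e]
    rw [integral_indicator measurableSet_Ici, Measure.restrict_restrict measurableSet_Ici,
      intervalIntegral.integral_of_le h1]
    refine setIntegral_congr_set ?_
    refine (Filter.EventuallyEq.inter (Ioi_ae_eq_Ici (μ := volume) (a := M.time z)).symm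
      (ae_eq_refl _)).trans ?_
    have hset : Ioi (M.time z) ∩ Ioc 0 t = Ioc (M.time z) t :=
      Set.ext fun r => ⟨fun h => ⟨h.1, h.2.2⟩, fun h => ⟨h.1, h0.trans_lt h.1, h.2⟩⟩
    rw [hset]
    exact ae_eq_refl _

section Mollified

variable (b : ContDiffBump (0 : Eucl n))

theorem continuous_jac_moll_right (a : L2 n) (i j : Fin n) :
    Continuous fun x => jac (moll b a) x i j :=
  continuous_jac ((contDiff_moll b (L2_locallyIntegrable a)).of_le (by simp)) i j

theorem upto_moll_tendsto (t : ℝ) {a : ℕ → L2 n} {c : L2 n} (ha : Tendsto a atTop (𝓝 c)) :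
    Tendsto (fun k => M.upto t (jac (moll b (a k)))) atTop (𝓝 (M.upto t (jac (moll b c)))) := by
  rw [tendsto_iff_norm_sub_tendsto_zero]
  have hb := gradConst_nonneg b
  set I := ∫ z in M.time ⁻¹' Iic t, M.e z ∂M.τ
  have hle : ∀ k, ‖M.upto t (jac (moll b (a k))) - M.upto t (jac (moll b c))‖
      ≤ n * n * (gradConst b * ‖a k - c‖) * I := by
    intro k
    rw [upto, upto, ← integral_sub
      (M.integrableOn_contract (continuous_jac_moll_right b _) (abs_jac_moll_le b _) t)
      (M.integrableOn_contract (continuous_jac_moll_right b _) (abs_jac_moll_le b _) t),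
      ← integral_const_mul]
    refine norm_integral_le_of_norm_le ((M.integrableOn_e t).const_mul _) ?_
    filter_upwards [ae_restrict_of_ae M.bound] with z hz
    rw [contract_jac_moll, contract_jac_moll, ← inner_sub_right, ← contract_jac_moll]
    exact abs_contract_le (abs_jac_moll_le b _ _) hz
  refine squeeze_zero (fun k => norm_nonneg _) hle ?_
  have h1 : Tendsto (fun k => ‖a k - c‖) atTop (𝓝 0) := tendsto_iff_norm_sub_tendsto_zero.1 ha
  simpa using ((h1.const_mul (gradConst b)).const_mul ((n : ℝ) * n)).mul_const I

/-- The time integral of the stresses against the gradients of a mollified field `g` is the stress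
against the gradients of its primitives. -/
theorem integral_upto_moll {t : ℝ} (ht : 0 ≤ t) {g : ℝ → L2 n}
    (hg : IntervalIntegrable g volume 0 t) :
    ∫ r in (0 : ℝ)..t, M.upto r (jac (moll b (g r)))
      = ∫ z in M.time ⁻¹' Iic t,
          contract (jac (moll b (∫ r in M.time z..t, g r : L2 n)) (M.pos z)) (M.Θ z) ∂M.τ := by
  have := M.sfinite
  have hg' : IntegrableOn g (Ioc 0 t) := (intervalIntegrable_iff_integrableOn_Ioc_of_le ht).1 hg
  simp only [upto]
  rw [M.integral_upto_eq ht (h := fun r => n * n * (gradConst b * ‖g r‖))]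
  · refine integral_congr_ae ?_
    filter_upwards [ae_restrict_of_ae M.time_nonneg,
      ae_restrict_mem (M.measurable_time measurableSet_Iic)] with z h0 h1
    simp only [contract_jac_moll]
    rw [inner_intervalIntegral]
    exact hg.mono_set (uIcc_subset_uIcc (mem_uIcc_of_le h0 h1) right_mem_uIcc)
  · have hgm : AEStronglyMeasurable (fun p : ℝ × Z => (g p.1, M.pos p.2))
        ((volume.restrict (Ioc 0 t)).prod M.τ) :=
      hg'.1.comp_fst.prodMk (M.measurable_pos.comp measurable_snd).aestronglyMeasurable
    unfold contract
    exact Finset.aestronglyMeasurable_fun_sum _ fun i _ =>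
      Finset.aestronglyMeasurable_fun_sum _ fun j _ =>
        ((continuous_jac_moll b i j).comp_aestronglyMeasurable hgm).mul (M.meas i j).comp_snd
  · exact (hg'.norm.const_mul _).const_mul _
  · filter_upwards [M.bound] with z hz r
    exact abs_contract_le (abs_jac_moll_le b _ _) hz

end Mollified

end StressMeasure

/-! ### The stresses of a generalized Young measure -/

section General

/-- Averages over a measurable family of measures are measurable. -/
theorem aestronglyMeasurable_integral_family {α X : Type*} [MeasurableSpace α] [MeasurableSpace X]
    {μ : Measure α} {m : α → Measure X} (hm : AEMeasurable m μ) {f : X → ℝ} (hf : Measurable f)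
    (hi : ∀ᵐ z ∂μ, Integrable f (m z)) : AEStronglyMeasurable (fun z => ∫ ξ, f ξ ∂(m z)) μ := by
  have h1 := (Measure.measurable_lintegral hf.ennreal_ofReal).comp_aemeasurable hm
  have h2 := (Measure.measurable_lintegral hf.neg.ennreal_ofReal).comp_aemeasurable hm
  refine (h1.ennreal_toReal.sub h2.ennreal_toReal).aestronglyMeasurable.congr ?_
  filter_upwards [hi] with z hz
  rw [integral_eq_lintegral_pos_part_sub_lintegral_neg_part hz]
  rfl

/-- Comparison of measures on the line by means of compactly supported continuous functions. -/
theorem measure_le_of_lintegral_le {μ ν : Measure ℝ} [IsLocallyFiniteMeasure ν]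
    (h : ∀ f : ℝ → ℝ, Continuous f → HasCompactSupport f → (∀ x, 0 ≤ f x) →
      ∫⁻ x, ENNReal.ofReal (f x) ∂μ ≤ ∫⁻ x, ENNReal.ofReal (f x) ∂ν) : μ ≤ ν := by
  have hopen : ∀ K U : Set ℝ, IsCompact K → IsOpen U → K ⊆ U → μ K ≤ ν U := by
    intro K U hK hU hKU
    obtain ⟨f, hf1, hf2, hf3, hf4⟩ := exists_continuousMap_one_of_isCompact_subset_isOpen hK hU hKU
    calc μ K = ∫⁻ x, K.indicator 1 x ∂μ := (lintegral_indicator_one hK.measurableSet).symm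
      _ ≤ ∫⁻ x, ENNReal.ofReal (f x) ∂μ := by
        refine lintegral_mono fun x => ?_
        by_cases hx : x ∈ K
        · simp [hx, hf1 hx]
        · simp [hx]
      _ ≤ ∫⁻ x, ENNReal.ofReal (f x) ∂ν := h f f.continuous hf2 fun x => (hf4 x).1
      _ ≤ ∫⁻ x, U.indicator 1 x ∂ν := by
        refine lintegral_mono fun x => ?_
        by_cases hx : x ∈ tsupport f
        · simpa [hf3 hx] using (hf4 x).2
        · simp [image_eq_zero_of_notMem_tsupport hx]
      _ = ν U := lintegral_indicator_one hU.measurableSet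
  have hfin : IsLocallyFiniteMeasure μ := by
    refine ⟨fun x => ⟨Metric.closedBall x 1, Metric.closedBall_mem_nhds x one_pos, ?_⟩⟩
    refine (hopen _ (Metric.ball x 2) (isCompact_closedBall x 1) Metric.isOpen_ball
      (Metric.closedBall_subset_ball (by norm_num))).trans_lt measure_ball_lt_top
  refine Measure.le_iff.2 fun B _ => ?_
  rw [B.measure_eq_iInf_isOpen ν]
  refine le_iInf₂ fun U hBU => le_iInf fun hU => (measure_mono hBU).trans ?_
  rw [hU.measure_eq_iSup_isCompact μ]
  exact iSup₂_le fun K hKU => iSup_le fun hK => hopen K U hK hU hKU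

end General

section Moments

variable {n : ℕ} {m : Measure (Eucl n)}

theorem memLp_id_of_moment (hi : Integrable (fun ξ => ‖ξ‖ ^ 2) m) :
    MemLp (fun ξ : Eucl n => ξ) 2 m :=
  (memLp_two_iff_integrable_sq_norm aestronglyMeasurable_id).2 hi

theorem integrable_coord_mul (hi : Integrable (fun ξ => ‖ξ‖ ^ 2) m) (i j : Fin n) :
    Integrable (fun ξ : Eucl n => ξ i * ξ j) m := by
  refine hi.mono' (by fun_prop) (Eventually.of_forall fun ξ => ?_)
  rw [norm_mul, sq]
  exact mul_le_mul (abs_coord_le ξ i) (abs_coord_le ξ j) (norm_nonneg _) (norm_nonneg _)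

theorem abs_second_moment_le (hi : Integrable (fun ξ => ‖ξ‖ ^ 2) m) (i j : Fin n) :
    |∫ ξ : Eucl n, ξ i * ξ j ∂m| ≤ ∫ ξ, ‖ξ‖ ^ 2 ∂m := by
  rw [← Real.norm_eq_abs]
  refine norm_integral_le_of_norm_le hi (Eventually.of_forall fun ξ => ?_)
  rw [norm_mul, sq]
  exact mul_le_mul (abs_coord_le ξ i) (abs_coord_le ξ j) (norm_nonneg _) (norm_nonneg _)

/-- Jensen's inequality for a quadratic form bounded below by `-κ |ξ|²`. -/
theorem contract_second_moment_ge [IsProbabilityMeasure m] (hi : Integrable (fun ξ => ‖ξ‖ ^ 2) m)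
    (L : Eucl n →L[ℝ] Eucl n) {κ : ℝ} (hL : ∀ ξ, - κ * ‖ξ‖ ^ 2 ≤ ⟪L ξ, ξ⟫) :
    ⟪L (∫ ξ, ξ ∂m), ∫ ξ, ξ ∂m⟫ + κ * ‖∫ ξ, ξ ∂m‖ ^ 2 - κ * ∫ ξ, ‖ξ‖ ^ 2 ∂m
      ≤ contract (fun i j => (L (EuclideanSpace.single j 1)) i)
        (fun i j => ∫ ξ : Eucl n, ξ i * ξ j ∂m) := by
  have hid := memLp_id_of_moment hi
  have h1 : Integrable (fun ξ : Eucl n => ξ) m := hid.integrable (by norm_num)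
  set β := ∫ ξ, ξ ∂m with hβ
  have hq : Integrable (fun ξ : Eucl n => ⟪L ξ, ξ⟫) m := by
    refine (hi.const_mul ‖L‖).mono' (by fun_prop) (Eventually.of_forall fun ξ => ?_)
    refine (abs_real_inner_le_norm _ _).trans ?_
    rw [sq, ← mul_assoc]
    gcongr
    exact L.le_opNorm ξ
  have hc : contract (fun i j => (L (EuclideanSpace.single j 1)) i)
      (fun i j => ∫ ξ : Eucl n, ξ i * ξ j ∂m) = ∫ ξ, ⟪L ξ, ξ⟫ ∂m := by
    simp_rw [← contract_eq_inner]
    unfold contract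
    rw [integral_finsetSum _ fun i _ => integrable_finsetSum _ fun j _ =>
      (integrable_coord_mul hi i j).const_mul _]
    refine Finset.sum_congr rfl fun i _ => ?_
    rw [integral_finsetSum _ fun j _ => (integrable_coord_mul hi i j).const_mul _]
    exact Finset.sum_congr rfl fun j _ => (integral_const_mul _ _).symm
  have hl1 : ∫ ξ, ⟪L ξ, β⟫ ∂m = ⟪L β, β⟫ := by
    have := ((innerSL ℝ β).comp L).integral_comp_comm h1
    simp only [ContinuousLinearMap.coe_comp, Function.comp_apply, innerSL_apply_apply] at this
    simp_rw [real_inner_comm β]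
    exact this
  have hl2 : ∫ ξ, ⟪L β, ξ⟫ ∂m = ⟪L β, β⟫ := (innerSL ℝ (L β)).integral_comp_comm h1
  have hl3 : ∫ ξ, ⟪β, ξ⟫ ∂m = ⟪β, β⟫ := (innerSL ℝ β).integral_comp_comm h1
  have i1 : Integrable (fun ξ : Eucl n => ⟪L ξ, β⟫) m := by
    have := ((innerSL ℝ β).comp L).integrable_comp h1
    simp_rw [real_inner_comm β]
    exact this
  have i2 : Integrable (fun ξ : Eucl n => ⟪L β, ξ⟫) m := (innerSL ℝ (L β)).integrable_comp h1
  have i3 : Integrable (fun ξ : Eucl n => ⟪β, ξ⟫) m := (innerSL ℝ β).integrable_comp h1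
  -- `L + κ` is a nonnegative form; integrate its value at the deviation from the mean `β`
  have hpos : 0 ≤ ∫ ξ, ((⟪L ξ, ξ⟫ - ⟪L ξ, β⟫) - (⟪L β, ξ⟫ - ⟪L β, β⟫)
      + κ * ((‖ξ‖ ^ 2 - 2 * ⟪β, ξ⟫) + ‖β‖ ^ 2)) ∂m := by
    refine integral_nonneg fun ξ => ?_
    have h := hL (ξ - β)
    rw [map_sub, inner_sub_left, inner_sub_right, inner_sub_right, norm_sub_sq_real,
      real_inner_comm] at h
    simp only [Pi.zero_apply]
    linarith
  have j1 : Integrable (fun ξ : Eucl n => ⟪L ξ, ξ⟫ - ⟪L ξ, β⟫) m := hq.sub i1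
  have j2 : Integrable (fun ξ : Eucl n => ⟪L β, ξ⟫ - ⟪L β, β⟫) m := i2.sub (integrable_const _)
  have j3 : Integrable (fun ξ : Eucl n => 2 * ⟪β, ξ⟫) m := i3.const_mul 2
  have j4 : Integrable (fun ξ : Eucl n => ‖ξ‖ ^ 2 - 2 * ⟪β, ξ⟫) m := hi.sub j3
  have j5 : Integrable (fun ξ : Eucl n => ‖ξ‖ ^ 2 - 2 * ⟪β, ξ⟫ + ‖β‖ ^ 2) m :=
    j4.add (integrable_const _)
  have j6 : Integrable (fun ξ : Eucl n => (⟪L ξ, ξ⟫ - ⟪L ξ, β⟫) - (⟪L β, ξ⟫ - ⟪L β, β⟫)) m :=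
    j1.sub j2
  rw [integral_add j6 (j5.const_mul κ), integral_sub j1 j2, integral_sub hq i1,
    integral_sub i2 (integrable_const _), integral_const_mul,
    integral_add j4 (integrable_const _), integral_sub hi j3, integral_const_mul, hl1, hl2, hl3,
    integral_const, integral_const, real_inner_self_eq_norm_sq] at hpos
  simp only [probReal_univ, one_smul] at hpos
  rw [hc]
  linarith

theorem norm_sq_mean_le [IsProbabilityMeasure m] (hi : Integrable (fun ξ => ‖ξ‖ ^ 2) m) :
    ‖∫ ξ, ξ ∂m‖ ^ 2 ≤ ∫ ξ : Eucl n, ‖ξ‖ ^ 2 ∂m := by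
  have h := contract_second_moment_ge hi 0 (κ := 1) (fun ξ => by simp)
  simp [contract] at h
  linarith

end Moments

section Sphere

variable {n : ℕ} {m : Measure (Metric.sphere (0 : Eucl n) 1)} [IsProbabilityMeasure m]

theorem integrable_sphere_mul (i j : Fin n) :
    Integrable (fun θ : Metric.sphere (0 : Eucl n) 1 => (θ : Eucl n) i * (θ : Eucl n) j) m := by
  refine Integrable.of_bound (by fun_prop) 1 (Eventually.of_forall fun θ => ?_)
  have h : ∀ k, ‖(θ : Eucl n) k‖ ≤ 1 := fun k => (abs_coord_le _ k).trans_eq (by simp)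
  rw [norm_mul]
  exact mul_le_one₀ (h i) (norm_nonneg _) (h j)

theorem abs_sphere_moment_le (i j : Fin n) :
    |∫ θ : Metric.sphere (0 : Eucl n) 1, (θ : Eucl n) i * (θ : Eucl n) j ∂m| ≤ 1 := by
  have h1 : ∫ θ : Metric.sphere (0 : Eucl n) 1, (1 : ℝ) ∂m = 1 := by simp
  rw [← Real.norm_eq_abs]
  refine (norm_integral_le_of_norm_le (integrable_const (1 : ℝ)) ?_).trans_eq h1
  refine Eventually.of_forall fun θ => ?_
  have h : ∀ k, ‖(θ : Eucl n) k‖ ≤ 1 := fun k => (abs_coord_le _ k).trans_eq (by simp)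
  rw [norm_mul]
  exact mul_le_one₀ (h i) (norm_nonneg _) (h j)

/-- The lower bound for a quadratic form, averaged over the unit sphere. -/
theorem contract_sphere_moment_ge (L : Eucl n →L[ℝ] Eucl n) {κ : ℝ}
    (hL : ∀ ξ, - κ * ‖ξ‖ ^ 2 ≤ ⟪L ξ, ξ⟫) :
    - κ ≤ contract (fun i j => (L (EuclideanSpace.single j 1)) i)
      (fun i j => ∫ θ : Metric.sphere (0 : Eucl n) 1, (θ : Eucl n) i * (θ : Eucl n) j ∂m) := by
  have hi := integrable_sphere_mul (m := m)
  have hc : contract (fun i j => (L (EuclideanSpace.single j 1)) i)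
      (fun i j => ∫ θ : Metric.sphere (0 : Eucl n) 1, (θ : Eucl n) i * (θ : Eucl n) j ∂m)
      = ∫ θ : Metric.sphere (0 : Eucl n) 1, ⟪L θ, (θ : Eucl n)⟫ ∂m := by
    simp_rw [← contract_eq_inner]
    unfold contract
    rw [integral_finsetSum _ fun i _ => integrable_finsetSum _ fun j _ => (hi i j).const_mul _]
    refine Finset.sum_congr rfl fun i _ => ?_
    rw [integral_finsetSum _ fun j _ => (hi i j).const_mul _]
    exact Finset.sum_congr rfl fun j _ => (integral_const_mul _ _).symm
  have hint : Integrable (fun θ : Metric.sphere (0 : Eucl n) 1 => ⟪L θ, (θ : Eucl n)⟫) m := by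
    simp_rw [← contract_eq_inner]
    unfold contract
    exact integrable_finsetSum _ fun i _ => integrable_finsetSum _ fun j _ => (hi i j).const_mul _
  rw [hc]
  have : ∫ θ : Metric.sphere (0 : Eucl n) 1, (-κ) ∂m = -κ := by simp
  rw [← this]
  refine integral_mono (integrable_const _) hint fun θ => ?_
  have := hL θ
  simpa using this

end Sphere

theorem measurableEmbedding_inl {α β : Type*} [MeasurableSpace α] [MeasurableSpace β] :
    MeasurableEmbedding (Sum.inl : α → α ⊕ β) :=
  ⟨Sum.inl_injective, measurable_inl, fun _ hs => hs.inl_image⟩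

theorem measurableEmbedding_inr {α β : Type*} [MeasurableSpace α] [MeasurableSpace β] :
    MeasurableEmbedding (Sum.inr : β → α ⊕ β) :=
  ⟨Sum.inr_injective, measurable_inr, fun _ hs => hs.inr_image⟩

theorem spaceTime_eq_prod (n : ℕ) :
    spaceTime n = (volume.restrict (Ici (0 : ℝ))).prod (volume : Measure (Eucl n)) :=
  restrict_slab _

namespace GeneralizedYoungMeasure

variable {n : ℕ} (Y : GeneralizedYoungMeasure n)

/-- The second moment `⟨ν_{t,x}, |ξ|²⟩`. -/
noncomputable def energyDensity (z : ℝ × Eucl n) : ℝ := ∫ ξ, ‖ξ‖ ^ 2 ∂(Y.osc z)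

theorem energyDensity_nonneg (z : ℝ × Eucl n) : 0 ≤ Y.energyDensity z :=
  integral_nonneg fun _ => by positivity

theorem aemeasurable_lintegral_osc :
    AEMeasurable (fun z => ∫⁻ ξ, ‖ξ‖ₑ ^ 2 ∂(Y.osc z)) (spaceTime n) :=
  (Measure.measurable_lintegral (f := fun ξ : Eucl n => ‖ξ‖ₑ ^ 2) (by fun_prop)).comp_aemeasurable
    Y.osc_meas

/-- Almost every `ν_{t,x}` has a finite second moment. -/
theorem ae_integrable_sq :
    ∀ᵐ z ∂(spaceTime n), Integrable (fun ξ => ‖ξ‖ ^ 2) (Y.osc z) := by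
  have h : ∀ᵐ z ∂(spaceTime n), ∀ k : ℕ, z ∈ Metric.closedBall (0 : ℝ × Eucl n) k →
      ∫⁻ ξ, ‖ξ‖ₑ ^ 2 ∂(Y.osc z) < ⊤ := by
    rw [ae_all_iff]
    intro k
    rw [← ae_restrict_iff' Metric.isClosed_closedBall.measurableSet]
    exact ae_lt_top' Y.aemeasurable_lintegral_osc.restrict
      (Y.osc_moment _ (isCompact_closedBall _ _)).ne
  filter_upwards [h] with z hz
  obtain ⟨k, hk⟩ := exists_nat_ge ‖z‖
  refine ⟨by fun_prop, ?_⟩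
  have := hz k (by simpa using hk)
  simpa [HasFiniteIntegral] using this

theorem aestronglyMeasurable_osc {f : Eucl n → ℝ} (hf : Continuous f) {C : ℝ}
    (hC : ∀ ξ, |f ξ| ≤ C * (1 + ‖ξ‖ ^ 2)) :
    AEStronglyMeasurable (fun z => ∫ ξ, f ξ ∂(Y.osc z)) (spaceTime n) := by
  refine aestronglyMeasurable_integral_family Y.osc_meas hf.measurable ?_
  filter_upwards [Y.ae_integrable_sq, Y.osc_prob] with z hz hp
  exact (((integrable_const (1 : ℝ)).add hz).const_mul C).mono' hf.aestronglyMeasurable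
    (Eventually.of_forall hC)

theorem aestronglyMeasurable_energyDensity :
    AEStronglyMeasurable Y.energyDensity (spaceTime n) :=
  Y.aestronglyMeasurable_osc (by fun_prop) (C := 1) fun ξ => by
    rw [abs_of_nonneg (by positivity)]
    linarith

theorem aestronglyMeasurable_oscMoment (i j : Fin n) :
    AEStronglyMeasurable (fun z => Y.oscMoment z i j) (spaceTime n) :=
  Y.aestronglyMeasurable_osc (f := fun ξ => ξ i * ξ j) (by fun_prop) (C := 1) fun ξ => by
    rw [abs_mul]
    nlinarith [abs_coord_le ξ i, abs_coord_le ξ j, abs_nonneg (ξ i), abs_nonneg (ξ j)]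

theorem aestronglyMeasurable_barycenter :
    AEStronglyMeasurable Y.barycenter (spaceTime n) := by
  refine aestronglyMeasurable_of_inner fun g => ?_
  refine (Y.aestronglyMeasurable_osc (f := fun ξ => ⟪g, ξ⟫) (by fun_prop) (C := ‖g‖)
    fun ξ => ?_).congr ?_
  · refine (abs_real_inner_le_norm _ _).trans ?_
    gcongr
    nlinarith [sq_nonneg (‖ξ‖ - 1), norm_nonneg ξ]
  · filter_upwards [Y.ae_integrable_sq, Y.osc_prob] with z hz hp
    exact (innerSL ℝ g).integral_comp_comm ((memLp_id_of_moment hz).integrable (by norm_num))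

theorem ae_norm_sq_barycenter_le :
    ∀ᵐ z ∂(spaceTime n), ‖Y.barycenter z‖ ^ 2 ≤ Y.energyDensity z := by
  filter_upwards [Y.ae_integrable_sq, Y.osc_prob] with z hz hp
  exact norm_sq_mean_le hz

theorem ae_abs_oscMoment_le :
    ∀ᵐ z ∂(spaceTime n), ∀ i j, |Y.oscMoment z i j| ≤ Y.energyDensity z := by
  filter_upwards [Y.ae_integrable_sq, Y.osc_prob] with z hz hp i j
  exact abs_second_moment_le hz i j

theorem aestronglyMeasurable_angleMoment (i j : Fin n) :
    AEStronglyMeasurable (fun z => Y.angleMoment z i j) Y.conc := by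
  refine aestronglyMeasurable_integral_family Y.angle_meas
    (f := fun θ : Metric.sphere (0 : Eucl n) 1 => (θ : Eucl n) i * (θ : Eucl n) j)
    (Continuous.measurable (by fun_prop)) ?_
  filter_upwards [Y.angle_prob] with z hz
  exact integrable_sphere_mul i j

theorem ae_abs_angleMoment_le : ∀ᵐ z ∂Y.conc, ∀ i j, |Y.angleMoment z i j| ≤ 1 := by
  filter_upwards [Y.angle_prob] with z hz i j
  exact abs_sphere_moment_le i j

/-- The reference measure for the oscillations and the concentrations, on two copies of
space-time. -/
noncomputable def reference : Measure ((ℝ × Eucl n) ⊕ (ℝ × Eucl n)) :=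
  (spaceTime n).map Sum.inl + Y.conc.map Sum.inr

theorem ae_reference_iff {p : (ℝ × Eucl n) ⊕ (ℝ × Eucl n) → Prop} :
    (∀ᵐ z ∂Y.reference, p z) ↔
      (∀ᵐ z ∂(spaceTime n), p (Sum.inl z)) ∧ ∀ᵐ z ∂Y.conc, p (Sum.inr z) := by
  rw [reference, ae_add_measure_iff, measurableEmbedding_inl.ae_map_iff,
    measurableEmbedding_inr.ae_map_iff]

theorem aestronglyMeasurable_reference_iff {f : (ℝ × Eucl n) ⊕ (ℝ × Eucl n) → ℝ} :
    AEStronglyMeasurable f Y.reference ↔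
      AEStronglyMeasurable (fun z => f (Sum.inl z)) (spaceTime n) ∧
        AEStronglyMeasurable (fun z => f (Sum.inr z)) Y.conc := by
  rw [reference, aestronglyMeasurable_add_measure_iff,
    measurableEmbedding_inl.aestronglyMeasurable_map_iff,
    measurableEmbedding_inr.aestronglyMeasurable_map_iff]
  rfl

theorem integral_reference {f : (ℝ × Eucl n) ⊕ (ℝ × Eucl n) → ℝ} (hf : Integrable f Y.reference) :
    ∫ z, f z ∂Y.reference = ∫ z, f (Sum.inl z) ∂(spaceTime n) + ∫ z, f (Sum.inr z) ∂Y.conc := by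
  rw [reference] at hf ⊢
  rw [integral_add_measure hf.left_of_add_measure hf.right_of_add_measure,
    measurableEmbedding_inl.integral_map, measurableEmbedding_inr.integral_map]

theorem lintegral_reference (f : (ℝ × Eucl n) ⊕ (ℝ × Eucl n) → ENNReal) :
    ∫⁻ z, f z ∂Y.reference
      = ∫⁻ z, f (Sum.inl z) ∂(spaceTime n) + ∫⁻ z, f (Sum.inr z) ∂Y.conc := by
  rw [reference, lintegral_add_measure, measurableEmbedding_inl.lintegral_map,
    measurableEmbedding_inr.lintegral_map]

/-- The density of the total energy with respect to the reference measure. -/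
noncomputable def totalDensity : (ℝ × Eucl n) ⊕ (ℝ × Eucl n) → ℝ :=
  Sum.elim Y.energyDensity fun _ => 1

theorem totalDensity_nonneg (z : (ℝ × Eucl n) ⊕ (ℝ × Eucl n)) : 0 ≤ Y.totalDensity z := by
  rcases z with z | z
  · exact Y.energyDensity_nonneg z
  · exact zero_le_one

theorem aestronglyMeasurable_totalDensity : AEStronglyMeasurable Y.totalDensity Y.reference :=
  Y.aestronglyMeasurable_reference_iff.2
    ⟨Y.aestronglyMeasurable_energyDensity, aestronglyMeasurable_const⟩

/-- The point of space-time below a point of one of the two copies. -/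
def base (z : (ℝ × Eucl n) ⊕ (ℝ × Eucl n)) : ℝ × Eucl n := Sum.elim id id z

theorem measurable_base : Measurable (base (n := n)) :=
  measurable_fun_sum measurable_id measurable_id

variable {Y} {v₀ : L2 n}

theorem integral_norm_sq_eq (v : L2 n) : ∫ x, ‖v x‖ ^ 2 = ‖v‖ ^ 2 := by
  rw [← real_inner_self_eq_norm_sq, L2.inner_def]
  simp_rw [real_inner_self_eq_norm_sq]

/-- Local integrability of the energy density, which makes the first integral in the energy inequality
meaningful. -/
theorem integrable_mul_energyDensity {f : ℝ × Eucl n → ℝ} (hf : Continuous f)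
    (hc : HasCompactSupport f) : Integrable (fun z => f z * Y.energyDensity z) (spaceTime n) := by
  obtain ⟨C, hC⟩ := hf.bounded_above_of_compact_support hc
  have h1 : IntegrableOn Y.energyDensity (tsupport f) (spaceTime n) := by
    refine ⟨Y.aestronglyMeasurable_energyDensity.restrict, ?_⟩
    rw [hasFiniteIntegral_iff_ofReal (Eventually.of_forall Y.energyDensity_nonneg)]
    refine lt_of_le_of_lt (lintegral_mono_ae ?_) (Y.osc_moment _ hc.isCompact)
    filter_upwards [ae_restrict_of_ae Y.ae_integrable_sq] with z hz
    rw [energyDensity, ofReal_integral_eq_lintegral_ofReal hz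
      (Eventually.of_forall fun ξ => by positivity)]
    refine lintegral_mono fun ξ => ?_
    rw [ENNReal.ofReal_pow (norm_nonneg _), ofReal_norm]
  have h2 : IntegrableOn (fun z => f z * Y.energyDensity z) (tsupport f) (spaceTime n) :=
    h1.bdd_mul hf.aestronglyMeasurable.restrict (Eventually.of_forall hC)
  rw [← integrableOn_univ]
  refine h2.of_forall_sdiff_eq_zero MeasurableSet.univ fun z hz => ?_
  rw [image_eq_zero_of_notMem_tsupport hz.2, zero_mul]

/-- The energy inequality for the total density, localised in space. -/
theorem lintegral_energy_le (hY : Y.IsAdmissible v₀) {φ : Eucl n → ℝ} {χ : ℝ → ℝ}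
    (hφ : Continuous φ) (hφc : HasCompactSupport φ) (hφ0 : ∀ x, 0 ≤ φ x) (hφ1 : ∀ x, φ x ≤ 1)
    (hχ : Continuous χ) (hχc : HasCompactSupport χ) (hχ0 : ∀ t, 0 ≤ χ t) :
    ∫⁻ z, ENNReal.ofReal (φ (base z).2 * χ (base z).1 * Y.totalDensity z) ∂Y.reference
      ≤ ENNReal.ofReal (‖v₀‖ ^ 2) * ∫⁻ t in Ici 0, ENNReal.ofReal (χ t) := by
  have := Y.conc_radon
  have hf : Continuous fun z : ℝ × Eucl n => φ z.2 * χ z.1 := by fun_prop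
  have hc : HasCompactSupport fun z : ℝ × Eucl n => φ z.2 * χ z.1 := by
    refine (hχc.isCompact.prod hφc.isCompact).of_isClosed_subset (isClosed_tsupport _)
      (closure_minimal (fun z hz => ?_) ((isClosed_tsupport χ).prod (isClosed_tsupport φ)))
    rw [Function.mem_support] at hz
    exact ⟨subset_closure (right_ne_zero_of_mul hz), subset_closure (left_ne_zero_of_mul hz)⟩
  have hpos : ∀ z : ℝ × Eucl n, 0 ≤ φ z.2 * χ z.1 := fun z => mul_nonneg (hφ0 _) (hχ0 _)
  have hχi : IntegrableOn χ (Ici 0) := (hχ.integrable_of_hasCompactSupport hχc).integrableOn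
  have hci : Integrable (fun z : ℝ × Eucl n => φ z.2 * χ z.1) Y.conc :=
    hf.integrable_of_hasCompactSupport hc
  rw [lintegral_reference]
  have e1 : ∫⁻ z, ENNReal.ofReal (φ (base (n := n) (Sum.inl z)).2 * χ (base (n := n) (Sum.inl z)).1
      * Y.totalDensity (Sum.inl z)) ∂(spaceTime n)
      = ENNReal.ofReal (∫ z, φ z.2 * χ z.1 * Y.energyDensity z ∂(spaceTime n)) :=
    (ofReal_integral_eq_lintegral_ofReal (integrable_mul_energyDensity hf hc)
      (Eventually.of_forall fun z => mul_nonneg (hpos z) (Y.energyDensity_nonneg z))).symm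
  have e2 : ∫⁻ z, ENNReal.ofReal (φ (base (n := n) (Sum.inr z)).2 * χ (base (n := n) (Sum.inr z)).1
      * Y.totalDensity (Sum.inr z)) ∂Y.conc = ENNReal.ofReal (∫ z, φ z.2 * χ z.1 ∂Y.conc) := by
    rw [ofReal_integral_eq_lintegral_ofReal hci (Eventually.of_forall hpos)]
    refine lintegral_congr fun z => ?_
    change ENNReal.ofReal (φ z.2 * χ z.1 * 1) = _
    rw [mul_one]
  rw [e1, e2, ← ENNReal.ofReal_add (integral_nonneg fun z =>
      mul_nonneg (hpos z) (Y.energyDensity_nonneg z)) (integral_nonneg hpos),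
    ← ofReal_integral_eq_lintegral_ofReal hχi (Eventually.of_forall hχ0),
    ← ENNReal.ofReal_mul (by positivity)]
  refine ENNReal.ofReal_le_ofReal ((hY.energy φ χ hφ hφc hχ hχc).trans ?_)
  have hsup : ⨆ x, |φ x| ≤ 1 := Real.iSup_le (fun x => by
    rw [abs_of_nonneg (hφ0 x)]
    exact hφ1 x) zero_le_one
  simp_rw [abs_of_nonneg (hχ0 _)]
  rw [integral_norm_sq_eq, mul_comm]
  have : 0 ≤ ∫ t in Ici 0, χ t := integral_nonneg hχ0
  refine mul_le_mul_of_nonneg_left ?_ (by positivity)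
  exact (mul_le_mul_of_nonneg_right hsup this).trans_eq (one_mul _)

/-- The time marginal of the total energy is bounded by the initial energy. -/
theorem energy_marginal_le (hY : Y.IsAdmissible v₀) {B : Set ℝ} (hB : MeasurableSet B) :
    ∫⁻ z in (fun z => (base z).1) ⁻¹' B, ENNReal.ofReal (Y.totalDensity z) ∂Y.reference
      ≤ ENNReal.ofReal (‖v₀‖ ^ 2) * volume (B ∩ Ici 0) := by
  have hm : Measurable fun z => (base (n := n) z).1 := measurable_fst.comp measurable_base
  have hem : AEMeasurable (fun z => ENNReal.ofReal (Y.totalDensity z)) Y.reference :=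
    Y.aestronglyMeasurable_totalDensity.aemeasurable.ennreal_ofReal
  set μ := (Y.reference.withDensity fun z => ENNReal.ofReal (Y.totalDensity z)).map
    fun z => (base z).1 with hμ
  have hle : μ ≤ (‖v₀‖ ^ 2).toNNReal • volume.restrict (Ici 0) := by
    refine measure_le_of_lintegral_le fun χ hχ hχc hχ0 => ?_
    have h1 : ∫⁻ t, ENNReal.ofReal (χ t) ∂μ
        = ∫⁻ z, ENNReal.ofReal (χ (base z).1 * Y.totalDensity z) ∂Y.reference := by
      have h2 := lintegral_withDensity_eq_lintegral_mul₀' hem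
        (g := fun z => ENNReal.ofReal (χ (base z).1))
        (hχ.measurable.comp hm).ennreal_ofReal.aemeasurable
      rw [hμ, lintegral_map (by fun_prop) hm, h2]
      refine lintegral_congr fun z => ?_
      rw [Pi.mul_apply, mul_comm, ENNReal.ofReal_mul (hχ0 _)]
    rw [h1, lintegral_smul_measure]
    -- exhaust space by balls
    have hU : (⋃ k : ℕ, {z | ‖(base (n := n) z).2‖ ≤ k + 1}) = univ := by
      refine eq_univ_of_forall fun z => mem_iUnion.2 ?_
      obtain ⟨k, hk⟩ := exists_nat_ge ‖(base z).2‖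
      exact ⟨k, hk.trans (by linarith)⟩
    rw [← setLIntegral_univ, ← hU, setLIntegral_iUnion_of_directed]
    · refine iSup_le fun k => ?_
      obtain ⟨_, _, hcut⟩ := exists_cutoff n
      obtain ⟨φ, hφ, hφc, hφ0, hφ1, hφk, -⟩ := hcut (k + 1) (by positivity)
      refine le_trans ?_ (lintegral_energy_le hY hφ.continuous hφc hφ0 hφ1 hχ hχc hχ0)
      refine le_trans (setLIntegral_mono_ae' ?_ (Eventually.of_forall fun z hz => ?_))
        (setLIntegral_le_lintegral _ _)
      · exact measurableSet_le ((measurable_snd.comp measurable_base).norm) measurable_const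
      · rw [hφk _ hz, one_mul]
    · refine directed_of_isDirected_le fun k l hkl z hz => ?_
      have : (k : ℝ) ≤ l := by exact_mod_cast hkl
      have hz' : ‖(base z).2‖ ≤ k + 1 := hz
      exact hz'.trans (by linarith)
  have h := hle B
  rw [hμ, Measure.map_apply hm hB, withDensity_apply _ (hm hB)] at h
  refine h.trans_eq ?_
  rw [Measure.smul_apply, Measure.restrict_apply hB]
  rfl

/-- By the energy inequality the concentration measure does not charge null sets of times. -/
theorem quasiMeasurePreserving_base_time (hY : Y.IsAdmissible v₀) :
    Measure.QuasiMeasurePreserving (fun z => (base z).1) Y.reference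
      (volume.restrict (Ici 0)) := by
  have hm : Measurable fun z => (base (n := n) z).1 := measurable_fst.comp measurable_base
  refine ⟨hm, Measure.AbsolutelyContinuous.mk fun B hB h0 => ?_⟩
  rw [Measure.map_apply hm hB, ← ae_eq_empty, eventuallyEq_set]
  have h1 : ∀ᵐ z ∂(spaceTime n), z.1 ∉ B := by
    rw [spaceTime_eq_prod]
    refine Measure.quasiMeasurePreserving_fst.ae (p := fun t => t ∉ B) ?_
    rw [ae_iff]
    simpa using h0
  have h2 := energy_marginal_le hY hB
  rw [← Measure.restrict_apply hB, h0, mul_zero, nonpos_iff_eq_zero,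
    lintegral_eq_zero_iff' Y.aestronglyMeasurable_totalDensity.aemeasurable.ennreal_ofReal.restrict]
    at h2
  have h3 := (Y.ae_reference_iff.1 ((ae_restrict_iff' (hm hB)).1 h2)).2
  refine Y.ae_reference_iff.2 ⟨?_, ?_⟩
  · filter_upwards [h1] with z hz
    exact ⟨fun h => hz h, fun h => h.elim⟩
  · filter_upwards [h3] with z hz
    refine ⟨fun h => ?_, fun h => h.elim⟩
    have h4 : ENNReal.ofReal 1 = 0 := hz h
    simp at h4

variable (Y) in
/-- The oscillation and concentration stresses of an admissible solution. -/
noncomputable def stress (hY : Y.IsAdmissible v₀) :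
    StressMeasure n (‖v₀‖ ^ 2) ((ℝ × Eucl n) ⊕ (ℝ × Eucl n)) where
  τ := Y.reference
  time z := (base z).1
  pos z := (base z).2
  Θ := Sum.elim Y.oscMoment Y.angleMoment
  e := Y.totalDensity
  sfinite := by
    have := Y.conc_radon
    unfold reference spaceTime
    infer_instance
  measurable_time := measurable_fst.comp measurable_base
  time_qmp := quasiMeasurePreserving_base_time hY
  measurable_pos := measurable_snd.comp measurable_base
  meas i j := Y.aestronglyMeasurable_reference_iff.2
    ⟨Y.aestronglyMeasurable_oscMoment i j, Y.aestronglyMeasurable_angleMoment i j⟩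
  e_meas := Y.aestronglyMeasurable_totalDensity.aemeasurable
  bound := Y.ae_reference_iff.2 ⟨Y.ae_abs_oscMoment_le, Y.ae_abs_angleMoment_le⟩
  e_nonneg := Y.totalDensity_nonneg
  V_nonneg := by positivity
  marginal _ hB := energy_marginal_le hY hB

end GeneralizedYoungMeasure

/-! ### The momentum equation at fixed times -/

/-- Every test function on `(0, T)` is, at nonnegative times, the derivative of a test function on
the line, which need not vanish at time zero. -/
theorem exists_primitive_test {T : ℝ} (hT : 0 < T) {ψ : ℝ → ℝ} (hψ : ContDiff ℝ ∞ ψ)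
    (hs : tsupport ψ ⊆ Ioo 0 T) :
    ∃ χ : ℝ → ℝ, ContDiff ℝ ∞ χ ∧ HasCompactSupport χ ∧ (∀ t, 0 ≤ t → deriv χ t = ψ t) ∧
      (∀ t ∈ Icc 0 T, χ t = - ∫ r in t..T, ψ r) ∧ ∀ t, T ≤ t → χ t = 0 := by
  let θ : ContDiffBump (0 : ℝ) := ⟨T + 1, T + 2, by linarith, by linarith⟩
  have hψ0 : ∀ t, t ∉ Ioo 0 T → ψ t = 0 := fun t ht =>
    image_eq_zero_of_notMem_tsupport fun h => ht (hs h)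
  set Ψ : ℝ → ℝ := fun t => ∫ r in T..t, ψ r with hΨ
  have hder : ∀ t, HasDerivAt Ψ (ψ t) t := fun t =>
    hψ.continuous.integral_hasStrictDerivAt T t |>.hasDerivAt
  have hΨs : ContDiff ℝ ∞ Ψ := by
    rw [contDiff_infty_iff_deriv]
    refine ⟨fun t => (hder t).differentiableAt, ?_⟩
    rw [show deriv Ψ = ψ from funext fun t => (hder t).deriv]
    exact hψ
  have hΨ0 : ∀ t, T ≤ t → Ψ t = 0 := by
    intro t ht
    rw [hΨ]
    simp only
    rw [intervalIntegral.integral_zero_ae]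
    refine Eventually.of_forall fun r hr => hψ0 r fun h => ?_
    rw [uIoc_of_le ht] at hr
    exact absurd h.2 (not_lt.2 hr.1.le)
  have hθ1 : ∀ t, |t| ≤ T + 1 → θ t = 1 := fun t ht => by
    refine θ.one_of_mem_closedBall ?_
    rw [mem_closedBall_zero_iff]
    exact ht
  refine ⟨fun t => θ t * Ψ t, θ.contDiff.mul hΨs, θ.hasCompactSupport.mul_right, ?_, ?_, ?_⟩
  · intro t ht
    rcases lt_or_ge t (T + 1) with h | h
    · have he : (fun t => θ t * Ψ t) =ᶠ[𝓝 t] Ψ := by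
        filter_upwards [Ioo_mem_nhds (show -1 < t by linarith) h] with s hs
        rw [hθ1 s (abs_le.2 ⟨by linarith [hs.1], hs.2.le⟩), one_mul]
      rw [he.deriv_eq, (hder t).deriv]
    · have he : (fun t => θ t * Ψ t) =ᶠ[𝓝 t] fun _ => 0 := by
        filter_upwards [Ioi_mem_nhds (show T < t by linarith)] with s hs
        rw [hΨ0 s (le_of_lt hs), mul_zero]
      rw [he.deriv_eq, deriv_const, hψ0 t fun h' => by linarith [h'.2]]
  · intro t ht
    simp only
    rw [hθ1 t (abs_le.2 ⟨by linarith [ht.1], by linarith [ht.2]⟩), one_mul,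
      intervalIntegral.integral_symm, neg_neg]
  · intro t ht
    simp only
    rw [hΨ0 t ht, mul_zero]

namespace GeneralizedYoungMeasure

variable {n : ℕ} {Y : GeneralizedYoungMeasure n} {v₀ : L2 n}

/-- At almost every time the kinetic energy of the oscillations is at most the initial one. -/
theorem ae_lintegral_energy_le (hY : Y.IsAdmissible v₀) :
    ∀ᵐ t ∂(volume.restrict (Ici (0 : ℝ))),
      ∫⁻ x, ENNReal.ofReal (Y.energyDensity (t, x)) ≤ ENNReal.ofReal (‖v₀‖ ^ 2) := by
  have hm : AEMeasurable (fun z => ENNReal.ofReal (Y.energyDensity z))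
      ((volume.restrict (Ici (0 : ℝ))).prod volume) := by
    rw [← spaceTime_eq_prod]
    exact Y.aestronglyMeasurable_energyDensity.aemeasurable.ennreal_ofReal
  refine ae_le_of_forall_setLIntegral_le_of_sigmaFinite₀ hm.lintegral_prod_right' fun B hB _ => ?_
  rw [lintegral_const, Measure.restrict_apply_univ, Measure.restrict_apply hB]
  refine le_trans ?_ (energy_marginal_le hY hB)
  have e1 : ∫⁻ t in B, (∫⁻ x, ENNReal.ofReal (Y.energyDensity (t, x))) ∂(volume.restrict (Ici 0))
      = ∫⁻ z in Prod.fst ⁻¹' B, ENNReal.ofReal (Y.energyDensity z) ∂(spaceTime n) := by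
    rw [spaceTime_eq_prod]
    have h2 : ((volume.restrict (Ici (0 : ℝ))).prod (volume : Measure (Eucl n))).restrict
        (Prod.fst ⁻¹' B) = ((volume.restrict (Ici (0 : ℝ))).restrict B).prod volume := by
      rw [← prod_univ, ← Measure.prod_restrict, Measure.restrict_univ]
    rw [h2, lintegral_prod]
    rw [← h2]
    exact hm.restrict
  have hb : MeasurableSet ((fun z => (base (n := n) z).1) ⁻¹' B) :=
    (measurable_fst.comp measurable_base) hB
  rw [e1, ← lintegral_indicator hb, lintegral_reference,
    ← lintegral_indicator (measurable_fst hB)]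
  exact le_add_right le_rfl

/-- At almost every time the barycenter is square integrable, with norm at most that of the initial
velocity. -/
theorem ae_memLp_barycenter (hY : Y.IsAdmissible v₀) :
    ∀ᵐ t ∂(volume.restrict (Ici (0 : ℝ))),
      ∃ h : MemLp (fun x => Y.barycenter (t, x)) 2 volume, ‖h.toLp‖ ≤ ‖v₀‖ := by
  have hm := Y.aestronglyMeasurable_barycenter
  have hle := Y.ae_norm_sq_barycenter_le
  rw [spaceTime_eq_prod] at hm hle
  filter_upwards [ae_lintegral_energy_le hY, hm.prodMk_left, Measure.ae_ae_of_ae_prod hle]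
    with t h1 h2 h3
  have h4 : eLpNorm (fun x => Y.barycenter (t, x)) 2 volume ^ 2 ≤ ENNReal.ofReal (‖v₀‖ ^ 2) := by
    rw [eLpNorm_two_sq]
    refine le_trans (lintegral_mono_ae ?_) h1
    filter_upwards [h3] with x hx
    rw [← ofReal_norm, ← ENNReal.ofReal_pow (norm_nonneg _)]
    exact ENNReal.ofReal_le_ofReal hx
  have h5 : eLpNorm (fun x => Y.barycenter (t, x)) 2 volume ≤ ENNReal.ofReal ‖v₀‖ := by
    rw [ENNReal.ofReal_pow (norm_nonneg _)] at h4
    exact (ENNReal.pow_le_pow_left_iff two_ne_zero).1 h4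
  have hL : MemLp (fun x => Y.barycenter (t, x)) 2 volume :=
    ⟨h2, h5.trans_lt ENNReal.ofReal_lt_top⟩
  refine ⟨hL, ?_⟩
  rw [Lp.norm_toLp]
  exact ENNReal.toReal_le_of_le_ofReal (norm_nonneg _) h5

theorem reference_integrable_inl {f : (ℝ × Eucl n) ⊕ (ℝ × Eucl n) → ℝ}
    (hf : Integrable f Y.reference) : Integrable (fun z => f (Sum.inl z)) (spaceTime n) := by
  rw [reference] at hf
  exact measurableEmbedding_inl.integrable_map_iff.1 hf.left_of_add_measure

/-- Unlike the second moment bound in the definition of a generalized Young measure, this is global in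
space. -/
theorem integrable_mul_energy (hY : Y.IsAdmissible v₀) {h : ℝ → ℝ} (hh : IntegrableOn h (Ici 0)) :
    Integrable (fun z => h z.1 * Y.energyDensity z) (spaceTime n) :=
  reference_integrable_inl ((Y.stress hY).integrable_time_mul hh)

theorem integrable_inner_barycenter (hY : Y.IsAdmissible v₀) {h : ℝ → ℝ}
    (hh : IntegrableOn h (Ici 0)) {φ : Eucl n → Eucl n} (hφ : MemLp φ 2 volume) :
    Integrable (fun z : ℝ × Eucl n => h z.1 * ⟪φ z.2, Y.barycenter z⟫) (spaceTime n) := by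
  have hφ2 : Integrable (fun x => ‖φ x‖ ^ 2) := (memLp_two_iff_integrable_sq_norm hφ.1).1 hφ
  have i1 : Integrable (fun z : ℝ × Eucl n => h z.1 * ‖φ z.2‖ ^ 2) (spaceTime n) := by
    rw [spaceTime_eq_prod]
    exact Integrable.mul_prod hh hφ2
  refine Integrable.mono' (i1.norm.add (integrable_mul_energy hY hh).norm) ?_ ?_
  · have hm := Y.aestronglyMeasurable_barycenter
    rw [spaceTime_eq_prod] at hm ⊢
    exact hh.1.comp_fst.mul (hφ.1.comp_snd.inner hm)
  · filter_upwards [Y.ae_norm_sq_barycenter_le] with z hz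
    simp only [Pi.add_apply, norm_mul, ← mul_add]
    refine mul_le_mul_of_nonneg_left ?_ (norm_nonneg _)
    rw [Real.norm_of_nonneg (Y.energyDensity_nonneg z), Real.norm_of_nonneg (sq_nonneg ‖φ z.2‖)]
    refine (norm_inner_le_norm _ _).trans ?_
    nlinarith [sq_nonneg (‖φ z.2‖ - ‖Y.barycenter z‖), norm_nonneg (φ z.2),
      norm_nonneg (Y.barycenter z)]

theorem integrableOn_integral_inner_barycenter (hY : Y.IsAdmissible v₀) {φ : Eucl n → Eucl n}
    (hφ : MemLp φ 2 volume) (T : ℝ) :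
    IntegrableOn (fun t => ∫ x, ⟪φ x, Y.barycenter (t, x)⟫) (Ioo 0 T) := by
  have h1 : IntegrableOn ((Ioo 0 T).indicator fun _ => (1 : ℝ)) (Ici 0) :=
    ((integrable_indicator_iff measurableSet_Ioo).2 (by simp [integrableOn_const_iff])).integrableOn
  have h2 := integrable_inner_barycenter hY h1 hφ
  rw [spaceTime_eq_prod] at h2
  have h3 := h2.integral_prod_left
  simp_rw [integral_const_mul] at h3
  have h4 : IntegrableOn (fun t => (Ioo 0 T).indicator (fun _ => (1 : ℝ)) t
      * ∫ x, ⟪φ x, Y.barycenter (t, x)⟫) (Ioo 0 T) :=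
    IntegrableOn.mono_set h3 fun t ht => ht.1.le
  refine h4.congr_fun (fun t ht => ?_) measurableSet_Ioo
  simp [ht]

theorem _root_.IsTestField.exists_jac_bound {φ : Eucl n → Eucl n} (hφ : IsTestField φ) :
    ∃ C, 0 ≤ C ∧ ∀ x i j, |jac φ x i j| ≤ C := by
  have hc := hφ.smooth.continuous_fderiv (by simp)
  obtain ⟨C, hC⟩ := hc.bounded_above_of_compact_support (hφ.compact.fderiv (𝕜 := ℝ))
  refine ⟨C, (norm_nonneg _).trans (hC 0), fun x i j => ?_⟩
  refine (abs_coord_le _ i).trans (((fderiv ℝ φ x).le_opNorm _).trans ?_)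
  simpa using hC x

/-- The momentum equation for separated test fields. -/
theorem momentum_separated (hY : Y.IsAdmissible v₀) (φ : testFields n) {χ : ℝ → ℝ}
    (hχ : ContDiff ℝ ∞ χ) (hχc : HasCompactSupport χ) :
    (∫ t in Ici 0, deriv χ t * ∫ x, ⟪φ.1 x, Y.barycenter (t, x)⟫)
      + ∫ z, χ ((Y.stress hY).time z) *
          contract (jac φ.1 ((Y.stress hY).pos z)) ((Y.stress hY).Θ z) ∂(Y.stress hY).τ
      = - (χ 0 * ⟪testL n φ, v₀⟫) := by
  have hφ : IsTestField φ.1 := φ.2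
  set M := Y.stress hY with hM
  obtain ⟨C, hC0, hC⟩ := IsTestField.exists_jac_bound hφ
  have h := hY.momentum (separated χ φ.1) (separated_contDiff hχ hφ.smooth)
    (separated_compact hχc hφ.compact) fun t _ x => spaceDiv_separated hφ _
  have hχi : IntegrableOn χ (Ici 0) :=
    (hχ.continuous.integrable_of_hasCompactSupport hχc).integrableOn
  have hχ'i : IntegrableOn (deriv χ) (Ici 0) :=
    ((hχ.continuous_deriv (by simp)).integrable_of_hasCompactSupport hχc.deriv).integrableOn
  have i1 : Integrable (fun z : ℝ × Eucl n => deriv χ z.1 * ⟪φ.1 z.2, Y.barycenter z⟫)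
      (spaceTime n) := integrable_inner_barycenter hY hχ'i hφ.memLp
  have i2 : Integrable (fun z => χ (M.time z) * contract (jac φ.1 (M.pos z)) (M.Θ z)) M.τ := by
    refine Integrable.mono' ((M.integrable_time_mul hχi).norm.const_mul (n * n * C)) ?_ ?_
    · refine ((hχ.continuous.measurable.comp M.measurable_time).aestronglyMeasurable).mul
        (M.aestronglyMeasurable_contract .rfl fun i j => ?_)
      exact ((continuous_jac (hφ.smooth.of_le (by simp)) i j).measurable.comp
        M.measurable_pos).aestronglyMeasurable
    · filter_upwards [M.bound] with z hz
      rw [norm_mul, norm_mul, Real.norm_of_nonneg (M.e_nonneg z), mul_left_comm]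
      exact mul_le_mul_of_nonneg_left (abs_contract_le (hC _) hz) (norm_nonneg _)
  have i3 := reference_integrable_inl i2
  have e1 : ∫ z, (⟪timeDeriv (separated χ φ.1) z, Y.barycenter z⟫
      + contract (gradMat (separated χ φ.1) z) (Y.oscMoment z)) ∂(spaceTime n)
      = (∫ t in Ici 0, deriv χ t * ∫ x, ⟪φ.1 x, Y.barycenter (t, x)⟫)
        + ∫ z, χ z.1 * contract (jac φ.1 z.2) (Y.oscMoment z) ∂(spaceTime n) := by
    have h2 : ∫ z : ℝ × Eucl n, deriv χ z.1 * ⟪φ.1 z.2, Y.barycenter z⟫ ∂(spaceTime n)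
        = ∫ t in Ici 0, deriv χ t * ∫ x, ⟪φ.1 x, Y.barycenter (t, x)⟫ := by
      rw [spaceTime_eq_prod] at i1 ⊢
      rw [integral_prod _ i1]
      simp_rw [integral_const_mul]
    rw [← h2]
    refine Eq.trans ?_ (integral_add i1 i3)
    refine integral_congr_ae (Eventually.of_forall fun z => ?_)
    exact congrArg₂ (· + ·) (by rw [timeDeriv_separated hχ, real_inner_smul_left])
      (contract_gradMat_separated hφ.smooth z _)
  have e2 : ∫ z, contract (gradMat (separated χ φ.1) z) (Y.angleMoment z) ∂Y.conc
      = ∫ z, χ z.1 * contract (jac φ.1 z.2) (Y.angleMoment z) ∂Y.conc :=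
    integral_congr_ae (Eventually.of_forall fun z => contract_gradMat_separated hφ.smooth z _)
  have e3 : ∫ x, ⟪separated χ φ.1 (0, x), v₀ x⟫ = χ 0 * ⟪testL n φ, v₀⟫ := by
    rw [inner_testL, ← integral_const_mul]
    refine integral_congr_ae (Eventually.of_forall fun x => ?_)
    simp only [separated, real_inner_smul_left]
  have e4 : ∫ z, χ (M.time z) * contract (jac φ.1 (M.pos z)) (M.Θ z) ∂M.τ
      = ∫ z, χ z.1 * contract (jac φ.1 z.2) (Y.oscMoment z) ∂(spaceTime n)
        + ∫ z, χ z.1 * contract (jac φ.1 z.2) (Y.angleMoment z) ∂Y.conc :=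
    Y.integral_reference i2
  rw [e1, e2, e3] at h
  rw [e4, ← h]
  ring

/-- The momentum equation integrated up to almost every time. -/
theorem ae_inner_barycenter_eq (hY : Y.IsAdmissible v₀) (φ : testFields n) :
    ∀ᵐ t ∂(volume.restrict (Ici (0 : ℝ))), ∫ x, ⟪φ.1 x, Y.barycenter (t, x)⟫
      = ⟪testL n φ, v₀⟫ + (Y.stress hY).upto t (jac φ.1) := by
  have hφ : IsTestField φ.1 := φ.2
  set M := Y.stress hY with hM
  obtain ⟨C, hC0, hC⟩ := IsTestField.exists_jac_bound hφ
  have hjc : ∀ i j, Continuous fun x => jac φ.1 x i j :=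
    continuous_jac (hφ.smooth.of_le (by simp))
  set a : ℝ → ℝ := fun t => ∫ x, ⟪φ.1 x, Y.barycenter (t, x)⟫ with ha
  have hac : ∀ T : ℝ, IntegrableOn a (Ioo 0 T) :=
    integrableOn_integral_inner_barycenter hY hφ.memLp
  have hup : Continuous fun t => M.upto t (jac φ.1) := M.continuous_upto hjc hC hC0
  have hT : ∀ T : ℝ, 0 < T → ∀ᵐ t, t ∈ Ioo 0 T →
      a t - (⟪testL n φ, v₀⟫ + M.upto t (jac φ.1)) = 0 := by
    intro T hT
    refine isOpen_Ioo.ae_eq_zero_of_integral_contDiff_smul_eq_zero ?_ ?_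
    · exact ((hac T).sub (((continuous_const.add hup).continuousOn.integrableOn_compact
        isCompact_Icc).mono_set Ioo_subset_Icc_self)).locallyIntegrableOn
    intro ψ hψ hψc hψs
    obtain ⟨χ, hχ, hχc, hχ1, hχ2, hχ3⟩ := exists_primitive_test hT hψ hψs
    have h := momentum_separated hY φ hχ hχc
    have hψ0 : ∀ t, t ∉ Ioo 0 T → ψ t = 0 := fun t ht =>
      image_eq_zero_of_notMem_tsupport fun h => ht (hψs h)
    have hsm : MeasurableSet (M.time ⁻¹' Iic T) := M.measurable_time measurableSet_Iic
    obtain ⟨B, hB⟩ := hψ.continuous.bounded_above_of_compact_support hψc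
    -- exchange the order of integration
    have hF := M.integral_upto_eq hT.le
      (G := fun r z => ψ r * contract (jac φ.1 (M.pos z)) (M.Θ z))
      (h := fun r => |ψ r| * (n * n * C)) ?_ ?_ ?_
    rotate_left
    · have := M.sfinite
      exact (hψ.continuous.aestronglyMeasurable.comp_fst).mul
        (M.aestronglyMeasurable_contract .rfl fun i j =>
          ((hjc i j).measurable.comp M.measurable_pos).aestronglyMeasurable).comp_snd
    · exact ((hψ.continuous.abs.integrable_of_hasCompactSupport hψc.abs).mul_const _).integrableOn
    · filter_upwards [M.bound] with z hz r
      rw [abs_mul, mul_assoc]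
      exact mul_le_mul_of_nonneg_left (abs_contract_le (hC _) hz) (abs_nonneg _)
    have e1 : ∫ z, χ (M.time z) * contract (jac φ.1 (M.pos z)) (M.Θ z) ∂M.τ
        = - ∫ r in (0 : ℝ)..T, ψ r * M.upto r (jac φ.1) := by
      have e2 : ∫ r in (0 : ℝ)..T, ψ r * M.upto r (jac φ.1)
          = ∫ r in (0 : ℝ)..T, ∫ z in M.time ⁻¹' Iic r,
            ψ r * contract (jac φ.1 (M.pos z)) (M.Θ z) ∂M.τ := by
        simp_rw [integral_const_mul]
        rfl
      rw [e2, hF, ← integral_neg, ← integral_indicator hsm]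
      refine integral_congr_ae ?_
      filter_upwards [M.time_nonneg] with z hz
      by_cases hzT : M.time z ≤ T
      · rw [indicator_of_mem (show z ∈ M.time ⁻¹' Iic T from hzT), hχ2 _ ⟨hz, hzT⟩,
          intervalIntegral.integral_mul_const]
        ring
      · rw [indicator_of_notMem (show z ∉ M.time ⁻¹' Iic T from hzT),
          hχ3 _ (le_of_not_ge hzT), zero_mul]
    have e3 : ∫ t in Ici 0, deriv χ t * ∫ x, ⟪φ.1 x, Y.barycenter (t, x)⟫
        = ∫ t in (0 : ℝ)..T, ψ t * a t := by
      rw [intervalIntegral.integral_of_le hT.le, ← integral_indicator measurableSet_Ioc,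
        ← integral_indicator measurableSet_Ici]
      refine integral_congr_ae (Eventually.of_forall fun t => ?_)
      by_cases h0 : 0 ≤ t
      · by_cases hI : t ∈ Ioo 0 T
        · simp only [indicator_of_mem (show t ∈ Ici (0 : ℝ) from h0),
            indicator_of_mem (Ioo_subset_Ioc_self hI), hχ1 t h0, ha]
        · have : (Ioc 0 T).indicator (fun t => ψ t * a t) t = 0 := by
            rw [indicator_apply, hψ0 t hI, zero_mul, ite_self]
          simp only [indicator_of_mem (show t ∈ Ici (0 : ℝ) from h0), hχ1 t h0, hψ0 t hI,
            zero_mul]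
          exact this.symm
      · rw [indicator_of_notMem (show t ∉ Ici (0 : ℝ) from h0),
          indicator_of_notMem (fun h => h0 h.1.le)]
    have e4 : χ 0 = - ∫ r in (0 : ℝ)..T, ψ r := hχ2 0 (left_mem_Icc.2 hT.le)
    have j1 : IntervalIntegrable (fun t => ψ t * a t) volume 0 T := by
      rw [intervalIntegrable_iff_integrableOn_Ioo_of_le hT.le]
      exact (hac T).bdd_mul hψ.continuous.aestronglyMeasurable.restrict
        (Eventually.of_forall hB)
    have j2 : IntervalIntegrable (fun t => ψ t * M.upto t (jac φ.1)) volume 0 T :=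
      (hψ.continuous.mul hup).intervalIntegrable _ _
    have j3 : IntervalIntegrable (fun t => ψ t * ⟪testL n φ, v₀⟫) volume 0 T :=
      (hψ.continuous.mul continuous_const).intervalIntegrable _ _
    rw [e3, e1, e4] at h
    have e5 : ∫ t, ψ t • (a t - (⟪testL n φ, v₀⟫ + M.upto t (jac φ.1)))
        = ∫ t in (0 : ℝ)..T, (ψ t * a t - (ψ t * ⟪testL n φ, v₀⟫ + ψ t * M.upto t (jac φ.1))) := by
      rw [intervalIntegral.integral_of_le hT.le, integral_Ioc_eq_integral_Ioo,
        ← setIntegral_eq_integral_of_forall_compl_eq_zero (s := Ioo 0 T)]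
      · refine integral_congr_ae (Eventually.of_forall fun t => ?_)
        simp only [smul_eq_mul]
        ring
      · intro t ht
        rw [hψ0 t ht, zero_smul]
    rw [e5, intervalIntegral.integral_sub j1 (j3.add j2), intervalIntegral.integral_add j3 j2,
      intervalIntegral.integral_mul_const]
    linarith
  have hall : ∀ᵐ t : ℝ, ∀ k : ℕ, t ∈ Ioo (0 : ℝ) (k + 1) →
      a t - (⟪testL n φ, v₀⟫ + M.upto t (jac φ.1)) = 0 :=
    ae_all_iff.2 fun k => hT _ (by positivity)
  rw [← Measure.restrict_congr_set (Ioi_ae_eq_Ici (μ := volume) (a := (0 : ℝ))),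
    ae_restrict_iff' measurableSet_Ioi]
  filter_upwards [hall] with t ht h0
  obtain ⟨k, hk⟩ := exists_nat_gt t
  linarith [ht k ⟨h0, by linarith⟩]

end GeneralizedYoungMeasure

/-! ### The velocity field -/

/-- A functional on the solenoidal test fields that is bounded in `L²` is represented by a
solenoidal field. -/
theorem exists_divFree_repr {n : ℕ} (Λ : testFields n →ₗ[ℝ] ℝ) {C : ℝ} (hC : 0 ≤ C)
    (hΛ : ∀ φ, |Λ φ| ≤ C * ‖testL n φ‖) :
    ∃ u ∈ divFree n, ‖u‖ ≤ C ∧ ∀ φ, ⟪testL n φ, u⟫ = Λ φ := by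
  set e : testFields n →ₗ[ℝ] divFree n := (testL n).codRestrict (divFree n) testL_mem_divFree with he
  have hd : DenseRange e := by
    intro u
    rw [closure_subtype, ← range_comp]
    exact mem_closure_testL u.2
  set u := (InnerProductSpace.toDual ℝ (divFree n)).symm (Λ.extendOfNorm e) with hu
  refine ⟨u, u.2, ?_, fun φ => ?_⟩
  · have h1 : ‖(u : L2 n)‖ = ‖u‖ := rfl
    rw [h1, hu, LinearIsometryEquiv.norm_map]
    exact LinearMap.opNorm_extendOfNorm_le hd hC hΛ
  · have h1 : ⟪u, e φ⟫ = Λ.extendOfNorm e (e φ) := InnerProductSpace.toDual_symm_apply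
    rw [LinearMap.extendOfNorm_eq hd ⟨C, hΛ⟩] at h1
    rw [← h1, real_inner_comm]
    rfl

/-- A continuous function bounded above almost everywhere on `[0, ∞)` is bounded there. -/
theorem le_of_ae_le_Ici {f : ℝ → ℝ} (hf : Continuous f) {c : ℝ}
    (h : ∀ᵐ t ∂(volume.restrict (Ici (0 : ℝ))), f t ≤ c) {t : ℝ} (ht : 0 ≤ t) : f t ≤ c := by
  have h1 : ∀ᵐ t : ℝ, t ∈ Ici (0 : ℝ) → f t ≤ c := (ae_restrict_iff' measurableSet_Ici).1 h
  have h2 : Dense {t : ℝ | t ∈ Ici (0 : ℝ) → f t ≤ c} := Measure.dense_of_ae h1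
  have h3 := h2.open_subset_closure_inter (isOpen_Ioi (a := (0 : ℝ)))
  have h4 : closure (Ioi (0 : ℝ) ∩ {t : ℝ | t ∈ Ici (0 : ℝ) → f t ≤ c}) ⊆ {t | f t ≤ c} :=
    closure_minimal (fun s hs => hs.2 (Ioi_subset_Ici_self hs.1)) (isClosed_le hf continuous_const)
  have h5 : closure (Ioi (0 : ℝ)) ⊆ {t | f t ≤ c} :=
    (closure_minimal h3 isClosed_closure).trans h4
  rw [closure_Ioi] at h5
  exact h5 ht

theorem aestronglyMeasurable_jac_moll {n : ℕ} {α : Type*} [MeasurableSpace α] {μ : Measure α}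
    (b : ContDiffBump (0 : Eucl n)) {w : α → L2 n} {x : α → Eucl n}
    (hw : AEStronglyMeasurable w μ) (hx : AEStronglyMeasurable x μ) (i j : Fin n) :
    AEStronglyMeasurable (fun z => jac (moll b (w z)) (x z) i j) μ := by
  have h : AEStronglyMeasurable (fun z => ((w z, x z) : L2 n × Eucl n)) μ := hw.prodMk hx
  have h2 := (continuous_jac_moll b i j).comp_aestronglyMeasurable h
  exact h2

namespace StressMeasure

variable {n : ℕ} {V : ℝ} {Z : Type*} [MeasurableSpace Z] (M : StressMeasure n V Z)

/-- `u` is a bounded solenoidal field with `∂ₜ u + P div Θ = 0` and `u(0) = v₀`, integrated in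
time. -/
structure IsVelocity (v₀ : L2 n) (u : ℝ → L2 n) : Prop where
  mem : ∀ t, 0 ≤ t → u t ∈ divFree n
  norm_le : ∀ t, 0 ≤ t → ‖u t‖ ≤ ‖v₀‖
  momentum : ∀ t, 0 ≤ t → ∀ φ : testFields n,
    ⟪testL n φ, u t⟫ = ⟪testL n φ, v₀⟫ + M.upto t (jac φ.1)

namespace IsVelocity

variable {M} {v₀ : L2 n} {u : ℝ → L2 n} (hu : M.IsVelocity v₀ u)

include hu

/-- The difference of `u 0` and `v₀` is solenoidal and orthogonal to all test fields. -/
theorem initial (hv₀ : IsDivFree v₀) : u 0 = v₀ := by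
  rw [← sub_eq_zero]
  refine eq_zero_of_orthogonal _ (sub_mem (hu.mem 0 le_rfl) (mem_divFree.2 hv₀)) fun φ => ?_
  obtain ⟨C, -, hC⟩ := IsTestField.exists_jac_bound φ.2
  rw [inner_sub_right, hu.momentum 0 le_rfl, M.upto_zero hC]
  ring

/-- By density it suffices to pair with test fields, for which the momentum equation applies. -/
theorem weak_cont (g : L2 n) : ContinuousOn (fun t => ⟪g, u t⟫) (Ici 0) := by
  set p := (divFree n).starProjection g with hp
  have h1 : ∀ t ∈ Ici (0 : ℝ), ⟪g, u t⟫ = ⟪p, u t⟫ := fun t ht => by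
    rw [hp, Submodule.inner_starProjection_left_eq_right, starProjection_divFree_self (hu.mem t ht)]
  refine ContinuousOn.congr ?_ h1
  refine continuousOn_of_uniform_approx_of_continuousOn fun U hU => ?_
  obtain ⟨ε, hε, hεU⟩ := Metric.mem_uniformity_dist.1 hU
  obtain ⟨_, ⟨φ, rfl⟩, hφ⟩ := Metric.mem_closure_iff.1
    (mem_closure_testL ((divFree n).starProjection_apply_mem g)) (ε / (‖v₀‖ + 1)) (by positivity)
  obtain ⟨C, hC0, hC⟩ := IsTestField.exists_jac_bound φ.2
  refine ⟨fun t => ⟪testL n φ, v₀⟫ + M.upto t (jac φ.1), ?_, fun t ht => hεU ?_⟩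
  · exact (continuous_const.add (M.continuous_upto
      (continuous_jac ((IsTestField.smooth φ.2).of_le (by simp))) hC hC0)).continuousOn
  · simp only
    rw [← hu.momentum t ht, Real.dist_eq, ← inner_sub_left]
    refine (abs_real_inner_le_norm _ _).trans_lt ?_
    rw [← dist_eq_norm]
    have h2 : dist p (testL n φ) * (‖v₀‖ + 1) < ε := (lt_div_iff₀ (by positivity)).1 hφ
    refine lt_of_le_of_lt ?_ h2
    have := hu.norm_le t ht
    gcongr
    linarith

theorem aestronglyMeasurable : AEStronglyMeasurable u (volume.restrict (Ici 0)) := by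
  have := secondCountable_L2 n
  exact aestronglyMeasurable_of_inner fun g =>
    (hu.weak_cont g).aestronglyMeasurable measurableSet_Ici

/-- Pairings of `u` with an integrable field are integrable in time. -/
theorem integrableOn_inner {g : ℝ → L2 n} {s : Set ℝ} (hg : IntegrableOn g s)
    (hsm : MeasurableSet s) (hs : s ⊆ Ici 0) :
    IntegrableOn (fun t => ⟪g t, u t⟫) s := by
  have hum : AEStronglyMeasurable u (volume.restrict s) :=
    hu.aestronglyMeasurable.mono_measure (Measure.restrict_mono hs le_rfl)
  refine (hg.norm.mul_const ‖v₀‖).mono' (hg.1.inner hum) ?_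
  filter_upwards [ae_restrict_mem hsm] with t ht
  refine (norm_inner_le_norm _ _).trans ?_
  gcongr
  exact hu.norm_le t (hs ht)

/-- The momentum equation tested with mollified solenoidal fields. -/
theorem inner_moll_eq (b : ContDiffBump (0 : Eucl n)) {a : L2 n} (ha : a ∈ divFree n) {t : ℝ}
    (ht : 0 ≤ t) :
    ⟪mollL b a, u t⟫ = ⟪mollL b a, v₀⟫ + M.upto t (jac (moll b a)) := by
  obtain ⟨c, hc, hlim⟩ := mem_closure_iff_seq_limit.1 (mem_closure_testL ha)
  choose φ hφ using hc
  have hmoll : ∀ k, moll b (c k) = moll b (φ k).1 := fun k => by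
    rw [← hφ k]
    exact moll_congr_ae b (testL_coeFn (φ k))
  have h1 : ∀ k, ⟪mollL b (c k), u t⟫ = ⟪mollL b (c k), v₀⟫ + M.upto t (jac (moll b (c k))) := by
    intro k
    have hT : IsTestField (moll b (φ k).1) := IsTestField.moll (φ k).2 b
    have h2 : testL n ⟨moll b (φ k).1, hT⟩ = mollL b (c k) := by
      apply Lp.ext
      have h4 : moll b (φ k).1 =ᵐ[volume] mollL b (c k) := by
        rw [← hmoll k]
        exact (mollL_coeFn b (c k)).symm
      exact (testL_coeFn _).trans h4
    have h3 := hu.momentum t ht ⟨moll b (φ k).1, hT⟩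
    rw [h2] at h3
    rw [h3, hmoll]
  have h4 := ((mollL b).continuous.tendsto a).comp hlim
  refine tendsto_nhds_unique ((h4.inner (tendsto_const_nhds (x := u t))).congr fun k => h1 k) ?_
  exact (h4.inner tendsto_const_nhds).add (M.upto_moll_tendsto b t hlim)

/-- The evolution of the pairing of `u` with a mollified comparison field `w`, the primitive of
`g`. -/
theorem inner_moll_evolution (b : ContDiffBump (0 : Eucl n)) {t : ℝ} (ht : 0 ≤ t) {w g : ℝ → L2 n}
    (hg : IntervalIntegrable g volume 0 t) (hw : ∀ s ∈ Icc 0 t, w s = w 0 + ∫ r in (0 : ℝ)..s, g r)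
    (hwc : ContinuousOn w (Icc 0 t)) (hwd : ∀ s ∈ Icc 0 t, w s ∈ divFree n)
    (hgd : ∀ᵐ s ∂(volume.restrict (Ioc 0 t)), g s ∈ divFree n) :
    IntegrableOn (fun z => contract (jac (moll b (w (M.time z))) (M.pos z)) (M.Θ z))
        (M.time ⁻¹' Iic t) M.τ ∧
      ⟪mollL b (w t), u t⟫ - ⟪mollL b (w 0), v₀⟫
        = (∫ s in (0 : ℝ)..t, ⟪mollL b (g s), u s⟫)
          + ∫ z in M.time ⁻¹' Iic t,
            contract (jac (moll b (w (M.time z))) (M.pos z)) (M.Θ z) ∂M.τ := by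
  have hIc : IntegrableOn g (Ioc 0 t) := (intervalIntegrable_iff_integrableOn_Ioc_of_le ht).1 hg
  have hmeas : MeasurableSet (M.time ⁻¹' Iic t) := M.measurable_time measurableSet_Iic
  obtain ⟨K, hK⟩ := isCompact_Icc.exists_bound_of_continuousOn hwc
  have hqmp : Measure.QuasiMeasurePreserving M.time (M.τ.restrict (M.time ⁻¹' Iic t))
      (volume.restrict (Icc 0 t)) := by
    have := M.time_qmp.restrict (mapsTo_preimage M.time (Iic t))
    rwa [Measure.restrict_restrict measurableSet_Iic, inter_comm, Ici_inter_Iic] at this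
  have hint : IntegrableOn (fun z => contract (jac (moll b (w (M.time z))) (M.pos z)) (M.Θ z))
      (M.time ⁻¹' Iic t) M.τ := by
    refine Integrable.mono' (g := fun z => n * n * (gradConst b * K) * M.e z)
      ((M.integrableOn_e t).const_mul _) ?_ ?_
    · have h1 : AEStronglyMeasurable (fun z => w (M.time z)) (M.τ.restrict (M.time ⁻¹' Iic t)) :=
        (hwc.aestronglyMeasurable measurableSet_Icc).comp_quasiMeasurePreserving hqmp
      have h2 := aestronglyMeasurable_jac_moll b h1 M.measurable_pos.aestronglyMeasurable
      exact M.aestronglyMeasurable_contract Measure.absolutelyContinuous_restrict h2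
    · filter_upwards [ae_restrict_of_ae M.bound, ae_restrict_of_ae M.time_nonneg,
        ae_restrict_mem hmeas] with z h1 h2 h3
      refine abs_contract_le (fun i j => (abs_jac_moll_le b _ _ i j).trans ?_) h1
      have := gradConst_nonneg b
      gcongr
      exact hK _ ⟨h2, h3⟩
  refine ⟨hint, ?_⟩
  have hgm : IntegrableOn (fun s => mollL b (g s)) (Ioc 0 t) := (mollL b).integrable_comp hIc
  have i1 : IntervalIntegrable (fun s => ⟪mollL b (g s), u s⟫) volume 0 t :=
    (intervalIntegrable_iff_integrableOn_Ioc_of_le ht).2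
      (hu.integrableOn_inner hgm measurableSet_Ioc fun s hs => hs.1.le)
  have i2 : IntervalIntegrable (fun s => ⟪mollL b (g s), v₀⟫) volume 0 t :=
    (intervalIntegrable_iff_integrableOn_Ioc_of_le ht).2 (hgm.inner_const v₀)
  have e1 : (∫ s in (0 : ℝ)..t, ⟪mollL b (g s), u s⟫) - ∫ s in (0 : ℝ)..t, ⟪mollL b (g s), v₀⟫
      = ∫ s in (0 : ℝ)..t, M.upto s (jac (moll b (g s))) := by
    rw [← intervalIntegral.integral_sub i1 i2, intervalIntegral.integral_of_le ht,
      intervalIntegral.integral_of_le ht]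
    refine integral_congr_ae ?_
    filter_upwards [hgd, ae_restrict_mem measurableSet_Ioc] with s h1 h2
    rw [hu.inner_moll_eq b h1 h2.1.le]
    ring
  have e2 : ∫ s in (0 : ℝ)..t, ⟪mollL b (g s), v₀⟫ = ⟪mollL b (w t), v₀⟫ - ⟪mollL b (w 0), v₀⟫ := by
    rw [hw t (right_mem_Icc.2 ht), map_add, inner_add_left, add_sub_cancel_left,
      ← (mollL b).intervalIntegral_comp_comm hg, real_inner_comm,
      inner_intervalIntegral ((intervalIntegrable_iff_integrableOn_Ioc_of_le ht).2 hgm)]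
    simp_rw [real_inner_comm v₀]
  have e3 : ∫ z in M.time ⁻¹' Iic t,
        contract (jac (moll b (∫ r in M.time z..t, g r : L2 n)) (M.pos z)) (M.Θ z) ∂M.τ
      = M.upto t (jac (moll b (w t)))
        - ∫ z in M.time ⁻¹' Iic t,
            contract (jac (moll b (w (M.time z))) (M.pos z)) (M.Θ z) ∂M.τ := by
    rw [upto, ← integral_sub (M.integrableOn_contract (continuous_jac_moll_right b _)
      (abs_jac_moll_le b _) t) hint]
    refine integral_congr_ae ?_
    filter_upwards [ae_restrict_of_ae M.time_nonneg, ae_restrict_mem hmeas] with z h2 h3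
    simp only [contract_jac_moll]
    rw [← inner_sub_right, hw t (right_mem_Icc.2 ht), hw _ ⟨h2, h3⟩, add_sub_add_left_eq_sub,
      intervalIntegral.integral_interval_sub_left hg
        (hg.mono_set (uIcc_subset_uIcc left_mem_uIcc (mem_uIcc_of_le h2 h3)))]
  have e4 := M.integral_upto_moll b ht hg
  have e5 := hu.inner_moll_eq b (hwd t (right_mem_Icc.2 ht)) ht
  rw [e3] at e4
  linarith

end IsVelocity

end StressMeasure

/-- A countable subfamily with the same closure, used to exchange null sets of times. -/
theorem exists_dense_subfamily {ι X : Type*} [Nonempty ι] [PseudoMetricSpace X]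
    [SecondCountableTopology X] (f : ι → X) :
    ∃ s : ℕ → ι, ∀ i, f i ∈ closure (range fun k => f (s k)) := by
  have : Nonempty (range f) := (range_nonempty f).to_subtype
  choose s hs using fun k => (TopologicalSpace.denseSeq (range f) k).2
  refine ⟨s, fun i => ?_⟩
  have h := TopologicalSpace.denseRange_denseSeq (range f) ⟨f i, mem_range_self i⟩
  rw [closure_subtype, ← range_comp] at h
  convert h using 3
  exact funext hs

theorem contract_jac_add {n : ℕ} {φ ψ : Eucl n → Eucl n} (hφ : ContDiff ℝ ∞ φ)
    (hψ : ContDiff ℝ ∞ ψ) (x : Eucl n) (B : Matrix (Fin n) (Fin n) ℝ) :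
    contract (jac (φ + ψ) x) B = contract (jac φ x) B + contract (jac ψ x) B := by
  unfold contract
  simp_rw [jac_add hφ hψ, add_mul, Finset.sum_add_distrib]

theorem contract_jac_smul {n : ℕ} {φ : Eucl n → Eucl n} (hφ : ContDiff ℝ ∞ φ) (c : ℝ) (x : Eucl n)
    (B : Matrix (Fin n) (Fin n) ℝ) : contract (jac (c • φ) x) B = c * contract (jac φ x) B := by
  unfold contract
  simp_rw [jac_smul hφ, mul_assoc, Finset.mul_sum]

namespace GeneralizedYoungMeasure

variable {n : ℕ} {Y : GeneralizedYoungMeasure n} {v₀ : L2 n}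

/-- The velocity at time `t ≥ 0` as a functional on test fields. At almost every time it is the pairing
with the barycenter, but in contrast to the latter it is defined at every time. -/
noncomputable def momentumFunctional (hY : Y.IsAdmissible v₀) (t : ℝ) : testFields n →ₗ[ℝ] ℝ where
  toFun φ := ⟪testL n φ, v₀⟫ + (Y.stress hY).upto t (jac φ.1)
  map_add' φ ψ := by
    have hφ : IsTestField φ.1 := φ.2
    have hψ : IsTestField ψ.1 := ψ.2
    obtain ⟨C, -, hC⟩ := IsTestField.exists_jac_bound hφ
    obtain ⟨D, -, hD⟩ := IsTestField.exists_jac_bound hψ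
    have h : (Y.stress hY).upto t (jac (φ + ψ).1)
        = (Y.stress hY).upto t (jac φ.1) + (Y.stress hY).upto t (jac ψ.1) := by
      unfold StressMeasure.upto
      rw [← integral_add
        ((Y.stress hY).integrableOn_contract (continuous_jac (hφ.smooth.of_le (by simp))) hC t)
        ((Y.stress hY).integrableOn_contract (continuous_jac (hψ.smooth.of_le (by simp))) hD t)]
      exact integral_congr_ae (Eventually.of_forall fun z =>
        contract_jac_add hφ.smooth hψ.smooth _ _)
    rw [map_add, inner_add_left, h]
    ring
  map_smul' c φ := by
    have hφ : IsTestField φ.1 := φ.2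
    have h : (Y.stress hY).upto t (jac (c • φ).1) = c * (Y.stress hY).upto t (jac φ.1) := by
      unfold StressMeasure.upto
      rw [← integral_const_mul]
      exact integral_congr_ae (Eventually.of_forall fun z => contract_jac_smul hφ.smooth _ _ _)
    rw [map_smul, real_inner_smul_left, h, RingHom.id_apply, smul_eq_mul]
    ring

theorem integral_inner_barycenter {t : ℝ} (h : MemLp (fun x => Y.barycenter (t, x)) 2 volume)
    (p : L2 n) : ⟪p, h.toLp⟫ = ∫ x, ⟪p x, Y.barycenter (t, x)⟫ := by
  rw [L2.inner_def]
  exact integral_congr_ae (h.coeFn_toLp.mono fun x hx => by simp only [hx])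

/-- The bound holds at almost every time by the energy inequality, and at every time by continuity. -/
theorem abs_momentumFunctional_le (hY : Y.IsAdmissible v₀) {t : ℝ} (ht : 0 ≤ t)
    (φ : testFields n) : |momentumFunctional hY t φ| ≤ ‖v₀‖ * ‖testL n φ‖ := by
  have hφ : IsTestField φ.1 := φ.2
  obtain ⟨C, hC0, hC⟩ := IsTestField.exists_jac_bound hφ
  have hc : Continuous fun t => |momentumFunctional hY t φ| :=
    (continuous_const.add ((Y.stress hY).continuous_upto
      (continuous_jac (hφ.smooth.of_le (by simp))) hC hC0)).abs
  refine le_of_ae_le_Ici hc ?_ ht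
  filter_upwards [ae_inner_barycenter_eq hY φ, ae_memLp_barycenter hY] with s h1 h2
  obtain ⟨h2, h3⟩ := h2
  have h4 : momentumFunctional hY s φ = ⟪testL n φ, h2.toLp⟫ := by
    refine h1.symm.trans ?_
    rw [integral_inner_barycenter h2]
    exact integral_congr_ae ((testL_coeFn φ).mono fun x hx => by simp only [hx])
  rw [h4, mul_comm]
  exact (abs_real_inner_le_norm _ _).trans (by gcongr)

/-- The velocity field, obtained at every time from the Riesz representation theorem. -/
theorem exists_isVelocity (hY : Y.IsAdmissible v₀) : ∃ u, (Y.stress hY).IsVelocity v₀ u := by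
  have h : ∀ t : ℝ, ∃ u : L2 n, 0 ≤ t → u ∈ divFree n ∧ ‖u‖ ≤ ‖v₀‖ ∧
      ∀ φ, ⟪testL n φ, u⟫ = momentumFunctional hY t φ := by
    intro t
    by_cases ht : 0 ≤ t
    · obtain ⟨u, h1, h2⟩ := exists_divFree_repr (momentumFunctional hY t) (norm_nonneg v₀)
        (abs_momentumFunctional_le hY ht)
      exact ⟨u, fun _ => ⟨h1, h2⟩⟩
    · exact ⟨0, fun h => absurd h ht⟩
  choose u hu using h
  exact ⟨u, fun t ht => (hu t ht).1, fun t ht => (hu t ht).2.1, fun t ht => (hu t ht).2.2⟩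

/-- The divergence constraint tested with a fixed function at almost every time. -/
theorem ae_integral_gradient_eq_zero (hY : Y.IsAdmissible v₀) {ψ : Eucl n → ℝ}
    (hψ : ContDiff ℝ ∞ ψ) (hψc : HasCompactSupport ψ) :
    ∀ᵐ t ∂(volume.restrict (Ici (0 : ℝ))), ∫ x, ⟪gradient ψ x, Y.barycenter (t, x)⟫ = 0 := by
  have hT : ∀ T : ℝ, ∀ᵐ t, t ∈ Ioo 0 T → ∫ x, ⟪gradient ψ x, Y.barycenter (t, x)⟫ = 0 := by
    intro T
    refine isOpen_Ioo.ae_eq_zero_of_integral_contDiff_smul_eq_zero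
      (integrableOn_integral_inner_barycenter hY
        (gradient_memLp hψ hψc) T).locallyIntegrableOn ?_
    intro χ hχ hχc hχs
    have h := hY.div_free (separated χ ψ) (separated_contDiff hχ hψ) (separated_compact hχc hψc)
      (tsupport_separated_subset.trans
        (prod_mono (hχs.trans Ioo_subset_Ioi_self) (subset_univ _)))
    have hχi : IntegrableOn χ (Ici 0) :=
      (hχ.continuous.integrable_of_hasCompactSupport hχc).integrableOn
    have i1 := integrable_inner_barycenter hY hχi (gradient_memLp hψ hψc)
    have e1 : ∫ z, ⟪Y.barycenter z, spaceGrad (separated χ ψ) z⟫ ∂(spaceTime n)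
        = ∫ z : ℝ × Eucl n, χ z.1 * ⟪gradient ψ z.2, Y.barycenter z⟫ ∂(spaceTime n) := by
      refine integral_congr_ae (Eventually.of_forall fun z => ?_)
      simp only [spaceGrad_separated hψ, real_inner_smul_right]
      rw [real_inner_comm]
    rw [e1] at h
    rw [spaceTime_eq_prod] at i1 h
    rw [integral_prod _ i1] at h
    simp_rw [integral_const_mul] at h
    rw [← h, ← setIntegral_eq_integral_of_forall_compl_eq_zero (s := Ici 0)]
    · rfl
    · intro t ht
      rw [image_eq_zero_of_notMem_tsupport fun h => ht (hχs h).1.le, zero_smul]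
  have hall : ∀ᵐ t : ℝ, ∀ k : ℕ, t ∈ Ioo (0 : ℝ) (k + 1) →
      ∫ x, ⟪gradient ψ x, Y.barycenter (t, x)⟫ = 0 := ae_all_iff.2 fun k => hT _
  rw [← Measure.restrict_congr_set (Ioi_ae_eq_Ici (μ := volume) (a := (0 : ℝ))),
    ae_restrict_iff' measurableSet_Ioi]
  filter_upwards [hall] with t ht h0
  obtain ⟨k, hk⟩ := exists_nat_gt t
  exact ht k ⟨h0, by linarith⟩

/-- At almost every time the barycenter is solenoidal. -/
theorem ae_barycenter_mem_divFree (hY : Y.IsAdmissible v₀) :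
    ∀ᵐ t ∂(volume.restrict (Ici (0 : ℝ))),
      ∀ h : MemLp (fun x => Y.barycenter (t, x)) 2 volume, h.toLp ∈ divFree n := by
  have := secondCountable_L2 n
  have : Nonempty {ψ : Eucl n → ℝ // ContDiff ℝ ∞ ψ ∧ HasCompactSupport ψ} :=
    ⟨⟨0, contDiff_const, HasCompactSupport.zero⟩⟩
  obtain ⟨s, hs⟩ := exists_dense_subfamily
    fun ψ : {ψ : Eucl n → ℝ // ContDiff ℝ ∞ ψ ∧ HasCompactSupport ψ} =>
      ((gradient_memLp ψ.2.1 ψ.2.2).toLp (gradient ψ.1) : L2 n)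
  have hall := ae_all_iff.2 fun k => ae_integral_gradient_eq_zero hY (s k).2.1 (s k).2.2
  filter_upwards [hall] with t ht h
  refine mem_divFree.2 ((isDivFree_iff_inner _).2 fun ψ hψ hc => ?_)
  have hcl : IsClosed {p : L2 n | ⟪p, h.toLp⟫ = 0} :=
    isClosed_eq (continuous_id.inner continuous_const) continuous_const
  refine closure_minimal ?_ hcl (hs ⟨ψ, hψ, hc⟩)
  rintro _ ⟨k, rfl⟩
  refine Eq.trans ?_ (ht k)
  rw [integral_inner_barycenter h]
  refine integral_congr_ae
    ((MemLp.coeFn_toLp (gradient_memLp (s k).2.1 (s k).2.2)).mono fun x hx => ?_)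
  exact congrArg (fun v => ⟪v, Y.barycenter (t, x)⟫) hx

/-- The velocity field is the barycenter at almost every time. -/
theorem ae_eq_barycenter (hY : Y.IsAdmissible v₀) {u : ℝ → L2 n}
    (hu : (Y.stress hY).IsVelocity v₀ u) :
    ∀ᵐ t ∂(volume.restrict (Ici (0 : ℝ))), u t =ᵐ[volume] fun x => Y.barycenter (t, x) := by
  have := secondCountable_L2 n
  obtain ⟨s, hs⟩ := exists_dense_subfamily (testL n)
  have hall := ae_all_iff.2 fun k => ae_inner_barycenter_eq hY (s k)
  filter_upwards [hall, ae_memLp_barycenter hY, ae_barycenter_mem_divFree hY,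
    ae_restrict_mem measurableSet_Ici] with t h1 h2 h3 ht
  obtain ⟨h, -⟩ := h2
  have h0 : u t - h.toLp = 0 := by
    refine eq_zero_of_orthogonal _ (sub_mem (hu.mem t ht) (h3 h)) fun φ => ?_
    have hcl : IsClosed {p : L2 n | ⟪p, u t - h.toLp⟫ = 0} :=
      isClosed_eq (continuous_id.inner continuous_const) continuous_const
    refine closure_minimal ?_ hcl (hs φ)
    rintro _ ⟨k, rfl⟩
    change ⟪testL n (s k), u t - h.toLp⟫ = 0
    rw [inner_sub_right, hu.momentum t ht, ← h1 k, integral_inner_barycenter h, sub_eq_zero]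
    exact integral_congr_ae ((testL_coeFn (s k)).mono fun x hx => by simp only [hx])
  rw [sub_eq_zero.1 h0]
  exact h.coeFn_toLp

end GeneralizedYoungMeasure

/-! ### The lower bound for the stresses -/

namespace GeneralizedYoungMeasure

variable {n : ℕ} {Y : GeneralizedYoungMeasure n} {v₀ : L2 n}

/-- Integration over a slab of a function dominated by the energy density. -/
theorem integrable_slab (hY : Y.IsAdmissible v₀) {t : ℝ} {h : ℝ → ℝ} (hh : IntegrableOn h (Ioc 0 t))
    {f : ℝ × Eucl n → ℝ}
    (hf : AEStronglyMeasurable f ((volume.restrict (Ioc 0 t)).prod volume))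
    (hle : ∀ᵐ z ∂((volume.restrict (Ioc 0 t)).prod volume), |f z| ≤ h z.1 * Y.energyDensity z) :
    Integrable f ((volume.restrict (Ioc 0 t)).prod volume) := by
  have h1 : IntegrableOn ((Ioc 0 t).indicator h) (Ici 0) :=
    ((integrable_indicator_iff measurableSet_Ioc).2 hh).integrableOn
  have h2 := integrable_mul_energy hY h1
  have h3 : (volume.restrict (Ioc 0 t)).prod (volume : Measure (Eucl n)) ≤ spaceTime n := by
    rw [spaceTime_eq_prod]
    exact Measure.prod_mono (Measure.restrict_mono (fun s hs => hs.1.le) le_rfl) le_rfl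
  refine (h2.mono_measure h3).mono' hf ?_
  have h4 : ∀ᵐ z ∂((volume.restrict (Ioc 0 t)).prod (volume : Measure (Eucl n))), z.1 ∈ Ioc 0 t :=
    Measure.quasiMeasurePreserving_fst.ae (ae_restrict_mem measurableSet_Ioc)
  filter_upwards [hle, h4] with z hz hzt
  rw [indicator_of_mem hzt]
  exact hz

variable {t : ℝ} {w u : ℝ → L2 n} {κ : ℝ → ℝ}

/-- Lower bound for the stresses against the gradients of a mollified comparison field. On the
oscillations it is Jensen's inequality, on the concentrations the bound on the quadratic form, and
the resulting total energy is controlled by the energy inequality. The integrability is stated as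
well, so that the integrals compared are genuine. -/
theorem stress_lower_bound (hY : Y.IsAdmissible v₀) (hu : (Y.stress hY).IsVelocity v₀ u)
    (b : ContDiffBump (0 : Eucl n)) (hwc : ContinuousOn w (Icc 0 t))
    (hκ : IntegrableOn κ (Ioc 0 t)) (hκ0 : ∀ s, 0 ≤ κ s)
    (hquad : ∀ᵐ s ∂(volume.restrict (Ioc 0 t)), ∀ x ξ : Eucl n,
      - κ s * ‖ξ‖ ^ 2 ≤ ⟪fderiv ℝ (moll b (w s)) x ξ, ξ⟫)
    (hint : IntegrableOn (fun z => contract (jac (moll b (w ((Y.stress hY).time z)))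
      ((Y.stress hY).pos z)) ((Y.stress hY).Θ z))
        ((Y.stress hY).time ⁻¹' Iic t) (Y.stress hY).τ) :
    IntegrableOn (fun s => ⟪mulLin (memLp_top_fderiv_moll b (w s)) (u s), u s⟫) (Ioc 0 t) ∧
      ∫ s in Ioc 0 t, (⟪mulLin (memLp_top_fderiv_moll b (w s)) (u s), u s⟫
          + κ s * (‖u s‖ ^ 2 - ‖v₀‖ ^ 2))
        ≤ ∫ z in (Y.stress hY).time ⁻¹' Iic t, contract (jac (moll b (w ((Y.stress hY).time z)))
            ((Y.stress hY).pos z)) ((Y.stress hY).Θ z) ∂(Y.stress hY).τ := by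
  set M := Y.stress hY with hM
  have hle : (volume.restrict (Ioc 0 t)) ≤ volume.restrict (Ici 0) :=
    Measure.restrict_mono (fun s hs => hs.1.le) le_rfl
  have hle2 : (volume.restrict (Ioc 0 t)).prod (volume : Measure (Eucl n)) ≤ spaceTime n := by
    rw [spaceTime_eq_prod]
    exact Measure.prod_mono hle le_rfl
  obtain ⟨K, hK⟩ := isCompact_Icc.exists_bound_of_continuousOn hwc
  have hg0 := gradConst_nonneg b
  set σ : Measure (ℝ × Eucl n) := (volume.restrict (Ioc 0 t)).prod volume with hσ
  have hfst : ∀ᵐ z ∂σ, z.1 ∈ Ioc 0 t :=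
    Measure.quasiMeasurePreserving_fst.ae (ae_restrict_mem measurableSet_Ioc)
  have hbm : AEStronglyMeasurable Y.barycenter σ := Y.aestronglyMeasurable_barycenter.mono_measure hle2
  have hbE : ∀ᵐ z ∂σ, ‖Y.barycenter z‖ ^ 2 ≤ Y.energyDensity z :=
    ae_mono hle2 Y.ae_norm_sq_barycenter_le
  -- the quadratic terms in the barycenter
  set q : ℝ × Eucl n → ℝ := fun z => contract (jac (moll b (w z.1)) z.2)
    (fun i j => Y.barycenter z i * Y.barycenter z j) with hq
  set r : ℝ × Eucl n → ℝ := fun z => κ z.1 * ‖Y.barycenter z‖ ^ 2 with hr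
  have hqi : Integrable q σ := by
    refine integrable_slab hY (h := fun _ => n * n * (gradConst b * K))
      continuous_const.integrableOn_Ioc ?_ ?_
    · have h1 : AEStronglyMeasurable (fun z : ℝ × Eucl n => w z.1) σ :=
        ((hwc.mono Ioc_subset_Icc_self).aestronglyMeasurable measurableSet_Ioc).comp_fst
      have h2 := aestronglyMeasurable_jac_moll b h1 measurable_snd.aestronglyMeasurable
      have h3 : ∀ i, AEStronglyMeasurable (fun z => Y.barycenter z i) σ := fun i =>
        (EuclideanSpace.proj (𝕜 := ℝ) i).continuous.comp_aestronglyMeasurable hbm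
      rw [hq]
      unfold contract
      exact Finset.aestronglyMeasurable_fun_sum _ fun i _ =>
        Finset.aestronglyMeasurable_fun_sum _ fun j _ => (h2 i j).mul ((h3 i).mul (h3 j))
    · filter_upwards [hbE, hfst] with z h1 h2
      refine abs_contract_le (fun i j => (abs_jac_moll_le b _ _ i j).trans ?_) fun i j => ?_
      · gcongr
        exact hK _ (Ioc_subset_Icc_self h2)
      · refine le_trans ?_ h1
        rw [abs_mul, sq]
        exact mul_le_mul (abs_coord_le _ i) (abs_coord_le _ j) (abs_nonneg _) (norm_nonneg _)
  have hri : Integrable r σ := by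
    refine integrable_slab hY hκ (hκ.1.comp_fst.mul (hbm.norm.pow 2)) ?_
    filter_upwards [hbE] with z h1
    rw [abs_of_nonneg (mul_nonneg (hκ0 _) (by positivity))]
    exact mul_le_mul_of_nonneg_left h1 (hκ0 _)
  have hub : ∀ᵐ s ∂(volume.restrict (Ioc 0 t)), u s =ᵐ[volume] fun x => Y.barycenter (s, x) :=
    ae_mono hle (ae_eq_barycenter hY hu)
  have hq1 : ∀ᵐ s ∂(volume.restrict (Ioc 0 t)),
      ∫ x, q (s, x) = ⟪mulLin (memLp_top_fderiv_moll b (w s)) (u s), u s⟫ := by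
    filter_upwards [hub] with s hs
    rw [inner_mulLin]
    refine integral_congr_ae (hs.mono fun x hx => ?_)
    simp only [hx]
    exact contract_jac_eq_inner _ _ _ _
  have hr1 : ∀ᵐ s ∂(volume.restrict (Ioc 0 t)), ∫ x, r (s, x) = κ s * ‖u s‖ ^ 2 := by
    filter_upwards [hub] with s hs
    change ∫ x, κ s * ‖Y.barycenter (s, x)‖ ^ 2 = _
    rw [integral_const_mul, ← integral_norm_sq_eq]
    congr 1
    exact integral_congr_ae (hs.mono fun x hx => by simp only [hx])
  have hq2 : IntegrableOn (fun s => ⟪mulLin (memLp_top_fderiv_moll b (w s)) (u s), u s⟫) (Ioc 0 t) :=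
    hqi.integral_prod_left.congr hq1
  have hr2 : IntegrableOn (fun s => κ s * ‖u s‖ ^ 2) (Ioc 0 t) := hri.integral_prod_left.congr hr1
  refine ⟨hq2, ?_⟩
  have hκV : IntegrableOn (fun s => κ s * ‖v₀‖ ^ 2) (Ioc 0 t) := hκ.mul_const _
  -- restriction to positive times
  set P : Set ((ℝ × Eucl n) ⊕ (ℝ × Eucl n)) := M.time ⁻¹' Ioc 0 t with hP
  have hPm : MeasurableSet P := M.measurable_time measurableSet_Ioc
  have hpos : ∀ᵐ z ∂M.τ, 0 < M.time z := by
    refine M.time_qmp.ae ?_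
    rw [← Measure.restrict_congr_set (Ioi_ae_eq_Ici (μ := volume) (a := (0 : ℝ)))]
    exact ae_restrict_mem measurableSet_Ioi
  have hPae : P =ᵐ[M.τ] M.time ⁻¹' Iic t := by
    refine eventuallyEq_set.2 ?_
    filter_upwards [hpos] with z hz
    exact ⟨fun h => h.2, fun h => ⟨hz, h⟩⟩
  rw [← setIntegral_congr_set hPae]
  rw [← integrableOn_congr_set_ae hPae] at hint
  -- the total energy
  have hκ' : IntegrableOn ((Ioc 0 t).indicator κ) (Ici 0) :=
    ((integrable_indicator_iff measurableSet_Ioc).2 hκ).integrableOn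
  have hκe : ∀ z, P.indicator (fun z => κ (M.time z) * M.e z) z
      = (Ioc 0 t).indicator κ (M.time z) * M.e z := by
    intro z
    by_cases hz : M.time z ∈ Ioc 0 t
    · rw [indicator_of_mem (show z ∈ P from hz), indicator_of_mem hz]
    · rw [indicator_of_notMem (show z ∉ P from hz), indicator_of_notMem hz, zero_mul]
  have hei : IntegrableOn (fun z => κ (M.time z) * M.e z) P M.τ := by
    rw [← integrable_indicator_iff hPm]
    exact (M.integrable_time_mul hκ').congr (Eventually.of_forall fun z => (hκe z).symm)
  have henergy : ∫ z in P, κ (M.time z) * M.e z ∂M.τ ≤ ∫ s in Ioc 0 t, κ s * ‖v₀‖ ^ 2 := by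
    have h1 := M.integral_time_mul_le hκ' (indicator_nonneg fun s _ => hκ0 s)
    have h2 : ∫ s in Ici 0, (Ioc 0 t).indicator κ s = ∫ s in Ioc 0 t, κ s := by
      rw [setIntegral_indicator measurableSet_Ioc,
        inter_eq_self_of_subset_right fun s hs => hs.1.le]
    rw [← integral_indicator hPm, integral_mul_const, ← h2, mul_comm]
    refine le_of_eq_of_le (integral_congr_ae (Eventually.of_forall hκe)) h1
  -- the quadratic terms as an integral over the oscillation part
  set B : (ℝ × Eucl n) ⊕ (ℝ × Eucl n) → ℝ := Sum.elim (fun z => q z + r z) fun _ => 0 with hB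
  have hPl : ∀ z, P.indicator B (Sum.inl z) = (Ioc 0 t ×ˢ univ).indicator (fun z => q z + r z) z := by
    intro z
    by_cases hz : z.1 ∈ Ioc 0 t
    · rw [indicator_of_mem (show Sum.inl z ∈ P from hz),
        indicator_of_mem (show z ∈ Ioc 0 t ×ˢ univ from ⟨hz, mem_univ _⟩)]
      rfl
    · rw [indicator_of_notMem (show Sum.inl z ∉ P from hz),
        indicator_of_notMem fun h : z ∈ Ioc 0 t ×ˢ univ => hz h.1]
  have hPr : ∀ z, P.indicator B (Sum.inr z) = 0 := by
    intro z
    by_cases hz : Sum.inr z ∈ P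
    · rw [indicator_of_mem hz]
      rfl
    · rw [indicator_of_notMem hz]
  have hIoc : Ioc 0 t ∩ Ici (0 : ℝ) = Ioc 0 t :=
    inter_eq_self_of_subset_left fun s hs => le_of_lt hs.1
  have hslab : (spaceTime n).restrict (Ioc 0 t ×ˢ univ) = σ := by
    rw [spaceTime, Measure.restrict_restrict (measurableSet_Ioc.prod MeasurableSet.univ),
      prod_inter_prod, hIoc,
      univ_inter, restrict_slab]
  have hslm : MeasurableSet (Ioc 0 t ×ˢ (univ : Set (Eucl n))) :=
    measurableSet_Ioc.prod MeasurableSet.univ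
  have hqr : IntegrableOn (fun z => q z + r z) (Ioc 0 t ×ˢ univ) (spaceTime n) := by
    rw [IntegrableOn, hslab]
    exact hqi.add hri
  have hBi : Integrable (P.indicator B) M.τ := by
    change Integrable _ Y.reference
    rw [reference, integrable_add_measure, measurableEmbedding_inl.integrable_map_iff,
      measurableEmbedding_inr.integrable_map_iff]
    refine ⟨?_, ?_⟩
    · exact ((integrable_indicator_iff hslm).2 hqr).congr
        (Eventually.of_forall fun z => (hPl z).symm)
    · exact (integrable_zero _ _ _).congr (Eventually.of_forall fun z => (hPr z).symm)
  have hBint : ∫ z in P, B z ∂M.τ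
      = ∫ s in Ioc 0 t, (⟪mulLin (memLp_top_fderiv_moll b (w s)) (u s), u s⟫
          + κ s * ‖u s‖ ^ 2) := by
    rw [← integral_indicator hPm]
    refine (Y.integral_reference hBi).trans ?_
    simp_rw [hPl, hPr]
    rw [integral_zero, add_zero, integral_indicator hslm, hslab, integral_add hqi hri,
      integral_prod _ hqi, integral_prod _ hri, integral_congr_ae hq1, integral_congr_ae hr1,
      ← integral_add hq2 hr2]
  have hmain : ∫ z in P, (B z - κ (M.time z) * M.e z) ∂M.τ
      ≤ ∫ z in P, contract (jac (moll b (w (M.time z))) (M.pos z)) (M.Θ z) ∂M.τ := by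
    refine integral_mono_ae (((integrable_indicator_iff hPm).1 hBi).sub hei) hint ?_
    refine (ae_restrict_iff' hPm).2 ?_
    have hqt : ∀ᵐ z ∂M.τ, M.time z ∈ Ioc 0 t → ∀ x ξ : Eucl n,
        - κ (M.time z) * ‖ξ‖ ^ 2 ≤ ⟪fderiv ℝ (moll b (w (M.time z))) x ξ, ξ⟫ :=
      M.time_qmp.ae (ae_restrict_of_ae ((ae_restrict_iff' measurableSet_Ioc).1 hquad))
    have hqt' := Y.ae_reference_iff.1 hqt
    refine Y.ae_reference_iff.2 ⟨?_, ?_⟩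
    · filter_upwards [hqt'.1, Y.ae_integrable_sq, Y.osc_prob] with z h1 h2 h3 hz
      have h4 := contract_second_moment_ge h2 (fderiv ℝ (moll b (w z.1)) z.2) (h1 hz z.2)
      have h5 : q z = ⟪fderiv ℝ (moll b (w z.1)) z.2 (Y.barycenter z), Y.barycenter z⟫ :=
        contract_jac_eq_inner _ _ _ _
      change q z + κ z.1 * ‖Y.barycenter z‖ ^ 2 - κ z.1 * Y.energyDensity z ≤ _
      rw [h5]
      exact h4
    · filter_upwards [hqt'.2, Y.angle_prob] with z h1 h2 hz
      have h4 := contract_sphere_moment_ge (m := Y.angle z) (fderiv ℝ (moll b (w z.1)) z.2)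
        (h1 hz z.2)
      change (0 : ℝ) - κ z.1 * 1 ≤ _
      refine le_trans (le_of_eq ?_) h4
      change (0 : ℝ) - κ z.1 * 1 = -κ z.1
      ring
  refine le_trans ?_ hmain
  rw [integral_sub ((integrable_indicator_iff hPm).1 hBi) hei, hBint]
  refine le_trans ?_ (sub_le_sub_left henergy _)
  have hqr2 : IntegrableOn (fun s => ⟪mulLin (memLp_top_fderiv_moll b (w s)) (u s), u s⟫
      + κ s * ‖u s‖ ^ 2) (Ioc 0 t) := hq2.add hr2
  rw [← integral_sub hqr2 hκV]
  refine le_of_eq (integral_congr_ae (Eventually.of_forall fun s => ?_))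
  ring

end GeneralizedYoungMeasure

/-! ### The relative energy inequality -/

section

variable {n : ℕ} {T t : ℝ} {w : ℝ → L2 n} {S : ℝ × Eucl n → (Eucl n →L[ℝ] Eucl n)}

theorem ae_Ioc_of_ae_Ioo (ht : t ≤ T) {p : ℝ → Prop} (h : ∀ᵐ s ∂(volume.restrict (Ioo 0 T)), p s) :
    ∀ᵐ s ∂(volume.restrict (Ioc 0 t)), p s := by
  rw [← Measure.restrict_congr_set (Ioo_ae_eq_Ioc (μ := volume) (a := (0 : ℝ)) (b := t))]
  exact ae_mono (Measure.restrict_mono (Ioo_subset_Ioo le_rfl ht) le_rfl) h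

theorem integrableOn_Ioc_of_Ioo {F : Type*} [NormedAddCommGroup F] (ht : t ≤ T) {g : ℝ → F}
    (h : IntegrableOn g (Ioo 0 T)) : IntegrableOn g (Ioc 0 t) := by
  rw [integrableOn_Ioc_iff_integrableOn_Ioo]
  exact h.mono_set (Ioo_subset_Ioo le_rfl ht)

/-- The relative energy bound `‖v₀‖² - 2 ⟪w, u⟫ + ‖w‖²`, weighted by an integrable function, is
integrable. -/
theorem StressMeasure.IsVelocity.integrableOn_mul_relative {V : ℝ} {Z : Type*} [MeasurableSpace Z]
    {M : StressMeasure n V Z} {v₀ : L2 n} {u : ℝ → L2 n} (hu : M.IsVelocity v₀ u) {κ : ℝ → ℝ}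
    (hw : ContinuousOn w (Icc 0 t)) (hκ : IntegrableOn κ (Ioc 0 t)) :
    IntegrableOn (fun s => κ s * (‖v₀‖ ^ 2 - 2 * ⟪w s, u s⟫ + ‖w s‖ ^ 2)) (Ioc 0 t) := by
  obtain ⟨K, hK⟩ := isCompact_Icc.exists_bound_of_continuousOn hw
  have hum : AEStronglyMeasurable u (volume.restrict (Ioc 0 t)) :=
    hu.aestronglyMeasurable.mono_measure
      (Measure.restrict_mono (Ioc_subset_Ioi_self.trans Ioi_subset_Ici_self) le_rfl)
  have hwm : AEStronglyMeasurable w (volume.restrict (Ioc 0 t)) :=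
    (hw.mono Ioc_subset_Icc_self).aestronglyMeasurable measurableSet_Ioc
  refine Integrable.mul_bdd (c := ‖v₀‖ ^ 2 + 2 * (K * ‖v₀‖) + K ^ 2) hκ
    ((aestronglyMeasurable_const.sub ((hwm.inner hum).const_mul 2)).add (hwm.norm.pow 2)) ?_
  filter_upwards [ae_restrict_mem measurableSet_Ioc] with s hs
  have h1 := hK s (Ioc_subset_Icc_self hs)
  have h2 := hu.norm_le s hs.1.le
  have h3 : |⟪w s, u s⟫| ≤ K * ‖v₀‖ :=
    (abs_real_inner_le_norm _ _).trans (mul_le_mul h1 h2 (norm_nonneg _) ((norm_nonneg _).trans h1))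
  have h4 : ‖w s‖ ^ 2 ≤ K ^ 2 := by gcongr
  rw [Real.norm_eq_abs, abs_le]
  obtain ⟨h5, h6⟩ := abs_le.1 h3
  constructor <;> nlinarith [sq_nonneg ‖w s‖, sq_nonneg ‖v₀‖]

end

namespace GeneralizedYoungMeasure

variable {n : ℕ} {Y : GeneralizedYoungMeasure n} {v₀ : L2 n} {u w f : ℝ → L2 n}
  {S : ℝ × Eucl n → (Eucl n →L[ℝ] Eucl n)} {T t : ℝ}

/-- The evolution of the pairing of the velocity with a comparison field. The comparison field is
mollified in space to be admissible as a test field, and the mollification is removed after the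
stresses have been estimated from below. -/
theorem inner_evolution_ge (hY : Y.IsAdmissible v₀) (hu : (Y.stress hY).IsVelocity v₀ u)
    (hT : 0 < T) (hw : ContinuousOn w (Icc 0 T)) (hdiv : ∀ t ∈ Icc 0 T, IsDivFree (w t))
    (hS : IsSymGrad T w S) (hf : IsResidual T w f) (ht : t ∈ Icc 0 T) :
    ∫ s in Ioc 0 t, (-⟪f s, u s⟫
        - negPartNorm S s * (‖v₀‖ ^ 2 - 2 * ⟪w s, u s⟫ + ‖w s‖ ^ 2))
      ≤ ⟪w t, u t⟫ - ⟪w 0, v₀⟫ := by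
  classical
  have hwt : ContinuousOn w (Icc 0 t) := hw.mono (Icc_subset_Icc le_rfl ht.2)
  have hsub : Ioc 0 t ⊆ Ici (0 : ℝ) := Ioc_subset_Ioi_self.trans Ioi_subset_Ici_self
  set κ := negPartNorm S with hκdef
  have hκ : IntegrableOn κ (Ioc 0 t) := integrableOn_Ioc_of_Ioo ht.2 hS.integrable_negPartNorm
  have hκ0 : ∀ s, 0 ≤ κ s := negPartNorm_nonneg
  set C : ℝ → ℝ := fun s => (eLpNorm (fun x => S (s, x)) ⊤ volume).toReal with hC
  have hCi : IntegrableOn C (Ioc 0 t) := integrableOn_Ioc_of_Ioo ht.2 hS.integrable_norm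
  have hA : ∀ᵐ s ∂(volume.restrict (Ioc 0 t)), IsSymGradAt (w s) fun x => S (s, x) :=
    ae_Ioc_of_ae_Ioo ht.2 (hS.ae_isSymGradAt hw)
  set g := fieldDeriv w f S with hg
  have hgi : IntegrableOn g (Ioc 0 t) :=
    integrableOn_Ioc_of_Ioo ht.2 (integrableOn_fieldDeriv hw hdiv hS hf)
  have hgd : ∀ᵐ s ∂(volume.restrict (Ioc 0 t)), g s ∈ divFree n :=
    ae_Ioc_of_ae_Ioo ht.2 (fieldDeriv_mem hf)
  have hwg : ∀ s ∈ Icc 0 t, w s = w 0 + ∫ r in (0 : ℝ)..s, g r := fun s hs =>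
    eq_add_integral_fieldDeriv hT hw hdiv hS hf ⟨hs.1, hs.2.trans ht.2⟩
  have hum : AEStronglyMeasurable u (volume.restrict (Ioc 0 t)) :=
    hu.aestronglyMeasurable.mono_measure (Measure.restrict_mono hsub le_rfl)
  have hdef : ∀ s ∈ Ioc 0 t, |‖u s‖ ^ 2 - ‖v₀‖ ^ 2| ≤ ‖v₀‖ ^ 2 := by
    intro s hs
    have h1 : ‖u s‖ ^ 2 ≤ ‖v₀‖ ^ 2 := by
      gcongr
      exact hu.norm_le s hs.1.le
    rw [abs_le]
    constructor <;> nlinarith [sq_nonneg ‖u s‖]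
  have hκu : IntegrableOn (fun s => κ s * (‖u s‖ ^ 2 - ‖v₀‖ ^ 2)) (Ioc 0 t) := by
    refine Integrable.mul_bdd (c := ‖v₀‖ ^ 2) hκ
      ((hum.norm.pow 2).sub aestronglyMeasurable_const) ?_
    filter_upwards [ae_restrict_mem measurableSet_Ioc] with s hs
    exact hdef s hs
  -- the inequality for the mollified comparison field
  set G : ℕ → ℝ → ℝ := fun m s => ⟪mollL (bumpSeq n m) (g s), u s⟫
    + (⟪mulLin (memLp_top_fderiv_moll (bumpSeq n m) (w s)) (u s), u s⟫
      + κ s * (‖u s‖ ^ 2 - ‖v₀‖ ^ 2)) with hG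
  have hstep : ∀ m, IntegrableOn (G m) (Ioc 0 t) ∧ ∫ s in Ioc 0 t, G m s
      ≤ ⟪mollL (bumpSeq n m) (w t), u t⟫ - ⟪mollL (bumpSeq n m) (w 0), v₀⟫ := by
    intro m
    obtain ⟨hint, hev⟩ := hu.inner_moll_evolution (bumpSeq n m) ht.1
      ((intervalIntegrable_iff_integrableOn_Ioc_of_le ht.1).2 hgi) hwg hwt
      (fun s hs => mem_divFree.2 (hdiv s ⟨hs.1, hs.2.trans ht.2⟩)) hgd
    have hquad : ∀ᵐ s ∂(volume.restrict (Ioc 0 t)), ∀ x ξ : Eucl n,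
        - κ s * ‖ξ‖ ^ 2 ≤ ⟪fderiv ℝ (moll (bumpSeq n m) (w s)) x ξ, ξ⟫ := by
      filter_upwards [hA] with s hs x ξ
      rw [hs.quad]
      exact quad_moll_ge _ hs.memLp x ξ
    obtain ⟨hqi, hlow⟩ := stress_lower_bound hY hu (bumpSeq n m) hwt hκ hκ0 hquad hint
    have h1 : IntegrableOn (fun s => ⟪mollL (bumpSeq n m) (g s), u s⟫) (Ioc 0 t) :=
      hu.integrableOn_inner ((mollL (bumpSeq n m)).integrable_comp hgi) measurableSet_Ioc hsub
    have h2 : IntegrableOn (fun s => ⟪mulLin (memLp_top_fderiv_moll (bumpSeq n m) (w s)) (u s), u s⟫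
      + κ s * (‖u s‖ ^ 2 - ‖v₀‖ ^ 2)) (Ioc 0 t) := hqi.add hκu
    refine ⟨h1.add h2, ?_⟩
    rw [hev, hG, integral_add h1 h2, intervalIntegral.integral_of_le ht.1]
    exact add_le_add_right hlow _
  -- the limit of the integrands
  set q : ℝ → ℝ := fun s => if h : IsSymGradAt (w s) fun x => S (s, x) then
    ⟪mulLin h.memLp (u s), u s⟫ else 0 with hq
  set G' : ℝ → ℝ := fun s => ⟪g s, u s⟫ + (q s + κ s * (‖u s‖ ^ 2 - ‖v₀‖ ^ 2)) with hG'
  have hGq : ∀ m s, ∀ h : IsSymGradAt (w s) fun x => S (s, x),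
      ⟪mulLin (memLp_top_fderiv_moll (bumpSeq n m) (w s)) (u s), u s⟫
        = ⟪mulLin (memLp_top_moll (bumpSeq n m) h.memLp) (u s), u s⟫ := by
    intro m s h
    rw [inner_mulLin, inner_mulLin]
    exact integral_congr_ae (Eventually.of_forall fun x => h.quad m x _)
  have hlim : ∀ᵐ s ∂(volume.restrict (Ioc 0 t)), Tendsto (fun m => G m s) atTop (𝓝 (G' s)) := by
    filter_upwards [hA] with s hs
    refine ((mollL_tendsto (g s)).inner tendsto_const_nhds).add (Tendsto.add_const _ ?_)
    simp only [hq, dif_pos hs, hGq _ s hs]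
    exact (mulLin_moll_tendsto hs.memLp (u s)).inner tendsto_const_nhds
  set B : ℝ → ℝ := fun s => ‖g s‖ * ‖v₀‖ + (C s * ‖v₀‖ ^ 2 + κ s * ‖v₀‖ ^ 2) with hB
  have hBi : IntegrableOn B (Ioc 0 t) :=
    (hgi.norm.mul_const _).add ((hCi.mul_const _).add (hκ.mul_const _))
  have hbound : ∀ m, ∀ᵐ s ∂(volume.restrict (Ioc 0 t)), ‖G m s‖ ≤ B s := by
    intro m
    filter_upwards [hA, ae_restrict_mem measurableSet_Ioc] with s hs hst
    have hus := hu.norm_le s hst.1.le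
    have hC0 : 0 ≤ C s := ENNReal.toReal_nonneg
    refine (norm_add_le _ _).trans (add_le_add ?_ ((norm_add_le _ _).trans (add_le_add ?_ ?_)))
    · exact (norm_inner_le_norm _ _).trans (mul_le_mul (mollL_norm_le _ _) hus (norm_nonneg _)
        (norm_nonneg _))
    · rw [hGq m s hs]
      refine (norm_inner_le_norm _ _).trans ?_
      have h1 := mulLin_norm_le (memLp_top_moll (bumpSeq n m) hs.memLp)
        (Eventually.of_forall (norm_moll_le (bumpSeq n m) (ae_norm_le_eLpNorm_top hs.memLp.2))) (u s)
      calc _ ≤ (C s * ‖u s‖) * ‖u s‖ := by gcongr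
        _ = C s * ‖u s‖ ^ 2 := by ring
        _ ≤ C s * ‖v₀‖ ^ 2 := by gcongr
    · rw [norm_mul, Real.norm_of_nonneg (hκ0 s)]
      exact mul_le_mul_of_nonneg_left (hdef s hst) (hκ0 s)
  have hconv : Tendsto (fun m => ∫ s in Ioc 0 t, G m s) atTop (𝓝 (∫ s in Ioc 0 t, G' s)) :=
    tendsto_integral_of_dominated_convergence B (fun m => (hstep m).1.1) hBi hbound hlim
  have hG'i : IntegrableOn G' (Ioc 0 t) := by
    refine Integrable.mono' hBi
      (aestronglyMeasurable_of_tendsto_ae atTop (fun m => (hstep m).1.1) hlim) ?_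
    filter_upwards [hlim, ae_all_iff.2 hbound] with s h1 h2
    exact le_of_tendsto h1.norm (Eventually.of_forall h2)
  have hlimit : ∫ s in Ioc 0 t, G' s ≤ ⟪w t, u t⟫ - ⟪w 0, v₀⟫ :=
    le_of_tendsto_of_tendsto' hconv
      (((mollL_tendsto (w t)).inner tendsto_const_nhds).sub
        ((mollL_tendsto (w 0)).inner tendsto_const_nhds)) fun m => (hstep m).2
  refine le_trans (integral_mono_ae ?_ hG'i ?_) hlimit
  · exact (hu.integrableOn_inner (integrableOn_Ioc_of_Ioo ht.2 hf.integrable) measurableSet_Ioc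
      hsub).neg.sub (hu.integrableOn_mul_relative hwt hκ)
  · filter_upwards [hA, ae_restrict_mem measurableSet_Ioc] with s hs hst
    have h1 := hs.relative_quad_ge (hdiv s ⟨hst.1.le, hst.2.trans ht.2⟩) (u s)
    have h2 := inner_fieldDeriv (f := f) hs (hu.mem s hst.1.le)
    have h3 : q s = ⟪mulLin hs.memLp (u s), u s⟫ := dif_pos hs
    have h4 : negSup (fun x => S (s, x)) = κ s := rfl
    simp only [hG', hg, h2, h3]
    rw [h4, norm_sub_sq_real, real_inner_comm] at h1
    linarith

/-- The velocity of an admissible measure-valued solution is a dissipative solution: Grönwall's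
inequality applies to the relative energy. -/
theorem isDissipativeSolution_of_isVelocity (hY : Y.IsAdmissible v₀) (hv₀ : IsDivFree v₀)
    (hu : (Y.stress hY).IsVelocity v₀ u) : IsDissipativeSolution v₀ u where
  bounded := ⟨‖v₀‖, hu.norm_le⟩
  weak_cont := hu.weak_cont
  initial := hu.initial hv₀
  div_free t ht := mem_divFree.1 (hu.mem t ht)
  dissipation T w f S hT hw hdiv hS hf t ht := by
    have hwt : ContinuousOn w (Icc 0 t) := hw.mono (Icc_subset_Icc le_rfl ht.2)
    have hκ : IntegrableOn (negPartNorm S) (Ioc 0 t) :=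
      integrableOn_Ioc_of_Ioo ht.2 hS.integrable_negPartNorm
    have hfi : IntegrableOn f (Ioc 0 t) := integrableOn_Ioc_of_Ioo ht.2 hf.integrable
    have hsub : Ioc 0 t ⊆ Ici (0 : ℝ) := Ioc_subset_Ioi_self.trans Ioi_subset_Ici_self
    have hfu : IntegrableOn (fun s => ⟪f s, u s⟫) (Ioc 0 t) :=
      hu.integrableOn_inner hfi measurableSet_Ioc hsub
    have hfw : IntegrableOn (fun s => ⟪f s, w s⟫) (Ioc 0 t) := by
      obtain ⟨K, hK⟩ := isCompact_Icc.exists_bound_of_continuousOn hwt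
      refine (hfi.norm.mul_const K).mono' (hfi.1.inner
        ((hwt.mono Ioc_subset_Icc_self).aestronglyMeasurable measurableSet_Ioc)) ?_
      filter_upwards [ae_restrict_mem measurableSet_Ioc] with s hs
      refine (norm_inner_le_norm _ _).trans ?_
      gcongr
      exact hK s (Ioc_subset_Icc_self hs)
    -- the relative energy, with `‖u s‖²`, for which there is no evolution equation, replaced by its
    -- upper bound `‖v₀‖²`; at time zero nothing is lost
    set F : ℝ → ℝ := fun s => ‖v₀‖ ^ 2 - 2 * ⟪w s, u s⟫ + ‖w s‖ ^ 2 with hF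
    have hκF : IntegrableOn (fun s => negPartNorm S s * F s) (Ioc 0 t) :=
      hu.integrableOn_mul_relative hwt hκ
    have hh : IntegrableOn (fun s => 2 * ⟪f s, u s - w s⟫) (Ioc 0 t) := by
      simp only [inner_sub_right]
      exact (hfu.sub hfw).const_mul 2
    have hI : ∀ {h : ℝ → ℝ}, IntegrableOn h (Ioc 0 t) → IntervalIntegrable h volume 0 t :=
      fun h => (intervalIntegrable_iff_integrableOn_Ioc_of_le ht.1).2 h
    have hineq : ∀ s ∈ Icc 0 t, F s ≤ ‖v₀ - w 0‖ ^ 2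
        + ∫ r in (0 : ℝ)..s, (2 * negPartNorm S r * F r + 2 * ⟪f r, u r - w r⟫) := by
      intro s hs
      have hss : Ioc 0 s ⊆ Ioc 0 t := Ioc_subset_Ioc le_rfl hs.2
      have h1 := inner_evolution_ge hY hu hT hw hdiv hS hf ⟨hs.1, hs.2.trans ht.2⟩
      have h2 := norm_sq_sub_eq hT hw hdiv hS hf ⟨hs.1, hs.2.trans ht.2⟩
      rw [intervalIntegral.integral_of_le hs.1] at h2 ⊢
      have h3 : ∫ r in Ioc 0 s, (2 * negPartNorm S r * F r + 2 * ⟪f r, u r - w r⟫)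
          = -2 * (∫ r in Ioc 0 s, (-⟪f r, u r⟫ - negPartNorm S r * F r))
            + ∫ r in Ioc 0 s, -2 * ⟪f r, w r⟫ := by
        rw [← integral_const_mul, ← integral_add]
        · refine integral_congr_ae (Eventually.of_forall fun r => ?_)
          simp only [inner_sub_right]
          ring
        · exact (((hfu.mono_set hss).neg).sub (hκF.mono_set hss)).const_mul _
        · exact (hfw.mono_set hss).const_mul _
      rw [h3, ← h2, norm_sub_sq_real, real_inner_comm]
      simp only [hF] at h1 ⊢
      linarith
    have hκF2 : IntegrableOn (fun s => 2 * negPartNorm S s * F s) (Ioc 0 t) := by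
      simp only [mul_assoc]
      exact hκF.const_mul 2
    have key := gronwall_integral (κ := fun s => 2 * negPartNorm S s) ht.1
      (fun s => mul_nonneg zero_le_two (negPartNorm_nonneg s)) (hI (hκ.const_mul 2)) (hI hh)
      (hI hκF2) hineq
    have hFt : ‖u t - w t‖ ^ 2 ≤ F t := by
      have h1 : ‖u t‖ ^ 2 ≤ ‖v₀‖ ^ 2 := by
        gcongr
        exact hu.norm_le t ht.1
      rw [norm_sub_sq_real, real_inner_comm]
      simp only [hF]
      linarith
    refine hFt.trans (key.trans_eq ?_)
    simp only [intervalIntegral.integral_const_mul]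
    congr 1
    rw [← intervalIntegral.integral_const_mul]
    refine intervalIntegral.integral_congr fun s _ => ?_
    ring

end GeneralizedYoungMeasure

/-- The barycenter of an admissible measure-valued solution is, after redefinition on a null set of
times, a dissipative solution in the sense of Lions. -/
theorem proposition3p4 (n : ℕ) (v₀ : L2 n) (hv₀ : IsDivFree v₀)
    (Y : GeneralizedYoungMeasure n) (hY : Y.IsAdmissible v₀) :
    ∃ u : ℝ → L2 n,
      (∀ᵐ t ∂(volume.restrict (Ici (0 : ℝ))), u t =ᵐ[volume] fun x => Y.barycenter (t, x)) ∧
      IsDissipativeSolution v₀ u := by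
  obtain ⟨u, hu⟩ := GeneralizedYoungMeasure.exists_isVelocity hY
  exact ⟨u, GeneralizedYoungMeasure.ae_eq_barycenter hY hu,
    GeneralizedYoungMeasure.isDissipativeSolution_of_isVelocity hY hv₀ hu⟩
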